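/- **Manifold.** Let $M$ be a smooth four-dimensional manifold (Hausdorff, $\sigma$-compact) with a global smooth frame $e_0,\dots,e_3$, and give $M$ the metric $g$ of signature $(+,-,-,-)$ for which $(e_a)$ is orthonormal, so that the spinor bundle is $M\times S$ with $S=\mathbb C^4$. Let $\gamma^a$ be the chiral gamma matrices $$\gamma^0=\begin{pmatrix}0&1_2\\1_2&0\end{pmatrix},\qquad \gamma^k=\begin{pmatrix}0&-\sigma_k\\ \sigma_k&0\end{pmatrix}\ (k=1,2,3),\qquad \sigma_1,\sigma_2,\sigma_3\text{ the Pauli matrices},$$ let $\chi_S=\mathrm{diag}(1,1,-1,-1)$, $J_S\psi=\gamma^2\bar\psi$, and let $D_M=i\sum_a\gamma^a\nabla_{e_a}$ be the canonical Dirac operator, $\nabla$ being the spin connection of the Levi-Civita connection of $g$. Write $\tilde C_c^\infty(M,V)$ for the smooth $V$-valued functions that are constant outside a compact set. **Finite part.** Let $N$ be the number of generations, $K_0=(\mathbb C^2\oplus\mathbb C^2\otimes\mathbb C^3)\otimes\mathbb C^N$ (lepton doublet $(\nu,e)$, quark doublet $(u,d)$ with colour) and $K_F=K_R\oplus K_L\oplus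 K_{\bar R}\oplus K_{\bar L}$, four copies of $K_0$; $4\times4$ block matrices refer to this decomposition. For a $2\times2$ matrix $a$ put $\tilde a=(a\oplus a\otimes 1_3)\otimes 1_N$. The algebra $A_F^{ext}=\mathbb C\oplus\mathbb H\oplus M_3(\mathbb C)\oplus\mathbb C$ acts on $K_F$ by $$\pi^{ext}_F(\lambda,q,m,\mu)=[\,\tilde q_\lambda,\ \tilde q,\ (\mu 1_2\oplus 1_2\otimes m)\otimes 1_N,\ (\mu 1_2\oplus 1_2\otimes m)\otimes 1_N\,],\qquad q_\lambda=\mathrm{diag}(\lambda,\bar\lambda)$$ (block diagonal; a quaternion is regarded as a complex $2\times2$ matrix), and $A_F=\mathbb C\oplus\mathbb H\oplus M_3(\mathbb C)$ acts by $\pi_F(\lambda,q,m)=\pi_F^{ext}(\lambda,q,m,\lambda)$. Let $s\in\{1,-1\}$, let $Y_\nu,Y_e,Y_u,Y_d,m_0\in M_N(\mathbb C)$ with $m_0^T=-s\,m_0$, and put $$Y_0=\mathrm{diag}(Y_\nu,Y_e)\oplus\mathrm{diag}(1_3\otimes Y_u,1_3\otimes Y_d),\qquad M_0=\mathrm{diag}(m_0,0)\oplus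 0,$$ $$\chi_F=[1,-1,-1,1],\quad \eta_F=[1,-1,s,-s],\quad J_F(v_1,v_2,v_3,v_4)=(-\bar v_3,-\bar v_4,\bar v_1,\bar v_2),$$ $$D_F=\begin{pmatrix}0&-Y_0^\dagger&sM_0^\dagger&0\\ Y_0&0&0&0\\ M_0&0&0&-Y_0^T\\ 0&0&Y_0^*&0\end{pmatrix},$$ where $Y_0^*$ is the entrywise complex conjugate of $Y_0$. **Backgrounds.** On $K=\Gamma_c^\infty(M,S\otimes K_F)$ put $D=D_M\otimes 1+\chi_S\otimes D_F$ (that is, $D_M\hat\otimes 1+1\hat\otimes D_F$), $J=J_S\otimes J_F\chi_F$, and the Krein product $$(\psi,\phi)=\int_M\langle\psi,(\gamma^0\otimes\chi_F\eta_F)\phi\rangle\,\mathrm{vol}_g .$$ Write $T^\times$ for the adjoint of an operator $T$ on $K$ with respect to the Krein product, when it exists, and $T^\circ=JT^\times J^{-1}$. Let $\mathcal A$ be the algebra of multiplication operators by fields in $\tilde C_c^\infty(M,\pi_F(A_F))$, let $\mathcal A^{ext}$ be that of $\tilde C_c^\infty(M,\pi_F^{ext}(A_F^{ext}))$, and let $\hat{\mathcal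 A}^{ext}$ be the real algebra generated by $\mathcal A^{ext}$ and $(\mathcal A^{ext})^\circ$ (the algebra of the $J$-symmetrized extended background). **Forms and curvature.** For a real algebra $\mathcal B$ of operators on $K$, the one-forms of $\mathcal B$ are the finite sums $\sum_j a_j[D,b_j]$ with $a_j,b_j\in\mathcal B$; the junk two-forms are the operators $\sum_j[D,a_j][D,b_j]$ with $\sum_j a_j[D,b_j]=0$. Modulo junk, $d_D\big(\sum_j a_j[D,b_j]\big)=\sum_j[D,a_j][D,b_j]$ is well defined on one-forms, and the curvature of a one-form $\omega$ is $\rho(\omega)=d_D\omega+\omega^2$ modulo junk. Below, one-forms (unless stated otherwise), junk and curvatures are those of $\hat{\mathcal A}^{ext}$. **Fields.** Let $A_0,\dots,A_3$ be smooth compactly supported fields on $M$ with values in $\pi_F(A_F)$ that are anti-self-adjoint ($\eta_F A_a^\dagger\eta_F=-A_a$) and tracefree ($\mathrm{Tr}\,A_a=0$), let $q\in\tilde C_c^\infty(M,\mathbb H)$, let $Z'_0,\dots,Z'_3$ be smooth compactly supported real functions on $M$ and let $z\in\tilde C_c^\infty(M,\mathbb C)$. With $$\Phi(q)=\begin{pmatrix}0&-Y_0^\dagger\tilde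 q^\dagger&0&0\\ \tilde q\,Y_0&0&0&0\\0&0&0&0\\0&0&0&0\end{pmatrix},\qquad \sigma(z)=\begin{pmatrix}0&0&s(zM_0)^\dagger&0\\0&0&0&0\\ zM_0&0&0&0\\0&0&0&0\end{pmatrix},$$ $$t_{B-L}=i\,[\,\tau,\tau,-\tau,-\tau\,],\qquad \tau=\big({-1_2}\oplus\tfrac13 1_2\otimes1_3\big)\otimes 1_N,$$ put $$\omega_{SM}=\sum_a i\gamma^a\otimes A_a+\chi_S\otimes\Phi(q-1),\qquad \omega_\sigma=\sum_a i\gamma^a\otimes Z'_a\,t_{B-L}+\chi_S\otimes\sigma(z-1).$$ **Proposition.** $\omega_{SM}$ is a one-form of $\mathcal A$ and has a Krein adjoint; $\omega_{SM}$, $\omega_\sigma$ and $$\hat\omega=\omega_{SM}+\omega_{SM}^\circ+\omega_\sigma$$ are one-forms of $\hat{\mathcal A}^{ext}$; and, modulo junk, $$\rho(\hat\omega)=\rho(\omega_{SM})+\rho(\omega_{SM})^\circ+\rho(\omega_\sigma).$$ Here $\rho(\omega_{SM})^\circ$ is the class of $R^\circ$ for an operator $R$ representing $\rho(\omega_{SM})$: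 every such $R$ has a Krein adjoint, and the equality holds for every choice of $R$. -/

import Mathlib

open scoped Manifold ContDiff Kronecker TensorProduct Quaternion
open Module

set_option linter.unusedSectionVars false

namespace NCSM
noncomputable section

/-- The model space of a four-dimensional manifold. -/
abbrev E4 : Type := EuclideanSpace ℝ (Fin 4)

section Geometry
variable (M : Type*) [TopologicalSpace M] [ChartedSpace E4 M] [IsManifold (𝓡 4) ∞ M]

/-- A global smooth frame `e₀, …, e₃` of the tangent bundle. It carries the metric of signature
`(+,-,-,-)` for which it is orthonormal, see `Tetrad.metric`; the spinor bundle is then `M × ℂ⁴`. -/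
structure Tetrad where
  e : Fin 4 → (x : M) → TangentSpace (𝓡 4) x
  smooth : ∀ a, ContMDiff (𝓡 4) (𝓡 4).tangent ∞ (fun x => (⟨x, e a x⟩ : TangentBundle (𝓡 4) M))
  linIndep : ∀ x, LinearIndependent ℝ (fun a => e a x)

variable {M}

def Tetrad.basis (t : Tetrad M) (x : M) : Basis (Fin 4) ℝ (TangentSpace (𝓡 4) x) :=
  basisOfLinearIndependentOfCardEqFinrank (t.linIndep x)
    (by rw [Fintype.card_fin]; exact (finrank_euclideanSpace_fin (𝕜 := ℝ) (n := 4)).symm)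

/-- The dual coframe. -/
def Tetrad.coframe (t : Tetrad M) (a : Fin 4) (x : M) (v : TangentSpace (𝓡 4) x) : ℝ :=
  (t.basis x).repr v a

/-- The derivative `e_a(f)` of a vector-valued function. -/
def Tetrad.deriv (t : Tetrad M) {F : Type*} [NormedAddCommGroup F] [NormedSpace ℝ F] (a : Fin 4)
    (f : M → F) (x : M) : F :=
  mfderiv (𝓡 4) 𝓘(ℝ, F) f x (t.e a x)

theorem Tetrad.contMDiff_deriv (t : Tetrad M) {F : Type*} [NormedAddCommGroup F] [NormedSpace ℝ F]
    (a : Fin 4) {f : M → F} (hf : ContMDiff (𝓡 4) 𝓘(ℝ, F) ∞ f) :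
    ContMDiff (𝓡 4) 𝓘(ℝ, F) ∞ (t.deriv a f) := by
  have : IsManifold (𝓡 4) 1 M := IsManifold.of_le (n := ∞) (by norm_cast)
  have h1 := hf.contMDiff_tangentMap (m := ∞) (n := ∞) le_rfl
  have h2 := h1.comp (t.smooth a)
  exact (contMDiff_snd_tangentBundle_modelSpace F 𝓘(ℝ, F)).comp h2

theorem Tetrad.deriv_add (t : Tetrad M) {F : Type*} [NormedAddCommGroup F] [NormedSpace ℝ F]
    (a : Fin 4) {f g : M → F} (hf : ContMDiff (𝓡 4) 𝓘(ℝ, F) ∞ f)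
    (hg : ContMDiff (𝓡 4) 𝓘(ℝ, F) ∞ g) (x : M) :
    t.deriv a (f + g) x = t.deriv a f x + t.deriv a g x := by
  have hf' := (hf.mdifferentiable (by simp)) x
  have hg' := (hg.mdifferentiable (by simp)) x
  unfold Tetrad.deriv
  rw [mfderiv_add hf' hg']
  rfl

theorem Tetrad.deriv_clm (t : Tetrad M) {F : Type*} [NormedAddCommGroup F] [NormedSpace ℝ F]
    (a : Fin 4) {f : M → F} (hf : ContMDiff (𝓡 4) 𝓘(ℝ, F) ∞ f) (L : F →L[ℝ] F) (x : M) :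
    t.deriv a (fun y => L (f y)) x = L (t.deriv a f x) := by
  have hf' := (hf.mdifferentiable (by simp)) x
  have h := (L.hasMFDerivAt (x := f x)).comp x hf'.hasMFDerivAt
  unfold Tetrad.deriv
  have h2 : mfderiv (𝓡 4) 𝓘(ℝ, F) (fun y => L (f y)) x = _ := h.mfderiv
  rw [h2]
  rfl

theorem Tetrad.deriv_eq_zero (t : Tetrad M) {F : Type*} [NormedAddCommGroup F] [NormedSpace ℝ F]
    (a : Fin 4) {f : M → F} {x : M} (hx : x ∉ tsupport f) : t.deriv a f x = 0 := by
  have h : f =ᶠ[nhds x] fun _ => (0 : F) := notMem_tsupport_iff_eventuallyEq.mp hx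
  unfold Tetrad.deriv
  rw [h.mfderiv_eq, mfderiv_const]
  rfl

theorem contMDiffAt_det {n : Type*} [Fintype n] [DecidableEq n] {A : M → Matrix n n ℝ} {x : M}
    (hA : ∀ i j, ContMDiffAt (𝓡 4) 𝓘(ℝ, ℝ) ∞ (fun y => A y i j) x) :
    ContMDiffAt (𝓡 4) 𝓘(ℝ, ℝ) ∞ (fun y => (A y).det) x := by
  simp only [Matrix.det_apply']
  refine ContMDiffAt.sum fun σ _ => ?_
  refine ContMDiffAt.mul contMDiffAt_const ?_
  exact ContMDiffAt.prod fun i _ => hA _ _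

open Bundle in
theorem Tetrad.contMDiff_coframe (t : Tetrad M) (a : Fin 4)
    {X : (x : M) → TangentSpace (𝓡 4) x}
    (hX : ContMDiff (𝓡 4) (𝓡 4).tangent ∞ (fun x => (⟨x, X x⟩ : TangentBundle (𝓡 4) M))) :
    ContMDiff (𝓡 4) 𝓘(ℝ, ℝ) ∞ (fun x => t.coframe a x (X x)) := by
  intro x₀
  have : IsManifold (𝓡 4) 1 M := IsManifold.of_le (n := ∞) (by norm_cast)
  let b : Basis (Fin 4) ℝ E4 := (EuclideanSpace.basisFun (Fin 4) ℝ).toBasis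
  let φ := trivializationAt E4 (TangentSpace (𝓡 4) : M → Type _) x₀
  have hx₀ : x₀ ∈ φ.baseSet := FiberBundle.mem_baseSet_trivializationAt' x₀
  let c : ((x : M) → TangentSpace (𝓡 4) x) → M → Fin 4 → ℝ :=
    fun Y x k => φ.localFrameCoeff (𝓡 4) b k x (Y x)
  have hc : ∀ Y : (x : M) → TangentSpace (𝓡 4) x,
      ContMDiff (𝓡 4) (𝓡 4).tangent ∞ (fun x => (⟨x, Y x⟩ : TangentBundle (𝓡 4) M)) →
      ∀ k, ContMDiffAt (𝓡 4) 𝓘(ℝ, ℝ) ∞ (fun x => c Y x k) x₀ := fun Y hY k =>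
    contMDiffAt_localFrameCoeff b hx₀ (hY x₀) k
  let P : M → Matrix (Fin 4) (Fin 4) ℝ := fun x => Matrix.of fun k a => c (t.e a) x k
  have key : ∀ x ∈ φ.baseSet, (P x).det ≠ 0 ∧
      t.coframe a x (X x) = ((P x).updateCol a (c X x)).det / (P x).det := by
    intro x hx
    let B := φ.basisAt b hx
    have hcB : ∀ Y : (x : M) → TangentSpace (𝓡 4) x, c Y x = B.repr (Y x) := by
      intro Y
      funext k
      exact Trivialization.localFrameCoeff_apply_of_mem_baseSet φ b hx Y k
    have hbas : ∀ a, t.basis x a = t.e a x := by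
      intro a
      simp [Tetrad.basis]
    have hP : P x = B.toMatrix (t.basis x) := by
      ext k a
      simp [P, hcB, Basis.toMatrix_apply, hbas]
    have hdet : (P x).det ≠ 0 := by
      have h := congrArg Matrix.det (B.toMatrix_mul_toMatrix_flip (t.basis x))
      rw [Matrix.det_mul, Matrix.det_one, ← hP] at h
      intro h0
      simp [h0] at h
    refine ⟨hdet, ?_⟩
    have hv : c X x = (P x).mulVec ((t.basis x).repr (X x)) := by
      rw [hcB, hP, Basis.toMatrix_mulVec_repr]
    rw [← Matrix.cramer_apply, Matrix.cramer_eq_adjugate_mulVec, hv, Matrix.mulVec_mulVec,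
      Matrix.adjugate_mul, Matrix.smul_mulVec, Matrix.one_mulVec, Pi.smul_apply, smul_eq_mul,
      mul_div_cancel_left₀ _ hdet]
    rfl
  have hnum : ContMDiffAt (𝓡 4) 𝓘(ℝ, ℝ) ∞ (fun x => ((P x).updateCol a (c X x)).det) x₀ := by
    refine contMDiffAt_det fun i j => ?_
    by_cases h : j = a
    · subst h
      simpa [Matrix.updateCol_self] using hc X hX i
    · simpa [Matrix.updateCol_ne h, P] using hc (t.e j) (t.smooth j) i
  have hden : ContMDiffAt (𝓡 4) 𝓘(ℝ, ℝ) ∞ (fun x => (P x).det) x₀ :=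
    contMDiffAt_det fun i j => hc (t.e j) (t.smooth j) i
  refine (hnum.div₀ hden (key x₀ hx₀).1).congr_of_eventuallyEq ?_
  filter_upwards [φ.open_baseSet.mem_nhds hx₀] with x hx
  exact (key x hx).2

/-- The metric of signature `(+,-,-,-)` for which the tetrad is orthonormal. -/
def Tetrad.metric (t : Tetrad M) (x : M) (v w : TangentSpace (𝓡 4) x) : ℝ :=
  t.coframe 0 x v * t.coframe 0 x w - ∑ k : Fin 3, t.coframe k.succ x v * t.coframe k.succ x w

theorem Tetrad.contMDiff_bracket (t : Tetrad M) (a b : Fin 4) :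
    ContMDiff (𝓡 4) (𝓡 4).tangent ∞ (fun x =>
      (⟨x, VectorField.mlieBracket (𝓡 4) (t.e a) (t.e b) x⟩ : TangentBundle (𝓡 4) M)) := by
  intro x
  have : IsManifold (𝓡 4) (minSmoothness ℝ 2) M := by
    rw [minSmoothness_of_isRCLikeNormedField]
    exact IsManifold.of_le (n := ∞) (by norm_cast)
  have : IsManifold (𝓡 4) (((⊤ : ℕ∞) : WithTop ℕ∞) + 1) M := inferInstanceAs (IsManifold (𝓡 4) ∞ M)
  refine ContMDiffAt.mlieBracket_vectorField (m := ⊤) (n := ⊤) (t.smooth a x) (t.smooth b x) ?_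
  rw [minSmoothness_of_isRCLikeNormedField]
  rfl

/-- `g(∇_{e_a} e_b, e_c)` for the Levi-Civita connection, by the Koszul formula in the orthonormal
frame. -/
def Tetrad.connection (t : Tetrad M) (a b c : Fin 4) (x : M) : ℝ :=
  (1 / 2) * (t.metric x (VectorField.mlieBracket (𝓡 4) (t.e a) (t.e b) x) (t.e c x)
    - t.metric x (VectorField.mlieBracket (𝓡 4) (t.e b) (t.e c) x) (t.e a x)
    + t.metric x (VectorField.mlieBracket (𝓡 4) (t.e c) (t.e a) x) (t.e b x))

theorem Tetrad.contMDiff_metric (t : Tetrad M) {X Y : (x : M) → TangentSpace (𝓡 4) x}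
    (hX : ContMDiff (𝓡 4) (𝓡 4).tangent ∞ (fun x => (⟨x, X x⟩ : TangentBundle (𝓡 4) M)))
    (hY : ContMDiff (𝓡 4) (𝓡 4).tangent ∞ (fun x => (⟨x, Y x⟩ : TangentBundle (𝓡 4) M))) :
    ContMDiff (𝓡 4) 𝓘(ℝ, ℝ) ∞ (fun x => t.metric x (X x) (Y x)) := by
  unfold Tetrad.metric
  refine ContMDiff.sub ((t.contMDiff_coframe 0 hX).mul (t.contMDiff_coframe 0 hY)) ?_
  exact ContMDiff.sum fun k _ => (t.contMDiff_coframe _ hX).mul (t.contMDiff_coframe _ hY)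

theorem Tetrad.contMDiff_connection (t : Tetrad M) (a b c : Fin 4) :
    ContMDiff (𝓡 4) 𝓘(ℝ, ℝ) ∞ (t.connection a b c) := by
  unfold Tetrad.connection
  refine ContMDiff.mul contMDiff_const ?_
  exact ((t.contMDiff_metric (t.contMDiff_bracket a b) (t.smooth c)).sub
    (t.contMDiff_metric (t.contMDiff_bracket b c) (t.smooth a))).add
    (t.contMDiff_metric (t.contMDiff_bracket c a) (t.smooth b))

end Geometry

section Volume
variable {M : Type*} [TopologicalSpace M] [ChartedSpace E4 M] [IsManifold (𝓡 4) ∞ M]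
  [T2Space M] [SigmaCompactSpace M]

/-- The density of the volume form `vol_g` in the chart at `i`, i.e. the square root of `|det g|`,
which is `|det e|⁻¹`. -/
def Tetrad.volDensity (t : Tetrad M) (i x : M) : ℝ :=
  |(Matrix.of fun k a : Fin 4 =>
    let v : E4 := mfderiv (𝓡 4) 𝓘(ℝ, E4) (chartAt E4 i) x (t.e a x)
    v k).det|⁻¹

variable (M) in
/-- A smooth partition of unity subordinate to the chart domains. -/
def chartPartition : SmoothPartitionOfUnity M (𝓡 4) M Set.univ :=
  (SmoothPartitionOfUnity.exists_isSubordinate_chartAt_source (𝓡 4) M).choose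

/-- `∫_M f vol_g` for compactly supported `f`, through charts and a partition of unity. -/
def Tetrad.integral (t : Tetrad M) (f : M → ℂ) : ℂ :=
  ∑ᶠ i : M, ∫ y in (chartAt E4 i).target,
    (chartPartition M i ((chartAt E4 i).symm y) * t.volDensity i ((chartAt E4 i).symm y)) •
      f ((chartAt E4 i).symm y)

end Volume

section Finite

/-- Basis of `K₀ = (ℂ² ⊕ ℂ² ⊗ ℂ³) ⊗ ℂᴺ`: lepton doublet `(ν, e)`, quark doublet `(u, d)` with
colour, and generations. -/
abbrev GenIdx (N : ℕ) : Type := (Fin 2 ⊕ Fin 2 × Fin 3) × Fin N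
/-- Basis of `K_F = K_R ⊕ K_L ⊕ K_R̄ ⊕ K_L̄`; the `Fin 4` factor is `(R, L, R̄, L̄)`. -/
abbrev FinIdx (N : ℕ) : Type := Fin 4 × GenIdx N
/-- Basis of the fibre `S ⊗ K_F`. -/
abbrev TotIdx (N : ℕ) : Type := Fin 4 × FinIdx N

/-- A `4 × 4` block matrix on `K_F` with entries in `End K₀`. -/
def blocks {N : ℕ} (X : Matrix (Fin 4) (Fin 4) (Matrix (GenIdx N) (GenIdx N) ℂ)) :
    Matrix (FinIdx N) (FinIdx N) ℂ :=
  Matrix.comp _ _ _ _ _ X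

/-- A quaternion as a complex `2 × 2` matrix. -/
def quatMat (q : ℍ[ℝ]) : Matrix (Fin 2) (Fin 2) ℂ :=
  !![⟨q.re, q.imI⟩, ⟨q.imJ, q.imK⟩; ⟨-q.imJ, q.imK⟩, ⟨q.re, -q.imI⟩]

/-- The operator `(a ⊕ b) ⊗ g` on `K₀`. -/
def lepQua {N : ℕ} (a : Matrix (Fin 2) (Fin 2) ℂ) (b : Matrix (Fin 2 × Fin 3) (Fin 2 × Fin 3) ℂ)
    (g : Matrix (Fin N) (Fin N) ℂ) : Matrix (GenIdx N) (GenIdx N) ℂ :=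
  (Matrix.fromBlocks a 0 0 b) ⊗ₖ g

/-- `ã = (a ⊕ a ⊗ 1) ⊗ 1`. -/
def tilde (N : ℕ) (a : Matrix (Fin 2) (Fin 2) ℂ) : Matrix (GenIdx N) (GenIdx N) ℂ :=
  lepQua a (a ⊗ₖ 1) 1

/-- The representation of `A_F^ext = ℂ ⊕ ℍ ⊕ M₃(ℂ) ⊕ ℂ` on `K_F`. -/
def piFExt (N : ℕ) (l : ℂ) (q : ℍ[ℝ]) (m : Matrix (Fin 3) (Fin 3) ℂ) (μ : ℂ) :
    Matrix (FinIdx N) (FinIdx N) ℂ :=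
  blocks (Matrix.diagonal
    ![tilde N !![l, 0; 0, star l], tilde N (quatMat q), lepQua (μ • 1) (1 ⊗ₖ m) 1,
      lepQua (μ • 1) (1 ⊗ₖ m) 1])

/-- The representation of `A_F = ℂ ⊕ ℍ ⊕ M₃(ℂ)` on `K_F`. -/
def piF (N : ℕ) (l : ℂ) (q : ℍ[ℝ]) (m : Matrix (Fin 3) (Fin 3) ℂ) :
    Matrix (FinIdx N) (FinIdx N) ℂ :=
  piFExt N l q m l

/-- The image `π_F(A_F)`. -/
def AF (N : ℕ) : Set (Matrix (FinIdx N) (FinIdx N) ℂ) := {b | ∃ l q m, b = piF N l q m}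

/-- The image `π_F^ext(A_F^ext)`. -/
def AFExt (N : ℕ) : Set (Matrix (FinIdx N) (FinIdx N) ℂ) := {b | ∃ l q m μ, b = piFExt N l q m μ}

/-- The finite chirality. -/
def chiF (N : ℕ) : Matrix (FinIdx N) (FinIdx N) ℂ := blocks (Matrix.diagonal ![1, -1, -1, 1])

/-- The matrix of the finite real structure: `J_F v = JFMat · v̄`, i.e.
`J_F (φ ⊗ σ) = φ̄ ⊗ σ̄` where `σ ↦ σ̄` squares to `-1`. -/
def JFMat (N : ℕ) : Matrix (FinIdx N) (FinIdx N) ℂ :=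
  blocks !![0, 0, -1, 0; 0, 0, 0, -1; 1, 0, 0, 0; 0, 1, 0, 0]

/-- The sign `s`, the Yukawa matrices and the Majorana matrix. -/
structure YukawaData (N : ℕ) where
  s : ℤˣ
  Yν : Matrix (Fin N) (Fin N) ℂ
  Ye : Matrix (Fin N) (Fin N) ℂ
  Yu : Matrix (Fin N) (Fin N) ℂ
  Yd : Matrix (Fin N) (Fin N) ℂ
  m₀ : Matrix (Fin N) (Fin N) ℂ
  m₀_transpose : m₀.transpose = -((s : ℤ) : ℂ) • m₀

variable {N : ℕ}

def YukawaData.sgn (y : YukawaData N) : ℂ := ((y.s : ℤ) : ℂ)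

/-- The internal metric `η_F = [1, -1, s, -s]`. -/
def YukawaData.etaF (y : YukawaData N) : Matrix (FinIdx N) (FinIdx N) ℂ :=
  blocks (Matrix.diagonal ![1, -1, y.sgn • 1, -(y.sgn • 1)])

/-- The effective internal metric `χ_F η_F = [1, 1, -s, -s]`. -/
def YukawaData.omegaF (y : YukawaData N) : Matrix (FinIdx N) (FinIdx N) ℂ := chiF N * y.etaF

/-- `Y₀ = diag(Y_ν, Y_e) ⊕ diag(1₃ ⊗ Y_u, 1₃ ⊗ Y_d)`. -/
def YukawaData.Y₀ (y : YukawaData N) : Matrix (GenIdx N) (GenIdx N) ℂ :=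
  lepQua !![1, 0; 0, 0] 0 y.Yν + lepQua !![0, 0; 0, 1] 0 y.Ye +
    lepQua 0 (!![1, 0; 0, 0] ⊗ₖ 1) y.Yu + lepQua 0 (!![0, 0; 0, 1] ⊗ₖ 1) y.Yd

/-- `M₀ = p_ν ⊗ m₀`. -/
def YukawaData.M₀ (y : YukawaData N) : Matrix (GenIdx N) (GenIdx N) ℂ :=
  lepQua !![1, 0; 0, 0] 0 y.m₀

/-- The finite Dirac operator. -/
def YukawaData.DF (y : YukawaData N) : Matrix (FinIdx N) (FinIdx N) ℂ :=
  blocks !![0, -y.Y₀.conjTranspose, y.sgn • y.M₀.conjTranspose, 0;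
            y.Y₀, 0, 0, 0;
            y.M₀, 0, 0, -y.Y₀.transpose;
            0, 0, y.Y₀.map star, 0]

/-- The Krein self-adjoint finite one-form `Φ(q)` of the Higgs field. -/
def YukawaData.Phi (y : YukawaData N) (q : ℍ[ℝ]) : Matrix (FinIdx N) (FinIdx N) ℂ :=
  blocks !![0, -(y.Y₀.conjTranspose * (tilde N (quatMat q)).conjTranspose), 0, 0;
            tilde N (quatMat q) * y.Y₀, 0, 0, 0;
            0, 0, 0, 0;
            0, 0, 0, 0]

/-- The finite one-form `σ(z)`, with Majorana matrix `z m₀`. -/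
def YukawaData.sigma (y : YukawaData N) (z : ℂ) : Matrix (FinIdx N) (FinIdx N) ℂ :=
  blocks !![0, 0, y.sgn • (z • y.M₀).conjTranspose, 0;
            0, 0, 0, 0;
            z • y.M₀, 0, 0, 0;
            0, 0, 0, 0]

/-- The generator of the `B - L` symmetry. -/
def tBL (N : ℕ) : Matrix (FinIdx N) (FinIdx N) ℂ :=
  Complex.I • blocks (Matrix.diagonal
    ![lepQua (-1) ((1 / 3 : ℂ) • 1) 1, lepQua (-1) ((1 / 3 : ℂ) • 1) 1,
      lepQua 1 (-(1 / 3 : ℂ) • 1) 1, lepQua 1 (-(1 / 3 : ℂ) • 1) 1])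

end Finite

section Dirac

/-- The gamma matrices `γ⁰, …, γ³` (upper index); `γ(e₀) = γ⁰` and `γ(e_k) = -γᵏ`. -/
def gam : Fin 4 → Matrix (Fin 4) (Fin 4) ℂ :=
  ![!![0, 0, 1, 0; 0, 0, 0, 1; 1, 0, 0, 0; 0, 1, 0, 0],
    !![0, 0, 0, -1; 0, 0, -1, 0; 0, 1, 0, 0; 1, 0, 0, 0],
    !![0, 0, 0, Complex.I; 0, 0, -Complex.I, 0; 0, -Complex.I, 0, 0; Complex.I, 0, 0, 0],
    !![0, 0, -1, 0; 0, 0, 0, 1; 1, 0, 0, 0; 0, -1, 0, 0]]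

/-- The chirality `γ₅ = i γ⁰γ¹γ²γ³` of `S`. -/
def chiS : Matrix (Fin 4) (Fin 4) ℂ := Matrix.diagonal ![1, 1, -1, -1]

end Dirac

section Fields
variable {M : Type*} [TopologicalSpace M] [ChartedSpace E4 M] [IsManifold (𝓡 4) ∞ M]

theorem contMDiff_cmul {f g : M → ℂ} (hf : ContMDiff (𝓡 4) 𝓘(ℝ, ℂ) ∞ f)
    (hg : ContMDiff (𝓡 4) 𝓘(ℝ, ℂ) ∞ g) : ContMDiff (𝓡 4) 𝓘(ℝ, ℂ) ∞ (fun x => f x * g x) :=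
  (ContDiff.contMDiff (contDiff_mul (𝕜 := ℝ) (𝔸 := ℂ))).comp (hf.prodMk_space hg)

/-- A matrix-valued function with smooth entries. -/
def SmoothMat {m n : Type*} (T : M → Matrix m n ℂ) : Prop :=
  ∀ i j, ContMDiff (𝓡 4) 𝓘(ℝ, ℂ) ∞ (fun x => T x i j)

theorem SmoothMat.const {m n : Type*} (C : Matrix m n ℂ) : SmoothMat (fun _ : M => C) :=
  fun _ _ => contMDiff_const

theorem SmoothMat.add {m n : Type*} {S T : M → Matrix m n ℂ} (hS : SmoothMat S)
    (hT : SmoothMat T) : SmoothMat (fun x => S x + T x) :=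
  fun i j => (hS i j).add (hT i j)

theorem SmoothMat.neg {m n : Type*} {T : M → Matrix m n ℂ} (hT : SmoothMat T) :
    SmoothMat (fun x => -T x) := fun i j => (hT i j).neg

theorem SmoothMat.sum {ι m n : Type*} (u : Finset ι) {T : ι → M → Matrix m n ℂ}
    (hT : ∀ i, SmoothMat (T i)) : SmoothMat (fun x => ∑ i ∈ u, T i x) := by
  intro i j
  simp only [Matrix.sum_apply]
  exact ContMDiff.sum fun k _ => hT k i j

theorem SmoothMat.mul {l m n : Type*} [Fintype m] {S : M → Matrix l m ℂ} {T : M → Matrix m n ℂ}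
    (hS : SmoothMat S) (hT : SmoothMat T) : SmoothMat (fun x => S x * T x) := by
  intro i j
  simp only [Matrix.mul_apply]
  exact ContMDiff.sum fun k _ => contMDiff_cmul (hS i k) (hT k j)

theorem SmoothMat.kron {k l m n : Type*} {S : M → Matrix k l ℂ} {T : M → Matrix m n ℂ}
    (hS : SmoothMat S) (hT : SmoothMat T) : SmoothMat (fun x => S x ⊗ₖ T x) :=
  fun i j => contMDiff_cmul (hS i.1 j.1) (hT i.2 j.2)

theorem SmoothMat.smul {m n : Type*} {f : M → ℂ} {T : M → Matrix m n ℂ}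
    (hf : ContMDiff (𝓡 4) 𝓘(ℝ, ℂ) ∞ f) (hT : SmoothMat T) : SmoothMat (fun x => f x • T x) :=
  fun i j => contMDiff_cmul hf (hT i j)

theorem contMDiff_linear {V : Type*} [NormedAddCommGroup V] [NormedSpace ℝ V]
    [FiniteDimensional ℝ V] {f : M → V} (hf : ContMDiff (𝓡 4) 𝓘(ℝ, V) ∞ f) (L : V →ₗ[ℝ] ℂ) :
    ContMDiff (𝓡 4) 𝓘(ℝ, ℂ) ∞ (fun x => L (f x)) :=
  (LinearMap.toContinuousLinearMap L).contMDiff.comp hf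

theorem SmoothMat.conjTranspose {m n : Type*} {T : M → Matrix m n ℂ} (hT : SmoothMat T) :
    SmoothMat (fun x => (T x).conjTranspose) :=
  fun i j => contMDiff_linear (hT j i) Complex.conjAe.toLinearMap

theorem contMDiff_ofReal {f : M → ℝ} (hf : ContMDiff (𝓡 4) 𝓘(ℝ, ℝ) ∞ f) :
    ContMDiff (𝓡 4) 𝓘(ℝ, ℂ) ∞ (fun x => (f x : ℂ)) :=
  contMDiff_linear hf Complex.ofRealCLM.toLinearMap

theorem SmoothMat.quatMat {q : M → ℍ[ℝ]} (hq : ContMDiff (𝓡 4) 𝓘(ℝ, ℍ[ℝ]) ∞ q) :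
    SmoothMat (fun x => quatMat (q x)) := by
  have h : ∀ L : ℍ[ℝ] →ₗ[ℝ] ℂ, ContMDiff (𝓡 4) 𝓘(ℝ, ℂ) ∞ (fun x => L (q x)) :=
    fun L => contMDiff_linear hq L
  intro i j
  let L : ℍ[ℝ] →ₗ[ℝ] ℂ :=
    { toFun := fun p => NCSM.quatMat p i j
      map_add' := fun p r => by
        fin_cases i <;> fin_cases j <;> simp [NCSM.quatMat, Complex.ext_iff] <;> ring
      map_smul' := fun c p => by
        fin_cases i <;> fin_cases j <;> simp [NCSM.quatMat, Complex.ext_iff] }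
  exact h L

theorem SmoothMat.tilde (N : ℕ) {a : M → Matrix (Fin 2) (Fin 2) ℂ} (ha : SmoothMat a) :
    SmoothMat (fun x => tilde N (a x)) := by
  refine SmoothMat.kron ?_ (SmoothMat.const 1)
  rintro (i | i) (j | j)
  · exact ha i j
  · exact contMDiff_const
  · exact contMDiff_const
  · exact SmoothMat.kron ha (SmoothMat.const 1) i j

variable {N : ℕ}

theorem SmoothMat.blocks {X : M → Matrix (Fin 4) (Fin 4) (Matrix (GenIdx N) (GenIdx N) ℂ)}
    (hX : ∀ i j, SmoothMat (fun x => X x i j)) : SmoothMat (fun x => blocks (X x)) :=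
  fun i j => hX i.1 j.1 i.2 j.2

theorem SmoothMat.Phi (y : YukawaData N) {q : M → ℍ[ℝ]}
    (hq : ContMDiff (𝓡 4) 𝓘(ℝ, ℍ[ℝ]) ∞ q) : SmoothMat (fun x => y.Phi (q x)) := by
  have h1 := SmoothMat.tilde N (SmoothMat.quatMat hq)
  have h2 := h1.mul (SmoothMat.const y.Y₀)
  have h3 := ((SmoothMat.const y.Y₀.conjTranspose).mul h1.conjTranspose).neg
  have h0 : SmoothMat (fun _ : M => (0 : Matrix (GenIdx N) (GenIdx N) ℂ)) := SmoothMat.const _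
  refine SmoothMat.blocks fun i j => ?_
  fin_cases i <;> fin_cases j
  exacts [h0, h3, h0, h0, h2, h0, h0, h0, h0, h0, h0, h0, h0, h0, h0, h0]

theorem SmoothMat.sigma (y : YukawaData N) {z : M → ℂ}
    (hz : ContMDiff (𝓡 4) 𝓘(ℝ, ℂ) ∞ z) : SmoothMat (fun x => y.sigma (z x)) := by
  have h2 := SmoothMat.smul hz (SmoothMat.const y.M₀)
  have h3 := SmoothMat.smul (contMDiff_const (c := y.sgn)) h2.conjTranspose
  have h0 : SmoothMat (fun _ : M => (0 : Matrix (GenIdx N) (GenIdx N) ℂ)) := SmoothMat.const _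
  refine SmoothMat.blocks fun i j => ?_
  fin_cases i <;> fin_cases j
  exacts [h0, h0, h3, h0, h0, h0, h0, h0, h2, h0, h0, h0, h0, h0, h0, h0]

end Fields

section Operators
variable (M : Type*) [TopologicalSpace M] [ChartedSpace E4 M] [IsManifold (𝓡 4) ∞ M] (N : ℕ)

/-- The subspace `Γ_c^∞(S ⊗ K_F)` of smooth compactly supported fields. -/
def spinorSubmodule : Submodule ℂ (M → TotIdx N → ℂ) where
  carrier := {ψ | ContMDiff (𝓡 4) 𝓘(ℝ, TotIdx N → ℂ) ∞ ψ ∧ HasCompactSupport ψ}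
  add_mem' h h' := ⟨h.1.add h'.1, h.2.add h'.2⟩
  zero_mem' := ⟨contMDiff_const, HasCompactSupport.zero⟩
  smul_mem' c ψ h := by
    refine ⟨contMDiff_pi_space.2 fun i => ?_, h.2.smul_left (f := fun _ => c)⟩
    exact contMDiff_cmul contMDiff_const (contMDiff_pi_space.1 h.1 i)

/-- The space `K` of smooth compactly supported fields with values in `S ⊗ K_F`. -/
def Spinor : Type _ := spinorSubmodule M N

instance : AddCommGroup (Spinor M N) := inferInstanceAs (AddCommGroup (spinorSubmodule M N))

instance : Module ℂ (Spinor M N) := inferInstanceAs (Module ℂ (spinorSubmodule M N))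

/-- The `ℂ`-linear operators on that space, seen as an algebra over `ℝ` below. -/
abbrev Op : Type _ := Module.End ℂ (Spinor M N)

variable {M N}

/-- The zero-order operator `(T ψ)(x) = T(x) ψ(x)`. -/
def mulOp (T : M → Matrix (TotIdx N) (TotIdx N) ℂ) (hT : SmoothMat T) : Op M N where
  toFun ψ := Subtype.mk (p := (· ∈ spinorSubmodule M N)) (fun x => (T x).mulVec (ψ.1 x)) <| by
    refine ⟨contMDiff_pi_space.2 fun i => ?_, ψ.2.2.mono fun x hx h => hx (by simp [h])⟩
    simp only [Matrix.mulVec, dotProduct]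
    exact ContMDiff.sum fun j _ => contMDiff_cmul (hT i j) (contMDiff_pi_space.1 ψ.2.1 j)
  map_add' ψ φ := Subtype.ext <| funext fun x => Matrix.mulVec_add (T x) (ψ.1 x) (φ.1 x)
  map_smul' c ψ := Subtype.ext <| funext fun x => Matrix.mulVec_smul (T x) c (ψ.1 x)

/-- The operator `ψ ↦ e_a(ψ)`. -/
def derivOp (t : Tetrad M) (a : Fin 4) : Op M N where
  toFun ψ := Subtype.mk (p := (· ∈ spinorSubmodule M N)) (t.deriv a ψ.1)
    ⟨t.contMDiff_deriv a ψ.2.1, ψ.2.2.mono' fun _ hx =>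
      by_contra fun h => hx (t.deriv_eq_zero a h)⟩
  map_add' ψ φ := Subtype.ext <| funext fun x => t.deriv_add a ψ.2.1 φ.2.1 x
  map_smul' c ψ := Subtype.ext <| funext fun x =>
    t.deriv_clm a ψ.2.1
      ((c • ContinuousLinearMap.id ℂ (TotIdx N → ℂ)).restrictScalars ℝ) x

/-- The spin connection `Γ_a = ¼ ∑ g(e_b, ∇_{e_a} e_c) γᵇ γᶜ`, so that `[Γ_a, γ(e_d)] = γ(∇_{e_a} e_d)`. -/
def spinConnection (t : Tetrad M) (a : Fin 4) (x : M) : Matrix (Fin 4) (Fin 4) ℂ :=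
  (1 / 4 : ℂ) • ∑ b, ∑ c, ((t.connection a c b x : ℝ) : ℂ) • (gam b * gam c)

theorem smoothMat_spinConnection (t : Tetrad M) (a : Fin 4) : SmoothMat (spinConnection t a) :=
  SmoothMat.smul contMDiff_const <| SmoothMat.sum _ fun b => SmoothMat.sum _ fun c =>
    SmoothMat.smul (contMDiff_ofReal (t.contMDiff_connection a c b)) (SmoothMat.const _)

/-- The spinor covariant derivative `∇_{e_a} ⊗ 1`. -/
def nabla (t : Tetrad M) (a : Fin 4) : Op M N :=
  derivOp t a + mulOp (fun x => spinConnection t a x ⊗ₖ 1)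
    ((smoothMat_spinConnection t a).kron (SmoothMat.const 1))

/-- `D_M ⊗̂ 1` for the canonical Dirac operator `D_M = i γᵃ ∇_{e_a}`. -/
def diracM (t : Tetrad M) : Op M N :=
  ∑ a, mulOp (fun _ => (Complex.I • gam a) ⊗ₖ 1) (SmoothMat.const _) * nabla t a

/-- `D = D_M ⊗̂ 1 + 1 ⊗̂ D_F`. By the graded tensor product rule, `1 ⊗̂ B` is `χ_M ⊗ B` for odd `B`. -/
def dirac (t : Tetrad M) (y : YukawaData N) : Op M N :=
  diracM t + mulOp (fun _ => chiS ⊗ₖ y.DF) (SmoothMat.const _)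

variable (N) in
/-- The matrix of the local real structure `J_S ⊗ J_F χ_F`, with `J_S ψ = γ² ψ̄`. -/
def JMat : Matrix (TotIdx N) (TotIdx N) ℂ := gam 2 ⊗ₖ (JFMat N * chiF N)

theorem blocks_mul (X Y : Matrix (Fin 4) (Fin 4) (Matrix (GenIdx N) (GenIdx N) ℂ)) :
    blocks X * blocks Y = blocks (X * Y) :=
  ((Matrix.compRingEquiv (Fin 4) (GenIdx N) ℂ).map_mul X Y).symm

def swapMat (R : Type*) [Ring R] : Matrix (Fin 4) (Fin 4) R :=
  !![0, 0, 1, 0; 0, 0, 0, -1; 1, 0, 0, 0; 0, -1, 0, 0]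

theorem swapMat_sq (R : Type*) [Ring R] : swapMat R * swapMat R = 1 := by
  ext i j : 2
  fin_cases i <;> fin_cases j <;> simp [swapMat, Matrix.mul_apply, Fin.sum_univ_four]

theorem swapMat_eq (R : Type*) [Ring R] :
    !![0, 0, -1, 0; 0, 0, 0, -1; 1, 0, 0, 0; 0, 1, 0, 0] * Matrix.diagonal ![1, -1, -1, 1] =
      swapMat R := by
  ext i j : 2
  fin_cases i <;> fin_cases j <;> simp [swapMat]

theorem blocks_swapMat_star :
    (blocks (swapMat (Matrix (GenIdx N) (GenIdx N) ℂ))).map star = blocks (swapMat _) := by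
  have h : ∀ i j, (swapMat (Matrix (GenIdx N) (GenIdx N) ℂ) i j).map star = swapMat _ i j := by
    intro i j
    fin_cases i <;> fin_cases j <;> simp [swapMat, Matrix.map_neg]
  ext ⟨i, i'⟩ ⟨j, j'⟩
  exact congrFun (congrFun (h i j) i') j'

theorem blocks_one :
    blocks (1 : Matrix (Fin 4) (Fin 4) (Matrix (GenIdx N) (GenIdx N) ℂ)) = 1 :=
  Matrix.comp_one

theorem JMat_mul_conj : JMat N * (JMat N).map star = 1 := by
  have h1 : gam 2 * (gam 2).map star = 1 := by
    ext i j
    fin_cases i <;> fin_cases j <;> simp [gam, Matrix.mul_apply, Fin.sum_univ_four]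
  have h2 : JFMat N * chiF N = blocks (swapMat _) := by
    rw [JFMat, chiF, blocks_mul, swapMat_eq]
  have h5 : (JMat N).map star = (gam 2).map star ⊗ₖ (blocks (swapMat _)).map star := by
    rw [JMat, h2]
    ext i j
    exact star_mul' _ _
  rw [h5, JMat, h2, ← Matrix.mul_kronecker_mul, h1, blocks_swapMat_star, blocks_mul, swapMat_sq,
    blocks_one, Matrix.one_kronecker_one]

variable (M N) in
def JLin : Spinor M N →ₛₗ[starRingEnd ℂ] Spinor M N where
  toFun ψ := Subtype.mk (p := (· ∈ spinorSubmodule M N))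
    (fun x => (JMat N).mulVec (star (ψ.1 x))) <| by
    refine ⟨contMDiff_pi_space.2 fun i => ?_, ψ.2.2.mono fun x hx h => hx (by simp [h])⟩
    simp only [Matrix.mulVec, dotProduct]
    exact ContMDiff.sum fun j _ => contMDiff_cmul contMDiff_const
      (contMDiff_linear (contMDiff_pi_space.1 ψ.2.1 j) Complex.conjAe.toLinearMap)
  map_add' ψ φ := Subtype.ext <| funext fun x => by
    change (JMat N).mulVec (star (ψ.1 x + φ.1 x)) = _
    rw [star_add, Matrix.mulVec_add]
    rfl
  map_smul' c ψ := Subtype.ext <| funext fun x => by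
    change (JMat N).mulVec (star (c • ψ.1 x)) = _
    rw [star_smul, Matrix.mulVec_smul]
    rfl

theorem JLin_involutive : Function.Involutive (JLin M N) := fun ψ =>
  Subtype.ext <| funext fun x => by
    have h : star ((JMat N).mulVec (star (ψ.1 x))) = ((JMat N).map star).mulVec (ψ.1 x) := by
      ext i
      simp [Matrix.mulVec, dotProduct]
    change (JMat N).mulVec (star ((JMat N).mulVec (star (ψ.1 x)))) = ψ.1 x
    rw [h, Matrix.mulVec_mulVec, JMat_mul_conj, Matrix.one_mulVec]

variable (M N) in
/-- The real structure `J = J_M ⊗ J_F χ_F`; `J² = 1`. -/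
def realJ : Spinor M N ≃ₛₗ[starRingEnd ℂ] Spinor M N :=
  LinearEquiv.ofInvolutive (JLin M N) JLin_involutive

variable [T2Space M] [SigmaCompactSpace M]

/-- The Krein product `∫_M ⟨ψ, (γ₀ ⊗ ω_F) φ⟩ vol_g`. -/
def krein (t : Tetrad M) (y : YukawaData N) (ψ φ : Spinor M N) : ℂ :=
  t.integral fun x => dotProduct (star (ψ.1 x)) ((gam 0 ⊗ₖ y.omegaF).mulVec (φ.1 x))

/-- `B` is a Krein adjoint of `A`. -/
def IsKreinAdj (t : Tetrad M) (y : YukawaData N) (A B : Op M N) : Prop :=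
  ∀ ψ φ, krein t y (A ψ) φ = krein t y ψ (B φ)

open Classical in
/-- The Krein adjoint `A^×` (by convention `0` if `A` has none). -/
def kreinAdj (t : Tetrad M) (y : YukawaData N) (A : Op M N) : Op M N :=
  if h : ∃ B : Op M N, IsKreinAdj t y A B then h.choose else 0

/-- The linear anti-automorphism `A^o = J A^× J⁻¹`. -/
def opp (t : Tetrad M) (y : YukawaData N) (A : Op M N) : Op M N :=
  (realJ M N).toLinearMap.comp ((kreinAdj t y A).comp (realJ M N).symm.toLinearMap)

end Operators

section Forms
variable {E : Type*} [Ring E] [Algebra ℝ E]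

/-- `a ↦ [D, a]` on `A`. -/
def adMap (D : E) (A : Subalgebra ℝ E) : A →ₗ[ℝ] E :=
  (LinearMap.mulLeft ℝ D - LinearMap.mulRight ℝ D) ∘ₗ A.val.toLinearMap

/-- `∑ a_j ⊗ b_j ↦ ∑ a_j [D, b_j]`. -/
def formMap (D : E) (A : Subalgebra ℝ E) : A ⊗[ℝ] A →ₗ[ℝ] E :=
  LinearMap.mul' ℝ E ∘ₗ TensorProduct.map A.val.toLinearMap (adMap D A)

/-- `∑ a_j ⊗ b_j ↦ ∑ [D, a_j] [D, b_j]`. -/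
def dFormMap (D : E) (A : Subalgebra ℝ E) : A ⊗[ℝ] A →ₗ[ℝ] E :=
  LinearMap.mul' ℝ E ∘ₗ TensorProduct.map (adMap D A) (adMap D A)

/-- The bimodule of one-forms `∑ a_j [D, b_j]`. -/
def oneForms (D : E) (A : Subalgebra ℝ E) : Submodule ℝ E := LinearMap.range (formMap D A)

/-- The junk two-forms: `∑ [D, a_j] [D, b_j]` such that `∑ a_j [D, b_j] = 0`. -/
def junk (D : E) (A : Subalgebra ℝ E) : Submodule ℝ E :=
  (LinearMap.ker (formMap D A)).map (dFormMap D A)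

/-- Operators modulo junk two-forms. -/
def ModJunk (D : E) (A : Subalgebra ℝ E) : Type _ := E ⧸ junk D A

instance (D : E) (A : Subalgebra ℝ E) : AddCommGroup (ModJunk D A) :=
  inferInstanceAs (AddCommGroup (E ⧸ junk D A))

instance (D : E) (A : Subalgebra ℝ E) : Module ℝ (ModJunk D A) :=
  inferInstanceAs (Module ℝ (E ⧸ junk D A))

/-- The class of an operator modulo junk. -/
def modJunk (D : E) (A : Subalgebra ℝ E) : E →ₗ[ℝ] ModJunk D A := (junk D A).mkQ

/-- The differential `d_D (∑ a_j [D, b_j]) = ∑ [D, a_j] [D, b_j]` modulo junk. -/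
def extD (D : E) (A : Subalgebra ℝ E) : oneForms D A →ₗ[ℝ] ModJunk D A :=
  (LinearMap.ker (formMap D A)).mapQ (junk D A) (dFormMap D A) (Submodule.le_comap_map _ _) ∘ₗ
    (formMap D A).quotKerEquivRange.symm.toLinearMap

/-- The curvature `ρ_D(w) = d_D w + w²` modulo junk. -/
def curvature (D : E) (A : Subalgebra ℝ E) (w : oneForms D A) : ModJunk D A :=
  extD D A w + modJunk D A ((w : E) * (w : E))

end Forms

section Background
variable {M : Type*} [TopologicalSpace M] [ChartedSpace E4 M] [IsManifold (𝓡 4) ∞ M] {N : ℕ}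

/-- `∑ i γᵃ ⊗̂ B_a` for even `B_a`. -/
def gaugeOp (B : Fin 4 → M → Matrix (FinIdx N) (FinIdx N) ℂ) (hB : ∀ a, SmoothMat (B a)) :
    Op M N :=
  mulOp (fun x => ∑ a, (Complex.I • gam a) ⊗ₖ B a x)
    (SmoothMat.sum _ fun a => (SmoothMat.const _).kron (hB a))

/-- `1 ⊗̂ S` for odd `S`. -/
def oddOp (S : M → Matrix (FinIdx N) (FinIdx N) ℂ) (hS : SmoothMat S) : Op M N :=
  mulOp (fun x => chiS ⊗ₖ S x) ((SmoothMat.const _).kron hS)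

/-- Multiplication by the smooth `V`-valued fields that are constant outside a compact set. -/
def fieldOps (M : Type*) [TopologicalSpace M] [ChartedSpace E4 M] [IsManifold (𝓡 4) ∞ M]
    (V : Set (Matrix (FinIdx N) (FinIdx N) ℂ)) : Set (Op M N) :=
  {T | ∃ (B : M → Matrix (FinIdx N) (FinIdx N) ℂ) (hB : SmoothMat B),
    (∃ c, HasCompactSupport fun x => B x - c) ∧ (∀ x, B x ∈ V) ∧
      T = mulOp (fun x => 1 ⊗ₖ B x) ((SmoothMat.const _).kron hB)}

/-- The represented algebra `π(A)`, `A = C̃_c^∞(M, A_F)`, of the Standard Model background. -/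
def smAlgebra (M : Type*) [TopologicalSpace M] [ChartedSpace E4 M] [IsManifold (𝓡 4) ∞ M]
    (N : ℕ) : Subalgebra ℝ (Op M N) :=
  Algebra.adjoin ℝ (fieldOps M (AF N))

/-- The Standard Model fields: an anti-self-adjoint, tracefree gauge field `A_a` with values in
`π_F(A_F)`, and a Higgs field `q`. -/
structure SMFields (M : Type*) [TopologicalSpace M] [ChartedSpace E4 M] [IsManifold (𝓡 4) ∞ M]
    {N : ℕ} (y : YukawaData N) where
  A : Fin 4 → M → Matrix (FinIdx N) (FinIdx N) ℂ
  A_smooth : ∀ a, SmoothMat (A a)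
  A_compact : ∀ a, HasCompactSupport (A a)
  A_mem : ∀ a x, A a x ∈ AF N
  A_anti : ∀ a x, y.etaF * (A a x).conjTranspose * y.etaF = -A a x
  A_trace : ∀ a x, (A a x).trace = 0
  q : M → ℍ[ℝ]
  q_smooth : ContMDiff (𝓡 4) 𝓘(ℝ, ℍ[ℝ]) ∞ q
  q_const : ∃ c, HasCompactSupport fun x => q x - c

/-- The fields `Z'_{B-L}` and `σ` (the complex field `z`). -/
structure BLFields (M : Type*) [TopologicalSpace M] [ChartedSpace E4 M]
    [IsManifold (𝓡 4) ∞ M] where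
  Z : Fin 4 → M → ℝ
  Z_smooth : ∀ a, ContMDiff (𝓡 4) 𝓘(ℝ, ℝ) ∞ (Z a)
  Z_compact : ∀ a, HasCompactSupport (Z a)
  z : M → ℂ
  z_smooth : ContMDiff (𝓡 4) 𝓘(ℝ, ℂ) ∞ z
  z_const : ∃ c, HasCompactSupport fun x => z x - c

/-- `ω_SM = i γᵃ ⊗̂ A_a + 1 ⊗̂ Φ(q - 1)`. -/
def SMFields.form {y : YukawaData N} (f : SMFields M y) : Op M N :=
  gaugeOp f.A f.A_smooth +
    oddOp (fun x => y.Phi (f.q x - 1)) (SmoothMat.Phi y (f.q_smooth.sub contMDiff_const))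

/-- `ω_σ = i γᵃ ⊗̂ Z'_a t_{B-L} + 1 ⊗̂ σ(z - 1)`. -/
def BLFields.form (b : BLFields M) (y : YukawaData N) : Op M N :=
  gaugeOp (fun a x => (b.Z a x : ℂ) • tBL N)
      (fun a => SmoothMat.smul (contMDiff_ofReal (b.Z_smooth a)) (SmoothMat.const _)) +
    oddOp (fun x => y.sigma (b.z x - 1)) (SmoothMat.sigma y (b.z_smooth.sub contMDiff_const))

variable [T2Space M] [SigmaCompactSpace M]

/-- The algebra of the `J`-symmetrized extended background, generated by `π(A^ext)` and `π(A^ext)^o`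
with `A^ext = C̃_c^∞(M, A_F^ext)`. -/
def hatAlgebraExt (t : Tetrad M) (y : YukawaData N) : Subalgebra ℝ (Op M N) :=
  Algebra.adjoin ℝ (fieldOps M (AFExt N) ∪ opp t y '' fieldOps M (AFExt N))

end Background

end
end NCSM

/-!
The operators in question are all of order zero, and the argument has two sources.

*The opposite.* For an internal operator `b`, acting on `K_F` pointwise, the commutator `[D, b]` is
of order zero, and on zero-order operators the Krein adjoint and `T ↦ T^o` are given fibrewise by
matrices (`opp_mulOp`). That the operator-theoretic adjoint is this fibrewise one is its uniqueness,
which rests on the nondegeneracy of the Krein product (`IsKreinAdj.unique`). On the fibre,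
`(i γᵃ)^o = -i γᵃ`, `χ_S^o = χ_S` and, because `m₀ᵀ = -s m₀`, also `D_F^o = D_F`; hence
`[D, b]^o = -[D, b^o]` (`oppData`). Consequently
`(a [D, b])^o = b^o [D, a^o] - [D, b^o a^o]` and `([D, a] [D, b])^o = [D, b^o] [D, a^o]`, so that `o`
maps one-forms to one-forms and junk to junk, and commutes with the differential
(`OppData.exists_lift`). Since the hat algebra is stable under `o` and consists of internal
operators, the class of `R^o` is that of `d ω^o + (ω^o)²` for each representative `R` of the
curvature of `ω`.

*The cross terms.* The curvature of a sum of one-forms differs from the sum of the curvatures by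
anticommutators. The forms `ω_SM`, `ω_SM^o` and `ω_σ` are one-forms of three algebras: the Standard
Model fields, their opposites, and the fields with values in the matrices `centralMat`, which contain
the `B - L` generator. Any two of these algebras satisfy the order-zero and order-one conditions, by a
computation in `End K_F`. If `b` commutes with `[D, e]`, then
`b [D, e] - [D, e b] + e [D, b] = 0`, and the differential of this representation of zero is
`[D, b] [D, e] + [D, e] [D, b]`. So the anticommutators are junk
(`OrderOne.anticommutator_mem_junk`), and `OppData.curvature_add` collects the terms.

It remains to see that the three operators are one-forms. For the gauge parts one divides by a
function `G`, positive on the support of the field, for which `i γᵃ G = ∑ f_k [D, h_k]`; locally the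
`h_k` are coordinates and the `f_k` come from the adjugate of the matrix `e_b(h_k)`
(`gaugeOp_mem_oneForms`). The parts `Φ` and `σ` are explicit combinations of a commutator of `D` with
a constant field (`YukawaData.Phi_eq`, `YukawaData.sigma_eq`). Finally, the central fields belong to
the hat algebra, being sums of a field on `K_R̄ ⊕ K_L̄` and the opposite of another one
(`central_le_hatAlgebraExt`).
-/

namespace NCSM
noncomputable section

/-! ### One-forms, junk and opposites of abstract algebras -/

section AbstractForms
variable {E : Type*} [Ring E] [Algebra ℝ E] {D : E} {A A₁ A₂ : Subalgebra ℝ E}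

theorem formMap_tmul (a b : A) :
    formMap D A (a ⊗ₜ b) = (a : E) * (D * b - b * D) := rfl

theorem dFormMap_tmul (a b : A) :
    dFormMap D A (a ⊗ₜ b) = (D * a - a * D) * (D * b - b * D) := rfl

theorem mul_commutator_mem_oneForms {a b : E} (ha : a ∈ A) (hb : b ∈ A) :
    a * (D * b - b * D) ∈ oneForms D A :=
  ⟨(⟨a, ha⟩ : A) ⊗ₜ (⟨b, hb⟩ : A), formMap_tmul _ _⟩

theorem mul_mem_oneForms {a w : E} (ha : a ∈ A) (hw : w ∈ oneForms D A) :
    a * w ∈ oneForms D A := by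
  obtain ⟨T, rfl⟩ := hw
  induction T with
  | zero => simp
  | add S T hS hT => rw [map_add, mul_add]; exact add_mem hS hT
  | tmul b c =>
    rw [formMap_tmul, ← mul_assoc]
    exact mul_commutator_mem_oneForms (A.mul_mem ha b.2) c.2

/-- One-forms are stable under right multiplication, by the Leibniz rule
`[D, b] a = [D, b a] - b [D, a]`. -/
theorem commutator_mul_mem_oneForms {a b : E} (ha : a ∈ A) (hb : b ∈ A) :
    (D * b - b * D) * a ∈ oneForms D A := by
  have h : (D * b - b * D) * a =
      1 * (D * (b * a) - b * a * D) - b * (D * a - a * D) := by noncomm_ring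
  rw [h]
  exact sub_mem (mul_commutator_mem_oneForms A.one_mem (A.mul_mem hb ha))
    (mul_commutator_mem_oneForms hb ha)

theorem oneForms_mono (h : A₁ ≤ A) : oneForms D A₁ ≤ oneForms D A := by
  rintro _ ⟨T, rfl⟩
  induction T with
  | zero => simp
  | add S T hS hT => rw [map_add]; exact add_mem hS hT
  | tmul b c => exact mul_commutator_mem_oneForms (h b.2) (h c.2)

/-- The differential of a one-form can be computed from any of its representations. -/
theorem extD_eq {w : E} {hw : w ∈ oneForms D A} {T : A ⊗[ℝ] A} (hT : formMap D A T = w) :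
    extD D A ⟨w, hw⟩ = modJunk D A (dFormMap D A T) := by
  subst hT
  exact congrArg ((LinearMap.ker (formMap D A)).mapQ (junk D A) (dFormMap D A)
      (Submodule.le_comap_map _ _))
    (LinearMap.quotKerEquivRange_symm_apply_image (formMap D A) T hw)

theorem modJunk_eq_iff {r s : E} : modJunk D A r = modJunk D A s ↔ r - s ∈ junk D A :=
  Submodule.Quotient.eq _

/-- Junk is a left ideal of the algebra: for `∑ b_j [D, c_j] = 0` the term `[D, a] ∑ b_j [D, c_j]`
of the differential of `∑ a b_j [D, c_j]` vanishes. -/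
theorem mul_mem_junk {a r : E} (ha : a ∈ A) (hr : r ∈ junk D A) : a * r ∈ junk D A := by
  obtain ⟨T, hT, rfl⟩ := hr
  let L : A ⊗[ℝ] A →ₗ[ℝ] A ⊗[ℝ] A :=
    TensorProduct.map (LinearMap.mulLeft ℝ (⟨a, ha⟩ : A)) LinearMap.id
  have h1 : ∀ S, formMap D A (L S) = a * formMap D A S := by
    intro S
    induction S with
    | zero => simp
    | add S T hS hT => rw [map_add, map_add, map_add, mul_add, hS, hT]
    | tmul b c =>
      rw [TensorProduct.map_tmul, formMap_tmul, formMap_tmul, ← mul_assoc]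
      rfl
  have h2 : ∀ S, dFormMap D A (L S) =
      a * dFormMap D A S + (D * a - a * D) * formMap D A S := by
    intro S
    induction S with
    | zero => simp
    | add S T hS hT => rw [map_add, map_add, map_add, map_add, hS, hT]; noncomm_ring
    | tmul b c =>
      rw [TensorProduct.map_tmul, dFormMap_tmul, dFormMap_tmul, formMap_tmul]
      change (D * (a * b) - a * b * D) * (D * c - c * D) = _
      noncomm_ring
  have hT' : formMap D A T = 0 := hT
  refine ⟨L T, ?_, ?_⟩
  · change formMap D A (L T) = 0
    rw [h1, hT', mul_zero]
  · rw [h2, hT', mul_zero, add_zero]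

/-- If `b` commutes with `[D, e]`, then `b [D, e] - [D, e b] + e [D, b]` vanishes, and
its differential is the anticommutator of `[D, b]` and `[D, e]`. -/
theorem anticommutator_commutators_mem_junk {b e : E} (hb : b ∈ A) (he : e ∈ A)
    (h1 : Commute b (D * e - e * D)) :
    (D * b - b * D) * (D * e - e * D) + (D * e - e * D) * (D * b - b * D) ∈ junk D A := by
  let b' : A := ⟨b, hb⟩
  let e' : A := ⟨e, he⟩
  refine ⟨b' ⊗ₜ e' - 1 ⊗ₜ (e' * b') + e' ⊗ₜ b', ?_, ?_⟩
  · change formMap D A _ = 0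
    rw [map_add, map_sub, formMap_tmul, formMap_tmul, formMap_tmul]
    change b * (D * e - e * D) - 1 * (D * (e * b) - e * b * D) + e * (D * b - b * D) = 0
    rw [h1.eq]
    noncomm_ring
  · rw [map_add, map_sub, dFormMap_tmul, dFormMap_tmul, dFormMap_tmul]
    change _ - (D * 1 - 1 * D) * _ + _ = _
    rw [mul_one, one_mul, sub_self, zero_mul, sub_zero]

/-- The order-zero and order-one conditions between two subsets. -/
def OrderOne (D : E) (S₁ S₂ : Set E) : Prop :=
  ∀ a ∈ S₁, ∀ b ∈ S₂, Commute a b ∧ Commute a (D * b - b * D)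

/-- The order conditions pass to the generated algebras, since `b ↦ [D, b]` is a derivation. -/
theorem OrderOne.adjoin {S₁ S₂ : Set E} (h : OrderOne D S₁ S₂) :
    OrderOne D (Algebra.adjoin ℝ S₁ : Subalgebra ℝ E) (Algebra.adjoin ℝ S₂ : Subalgebra ℝ E) := by
  have key : ∀ a ∈ S₁, ∀ b ∈ Algebra.adjoin ℝ S₂, Commute a b ∧ Commute a (D * b - b * D) := by
    intro a ha b hb
    induction hb using Algebra.adjoin_induction with
    | mem x hx => exact h a ha x hx
    | algebraMap r =>
      refine ⟨(Algebra.commutes r a).symm, ?_⟩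
      rw [← Algebra.commutes r D, sub_self]
      exact Commute.zero_right a
    | add x y _ _ hx hy =>
      refine ⟨hx.1.add_right hy.1, ?_⟩
      rw [mul_add, add_mul, add_sub_add_comm]
      exact hx.2.add_right hy.2
    | mul x y _ _ hx hy =>
      refine ⟨hx.1.mul_right hy.1, ?_⟩
      have : D * (x * y) - x * y * D = (D * x - x * D) * y + x * (D * y - y * D) := by
        noncomm_ring
      rw [this]
      exact (hx.2.mul_right hy.1).add_right (hx.1.mul_right hy.2)
  intro a ha b hb
  have hsub : Algebra.adjoin ℝ S₁ ≤ Subalgebra.centralizer ℝ {b, D * b - b * D} := by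
    refine Algebra.adjoin_le fun x hx => ?_
    rw [SetLike.mem_coe, Subalgebra.mem_centralizer_iff]
    rintro g (rfl | rfl)
    · exact (key x hx _ hb).1.symm.eq
    · exact (key x hx b hb).2.symm.eq
  have h1 := Subalgebra.mem_centralizer_iff ℝ |>.1 (hsub ha)
  exact ⟨(h1 b (by simp)).symm, (h1 (D * b - b * D) (by simp)).symm⟩

/-- The anticommutator of one-forms of two subalgebras which satisfy the order-zero and order-one
conditions is junk. -/
theorem OrderOne.anticommutator_mem_junk (h : OrderOne D (A₁ : Set E) (A₂ : Set E))
    (h₁ : A₁ ≤ A) (h₂ : A₂ ≤ A) {w₁ w₂ : E} (hw₁ : w₁ ∈ oneForms D A₁)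
    (hw₂ : w₂ ∈ oneForms D A₂) : w₁ * w₂ + w₂ * w₁ ∈ junk D A := by
  obtain ⟨S, rfl⟩ := hw₁
  obtain ⟨T, rfl⟩ := hw₂
  induction S with
  | zero => simp
  | add S S' hS hS' =>
    rw [map_add, add_mul, mul_add, add_add_add_comm]
    exact add_mem hS hS'
  | tmul a b =>
    induction T with
    | zero => simp
    | add T T' hT hT' =>
      rw [map_add, add_mul, mul_add, add_add_add_comm]
      exact add_mem hT hT'
    | tmul c e =>
      rw [formMap_tmul, formMap_tmul]
      have hac := (h a a.2 c c.2).1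
      have hae := (h a a.2 e e.2).2
      have hbc := (h b b.2 c c.2).1
      have hbc' := (h b b.2 c c.2).2
      -- `[b, c] = 0` and `[b, [D, c]] = 0` give `[[D, b], c] = 0`.
      have hdbc : (D * b - b * D) * c = c * (D * b - b * D) := by
        have h3 : (D * b - b * D) * c - c * (D * b - b * D) =
            (D * (b * c - c * b) - (b * c - c * b) * D) -
              ((b : E) * (D * c - c * D) - (D * c - c * D) * b) := by noncomm_ring
        rw [hbc.eq, hbc'.eq] at h3
        rw [← sub_eq_zero, h3]
        simp
      have key : (a : E) * (D * b - b * D) * (c * (D * e - e * D)) +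
          c * (D * e - e * D) * (a * (D * b - b * D)) =
          (a * c) * ((D * b - b * D) * (D * e - e * D) +
            (D * e - e * D) * (D * b - b * D)) := by
        have e1 : (a : E) * (D * b - b * D) * (c * (D * e - e * D)) =
            a * ((D * b - b * D) * c) * (D * e - e * D) := by noncomm_ring
        have e2 : (c : E) * (D * e - e * D) * (a * (D * b - b * D)) =
            c * ((D * e - e * D) * a) * (D * b - b * D) := by noncomm_ring
        rw [e1, e2, hdbc, ← hae.eq, mul_add]
        have e3 : (c : E) * (a * (D * e - e * D)) * (D * b - b * D) =
            (c * a) * ((D * e - e * D) * (D * b - b * D)) := by noncomm_ring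
        rw [e3, ← hac.eq]
        noncomm_ring
      rw [key]
      exact mul_mem_junk (A.mul_mem (h₁ a.2) (h₂ c.2))
        (anticommutator_commutators_mem_junk (h₁ b.2) (h₂ e.2) (h b b.2 e e.2).2)

/-- The properties of the anti-automorphism `x ↦ x^o` on the algebra `Z` of zero-order operators, and
`[D, a]^o = -[D, a^o]` for `a` in `W`. The map is arbitrary outside of `Z`. -/
structure OppData (D : E) (Z W : Subalgebra ℝ E) (o : E → E) : Prop where
  map_add : ∀ x ∈ Z, ∀ y ∈ Z, o (x + y) = o x + o y
  map_mul : ∀ x ∈ Z, ∀ y ∈ Z, o (x * y) = o y * o x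
  map_real : ∀ r : ℝ, o (algebraMap ℝ E r) = algebraMap ℝ E r
  le : W ≤ Z
  commutator_mem : ∀ a ∈ W, D * a - a * D ∈ Z
  map_commutator : ∀ a ∈ W, o (D * a - a * D) = -(D * o a - o a * D)

namespace OppData
variable {Z W : Subalgebra ℝ E} {o : E → E} (H : OppData D Z W o)
include H

theorem map_zero : o 0 = 0 := by
  simpa using H.map_real 0

/-- An anti-automorphism maps the algebra generated by `S` into the one generated by the image
of `S`. -/
theorem adjoin {S : Set E} (hS : S ⊆ W) :
    ∀ a ∈ Algebra.adjoin ℝ S, o a ∈ Algebra.adjoin ℝ (o '' S) := by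
  intro a ha
  have hle : Algebra.adjoin ℝ S ≤ Z := (Algebra.adjoin_le hS).trans H.le
  induction ha using Algebra.adjoin_induction with
  | mem x hx => exact Algebra.subset_adjoin ⟨x, hx, rfl⟩
  | algebraMap r => rw [H.map_real]; exact Subalgebra.algebraMap_mem _ r
  | add x y hx hy ihx ihy => rw [H.map_add x (hle hx) y (hle hy)]; exact add_mem ihx ihy
  | mul x y hx hy ihx ihy => rw [H.map_mul x (hle hx) y (hle hy)]; exact mul_mem ihy ihx

/-- The map `a ⊗ b ↦ b^o ⊗ a^o - 1 ⊗ b^o a^o` lifts `x ↦ x^o` to representatives of one-forms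
and of their differentials. -/
theorem exists_lift (h₁ : A₁ ≤ W) (h : ∀ a ∈ A₁, o a ∈ A) (T : A₁ ⊗[ℝ] A₁) :
    formMap D A₁ T ∈ Z ∧ dFormMap D A₁ T ∈ Z ∧ ∃ T' : A ⊗[ℝ] A,
      formMap D A T' = o (formMap D A₁ T) ∧ dFormMap D A T' = o (dFormMap D A₁ T) := by
  induction T with
  | zero =>
    rw [_root_.map_zero, _root_.map_zero]
    exact ⟨Z.zero_mem, Z.zero_mem, 0, by simp [H.map_zero], by simp [H.map_zero]⟩
  | add S T hS hT =>
    obtain ⟨s1, s2, S', s3, s4⟩ := hS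
    obtain ⟨t1, t2, T', t3, t4⟩ := hT
    rw [_root_.map_add, _root_.map_add]
    refine ⟨add_mem s1 t1, add_mem s2 t2, S' + T', ?_, ?_⟩
    · rw [_root_.map_add, H.map_add _ s1 _ t1, s3, t3]
    · rw [_root_.map_add, H.map_add _ s2 _ t2, s4, t4]
  | tmul a b =>
    rw [formMap_tmul, dFormMap_tmul]
    have ha := h₁ a.2
    have hb := h₁ b.2
    have hca := H.commutator_mem a ha
    have hcb := H.commutator_mem b hb
    refine ⟨Z.mul_mem (H.le ha) hcb, Z.mul_mem hca hcb, ?_⟩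
    let a' : A := ⟨o a, h a a.2⟩
    let b' : A := ⟨o b, h b b.2⟩
    refine ⟨b' ⊗ₜ a' - 1 ⊗ₜ (b' * a'), ?_, ?_⟩
    · rw [map_sub, formMap_tmul, formMap_tmul, H.map_mul _ (H.le ha) _ hcb, H.map_commutator _ hb]
      change o b * (D * o a - o a * D) - 1 * (D * (o b * o a) - o b * o a * D) = _
      noncomm_ring
    · rw [map_sub, dFormMap_tmul, dFormMap_tmul, H.map_mul _ hca _ hcb, H.map_commutator _ hb,
        H.map_commutator _ ha]
      change (D * o b - o b * D) * (D * o a - o a * D) - (D * 1 - 1 * D) * _ = _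
      rw [mul_one, one_mul, sub_self, zero_mul, sub_zero, neg_mul_neg]

theorem map_mem_oneForms (h₁ : A₁ ≤ W) (h : ∀ a ∈ A₁, o a ∈ A) {w : E}
    (hw : w ∈ oneForms D A₁) : o w ∈ oneForms D A := by
  obtain ⟨T, rfl⟩ := hw
  obtain ⟨-, -, T', h3, -⟩ := H.exists_lift h₁ h T
  exact ⟨T', h3⟩

theorem map_mem_junk (h₁ : A ≤ W) (h : ∀ a ∈ A, o a ∈ A) {r : E}
    (hr : r ∈ junk D A) : r ∈ Z ∧ o r ∈ junk D A := by
  obtain ⟨T, hT, rfl⟩ := hr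
  obtain ⟨-, h2, T', h3, h4⟩ := H.exists_lift h₁ h T
  refine ⟨h2, T', ?_, h4⟩
  have hT' : formMap D A T = 0 := hT
  change formMap D A T' = 0
  rw [h3, hT', H.map_zero]

/-- The curvature of `w + w^o + v`, when the anticommutators of `w`, `w^o` and `v` are junk. A
representative `R` of the curvature of `w` is determined up to junk only; it lies in `Z` because
junk does, and the class of `R^o` does not depend on the choice because junk is stable under
`x ↦ x^o`. -/
theorem curvature_add (h₁ : A ≤ W) (h : ∀ a ∈ A, o a ∈ A) {w v : E}
    (hw : w ∈ oneForms D A) (hv : v ∈ oneForms D A) (hsum : w + o w + v ∈ oneForms D A)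
    (j₁ : w * o w + o w * w ∈ junk D A) (j₂ : w * v + v * w ∈ junk D A)
    (j₃ : o w * v + v * o w ∈ junk D A) (R : E)
    (hR : modJunk D A R = curvature D A ⟨w, hw⟩) :
    R ∈ Z ∧ curvature D A ⟨w + o w + v, hsum⟩ =
      modJunk D A R + modJunk D A (o R) + curvature D A ⟨v, hv⟩ := by
  obtain ⟨T, hT⟩ := id hw
  obtain ⟨V, hV⟩ := id hv
  obtain ⟨z1, z2, T', h3, h4⟩ := H.exists_lift h₁ h T
  rw [hT] at z1 h3
  have how : o w ∈ oneForms D A := ⟨T', h3⟩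
  have hcw : curvature D A ⟨w, hw⟩ = modJunk D A (dFormMap D A T + w * w) := by
    rw [curvature, extD_eq hT, _root_.map_add]
  have hjR : R - (dFormMap D A T + w * w) ∈ junk D A := modJunk_eq_iff.1 (hR.trans hcw)
  have hz : dFormMap D A T + w * w ∈ Z := add_mem z2 (Z.mul_mem z1 z1)
  obtain ⟨hjZ, hoj⟩ := H.map_mem_junk h₁ h hjR
  have hRZ : R ∈ Z := by simpa using add_mem hjZ hz
  refine ⟨hRZ, ?_⟩
  have hoR : modJunk D A (o R) = modJunk D A (dFormMap D A T' + o w * o w) := by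
    have e1 : R = (R - (dFormMap D A T + w * w)) + (dFormMap D A T + w * w) := by abel
    have e2 : o R = o (R - (dFormMap D A T + w * w)) + (dFormMap D A T' + o w * o w) := by
      conv_lhs => rw [e1]
      rw [H.map_add _ hjZ _ hz, H.map_add _ z2 _ (Z.mul_mem z1 z1), H.map_mul _ z1 _ z1, h4]
    rw [modJunk_eq_iff, e2, add_sub_cancel_right]
    exact hoj
  have hsum' : (⟨w + o w + v, hsum⟩ : oneForms D A) =
      ⟨w, hw⟩ + ⟨o w, how⟩ + ⟨v, hv⟩ := rfl
  have hcross : modJunk D A ((w + o w + v) * (w + o w + v)) =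
      modJunk D A (w * w + o w * o w + v * v) := by
    rw [modJunk_eq_iff]
    have e : (w + o w + v) * (w + o w + v) - (w * w + o w * o w + v * v) =
        (w * o w + o w * w) + (w * v + v * w) + (o w * v + v * o w) := by noncomm_ring
    rw [e]
    exact add_mem (add_mem j₁ j₂) j₃
  rw [hR, hcw, hoR, curvature, curvature, hsum', _root_.map_add, _root_.map_add, extD_eq hT,
    extD_eq h3, extD_eq hV]
  change _ + modJunk D A ((w + o w + v) * (w + o w + v)) = _ + (_ + modJunk D A (v * v))
  rw [hcross]
  simp only [_root_.map_add]
  abel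

end OppData
end AbstractForms

/-! ### Derivatives and zero-order operators -/

section Derivatives
variable {M : Type*} [TopologicalSpace M] [ChartedSpace E4 M] [IsManifold (𝓡 4) ∞ M]

theorem Tetrad.deriv_comp_clm (t : Tetrad M) {F G : Type*} [NormedAddCommGroup F]
    [NormedSpace ℝ F] [NormedAddCommGroup G] [NormedSpace ℝ G] (a : Fin 4) {f : M → F}
    (hf : ContMDiff (𝓡 4) 𝓘(ℝ, F) ∞ f) (L : F →L[ℝ] G) (x : M) :
    t.deriv a (fun y => L (f y)) x = L (t.deriv a f x) := by
  have hf' := (hf.mdifferentiable (by simp)) x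
  have h := (L.hasMFDerivAt (x := f x)).comp x hf'.hasMFDerivAt
  unfold Tetrad.deriv
  have h2 : mfderiv (𝓡 4) 𝓘(ℝ, G) (fun y => L (f y)) x = _ := h.mfderiv
  rw [h2]
  rfl

theorem Tetrad.deriv_mul (t : Tetrad M) (a : Fin 4) {f g : M → ℂ}
    (hf : ContMDiff (𝓡 4) 𝓘(ℝ, ℂ) ∞ f) (hg : ContMDiff (𝓡 4) 𝓘(ℝ, ℂ) ∞ g) (x : M) :
    t.deriv a (fun y => f y * g y) x = t.deriv a f x * g x + f x * t.deriv a g x := by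
  have hf' := ((hf.mdifferentiable (by simp)) x).hasMFDerivAt
  have hg' := ((hg.mdifferentiable (by simp)) x).hasMFDerivAt
  have h := (hf'.mul hg').mfderiv
  have h2 : mfderiv (𝓡 4) 𝓘(ℝ, ℂ) (fun y => f y * g y) x = _ := h
  unfold Tetrad.deriv
  rw [h2]
  let u : ℂ := mfderiv (𝓡 4) 𝓘(ℝ, ℂ) f x (t.e a x)
  let v : ℂ := mfderiv (𝓡 4) 𝓘(ℝ, ℂ) g x (t.e a x)
  change f x * v + g x * u = u * g x + f x * v
  ring

theorem Tetrad.deriv_const (t : Tetrad M) {F : Type*} [NormedAddCommGroup F] [NormedSpace ℝ F]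
    (a : Fin 4) (c : F) (x : M) : t.deriv a (fun _ : M => c) x = 0 := by
  unfold Tetrad.deriv
  rw [mfderiv_const]
  rfl

theorem Tetrad.deriv_congr (t : Tetrad M) {F : Type*} [NormedAddCommGroup F] [NormedSpace ℝ F]
    (a : Fin 4) {f g : M → F} {x : M} (h : f =ᶠ[nhds x] g) : t.deriv a f x = t.deriv a g x := by
  unfold Tetrad.deriv
  rw [h.mfderiv_eq]
  rfl

theorem Tetrad.deriv_sum (t : Tetrad M) {F ι : Type*} [NormedAddCommGroup F] [NormedSpace ℝ F]
    (a : Fin 4) (s : Finset ι) {f : ι → M → F}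
    (hf : ∀ i, ContMDiff (𝓡 4) 𝓘(ℝ, F) ∞ (f i)) (x : M) :
    t.deriv a (fun y => ∑ i ∈ s, f i y) x = ∑ i ∈ s, t.deriv a (f i) x := by
  classical
  induction s using Finset.induction_on with
  | empty => simpa using t.deriv_const a (0 : F) x
  | insert i s hi ih =>
    rw [Finset.sum_insert hi, ← ih, ← t.deriv_add a (hf i) (ContMDiff.sum fun k _ => hf k)]
    congr 1
    ext y
    simp [Finset.sum_insert hi]

variable {m n k l : Type*}

/-- The entrywise derivative `e_a(B)` of a matrix-valued function. -/
def Tetrad.matDeriv (t : Tetrad M) (a : Fin 4) (B : M → Matrix m n ℂ) (x : M) : Matrix m n ℂ :=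
  Matrix.of fun i j => t.deriv a (fun y => B y i j) x

theorem SmoothMat.matDeriv (t : Tetrad M) (a : Fin 4) {B : M → Matrix m n ℂ} (hB : SmoothMat B) :
    SmoothMat (t.matDeriv a B) := fun i j => t.contMDiff_deriv a (hB i j)

theorem SmoothMat.contMDiff [Fintype m] [Fintype n] {B : M → Matrix m n ℂ} (hB : SmoothMat B) :
    ContMDiff (𝓡 4) 𝓘(ℝ, m → n → ℂ) ∞ (fun x i j => B x i j) :=
  contMDiff_pi_space.2 fun i => contMDiff_pi_space.2 fun j => hB i j

theorem SmoothMat.map_linear [Fintype m] [Fintype n] {B : M → Matrix m n ℂ} (hB : SmoothMat B)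
    (L : Matrix m n ℂ →ₗ[ℝ] Matrix k l ℂ) : SmoothMat (fun x => L (B x)) := fun i j => by
  let L' : (m → n → ℂ) →ₗ[ℝ] ℂ := Matrix.entryLinearMap ℝ ℂ i j ∘ₗ L ∘ₗ
    (Matrix.ofLinearEquiv ℝ).toLinearMap
  exact contMDiff_linear hB.contMDiff L'

/-- The derivative commutes with constant real-linear maps of matrices. -/
theorem Tetrad.matDeriv_map_linear [Fintype m] [Fintype n] (t : Tetrad M) (a : Fin 4)
    {B : M → Matrix m n ℂ} (hB : SmoothMat B) (L : Matrix m n ℂ →ₗ[ℝ] Matrix k l ℂ) (x : M) :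
    t.matDeriv a (fun y => L (B y)) x = L (t.matDeriv a B x) := by
  have h1 : ∀ i j, t.deriv a (fun (x : M) i j => B x i j) x i j = t.matDeriv a B x i j := by
    intro i j
    exact (t.deriv_comp_clm a hB.contMDiff ((ContinuousLinearMap.proj (R := ℝ) j).comp
      (ContinuousLinearMap.proj (R := ℝ) (φ := fun _ : m => n → ℂ) i)) x).symm
  have h2 : Matrix.of (t.deriv a (fun (x : M) i j => B x i j) x) = t.matDeriv a B x :=
    Matrix.ext h1
  ext i j
  let L' : (m → n → ℂ) →ₗ[ℝ] ℂ := Matrix.entryLinearMap ℝ ℂ i j ∘ₗ L ∘ₗ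
    (Matrix.ofLinearEquiv ℝ).toLinearMap
  have h3 := t.deriv_comp_clm a hB.contMDiff (LinearMap.toContinuousLinearMap L') x
  rw [← h2]
  exact h3

theorem Tetrad.matDeriv_const (t : Tetrad M) (a : Fin 4) (C : Matrix m n ℂ) (x : M) :
    t.matDeriv a (fun _ : M => C) x = 0 := by
  ext i j
  exact t.deriv_const a _ x

end Derivatives

section MulOp
variable {M : Type*} [TopologicalSpace M] [ChartedSpace E4 M] [IsManifold (𝓡 4) ∞ M] {N : ℕ}
variable {S T : M → Matrix (TotIdx N) (TotIdx N) ℂ}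

theorem spinor_ext {ψ φ : Spinor M N} (h : ∀ x, ψ.1 x = φ.1 x) : ψ = φ :=
  Subtype.ext (funext h)

theorem mulOp_apply (hS : SmoothMat S) (ψ : Spinor M N) (x : M) :
    (mulOp S hS ψ).1 x = (S x).mulVec (ψ.1 x) := rfl

theorem mulOp_congr {hS : SmoothMat S} {hT : SmoothMat T} (h : ∀ x, S x = T x) :
    mulOp S hS = mulOp T hT := by
  obtain rfl : S = T := funext h
  rfl

theorem mulOp_mul (hS : SmoothMat S) (hT : SmoothMat T) :
    mulOp S hS * mulOp T hT = mulOp (fun x => S x * T x) (hS.mul hT) :=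
  LinearMap.ext fun ψ => spinor_ext fun x => Matrix.mulVec_mulVec (ψ.1 x) (S x) (T x)

theorem mulOp_add (hS : SmoothMat S) (hT : SmoothMat T) :
    mulOp S hS + mulOp T hT = mulOp (fun x => S x + T x) (hS.add hT) :=
  LinearMap.ext fun ψ => spinor_ext fun x => (Matrix.add_mulVec (S x) (T x) (ψ.1 x)).symm

theorem mulOp_neg (hS : SmoothMat S) : -mulOp S hS = mulOp (fun x => -S x) hS.neg :=
  LinearMap.ext fun ψ => spinor_ext fun x => (Matrix.neg_mulVec (ψ.1 x) (S x)).symm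

theorem mulOp_sub (hS : SmoothMat S) (hT : SmoothMat T) :
    mulOp S hS - mulOp T hT = mulOp (fun x => S x + -T x) (hS.add hT.neg) := by
  rw [sub_eq_add_neg, mulOp_neg, mulOp_add]

theorem mulOp_zero : mulOp (fun _ : M => (0 : Matrix (TotIdx N) (TotIdx N) ℂ))
    (SmoothMat.const 0) = 0 :=
  LinearMap.ext fun ψ => spinor_ext fun x => Matrix.zero_mulVec (ψ.1 x)

theorem mulOp_sum {ι : Type*} (s : Finset ι) {B : ι → M → Matrix (TotIdx N) (TotIdx N) ℂ}
    (hB : ∀ i, SmoothMat (B i)) :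
    ∑ i ∈ s, mulOp (B i) (hB i) = mulOp (fun x => ∑ i ∈ s, B i x) (SmoothMat.sum s hB) := by
  classical
  induction s using Finset.induction_on with
  | empty =>
    rw [Finset.sum_empty, ← mulOp_zero]
    exact mulOp_congr fun x => by simp
  | insert i s hi ih =>
    rw [Finset.sum_insert hi, ih, mulOp_add]
    exact mulOp_congr fun x => by simp only [Finset.sum_insert hi]

theorem algebraMap_eq_mulOp (r : ℝ) : algebraMap ℝ (Op M N) r =
    mulOp (fun _ => (r : ℂ) • 1) (SmoothMat.const _) :=
  LinearMap.ext fun ψ => spinor_ext fun x => by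
    rw [mulOp_apply, Matrix.smul_mulVec, Matrix.one_mulVec]
    rfl

/-- The zero-order operator `1 ⊗ B` on `S ⊗ K_F`. -/
def intOp (B : M → Matrix (FinIdx N) (FinIdx N) ℂ) (hB : SmoothMat B) : Op M N :=
  mulOp (fun x => 1 ⊗ₖ B x) ((SmoothMat.const _).kron hB)

/-- The algebra of zero-order operators. -/
def zeroOrder (M : Type*) [TopologicalSpace M] [ChartedSpace E4 M] [IsManifold (𝓡 4) ∞ M]
    (N : ℕ) : Subalgebra ℝ (Op M N) where
  carrier := {T | ∃ S hS, T = mulOp S hS}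
  mul_mem' := by
    rintro _ _ ⟨S, hS, rfl⟩ ⟨T, hT, rfl⟩
    exact ⟨_, _, mulOp_mul hS hT⟩
  add_mem' := by
    rintro _ _ ⟨S, hS, rfl⟩ ⟨T, hT, rfl⟩
    exact ⟨_, _, mulOp_add hS hT⟩
  algebraMap_mem' r := ⟨_, _, algebraMap_eq_mulOp r⟩

/-- The algebra of zero-order operators which act on the internal factor `K_F` only. -/
def internal (M : Type*) [TopologicalSpace M] [ChartedSpace E4 M] [IsManifold (𝓡 4) ∞ M]
    (N : ℕ) : Subalgebra ℝ (Op M N) where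
  carrier := {T | ∃ B hB, T = intOp B hB}
  mul_mem' := by
    rintro _ _ ⟨S, hS, rfl⟩ ⟨T, hT, rfl⟩
    refine ⟨fun x => S x * T x, hS.mul hT, (mulOp_mul _ _).trans (mulOp_congr fun x => ?_)⟩
    rw [← Matrix.mul_kronecker_mul, one_mul]
  add_mem' := by
    rintro _ _ ⟨S, hS, rfl⟩ ⟨T, hT, rfl⟩
    refine ⟨fun x => S x + T x, hS.add hT, (mulOp_add _ _).trans (mulOp_congr fun x => ?_)⟩
    rw [Matrix.kronecker_add]
  algebraMap_mem' r := by
    refine ⟨fun _ => (r : ℂ) • 1, SmoothMat.const _, (algebraMap_eq_mulOp r).trans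
      (mulOp_congr fun x => ?_)⟩
    rw [Matrix.kronecker_smul, Matrix.one_kronecker_one]

theorem internal_le_zeroOrder : internal M N ≤ zeroOrder M N := by
  rintro _ ⟨B, hB, rfl⟩
  exact ⟨_, _, rfl⟩

/-- The commutator of a frame derivative with a zero-order operator is the entrywise derivative. -/
theorem derivOp_commutator (t : Tetrad M) (a : Fin 4) (hT : SmoothMat T) :
    derivOp t a * mulOp T hT - mulOp T hT * derivOp t a =
      mulOp (t.matDeriv a T) (hT.matDeriv t a) := by
  refine LinearMap.ext fun ψ => spinor_ext fun x => ?_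
  have hψ : ∀ j, ContMDiff (𝓡 4) 𝓘(ℝ, ℂ) ∞ (fun y => ψ.1 y j) :=
    contMDiff_pi_space.1 ψ.2.1
  have hp : ∀ (φ : Spinor M N) i, t.deriv a φ.1 x i = t.deriv a (fun y => φ.1 y i) x := fun φ i =>
    (t.deriv_comp_clm a φ.2.1
      (ContinuousLinearMap.proj (R := ℝ) (φ := fun _ : TotIdx N => ℂ) i) x).symm
  change t.deriv a (mulOp T hT ψ).1 x - (T x).mulVec (t.deriv a ψ.1 x) =
    (t.matDeriv a T x).mulVec (ψ.1 x)
  rw [sub_eq_iff_eq_add]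
  ext i
  rw [hp]
  change t.deriv a (fun y => ∑ j, T y i j * ψ.1 y j) x =
    ∑ j, t.deriv a (fun y => T y i j) x * ψ.1 x j + ∑ j, T x i j * t.deriv a ψ.1 x j
  rw [t.deriv_sum a Finset.univ (fun j => contMDiff_cmul (hT i j) (hψ j)),
    ← Finset.sum_add_distrib]
  refine Finset.sum_congr rfl fun j _ => ?_
  rw [t.deriv_mul a (hT i j) (hψ j), hp]

/-- Left multiplication by a fixed Kronecker factor. -/
def kronL {m n : Type*} (C : Matrix (Fin 4) (Fin 4) ℂ) :
    Matrix m n ℂ →ₗ[ℝ] Matrix (Fin 4 × m) (Fin 4 × n) ℂ where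
  toFun B := C ⊗ₖ B
  map_add' A B := Matrix.kronecker_add C A B
  map_smul' r B := Matrix.kronecker_smul r C B

theorem smoothMat_commutator (t : Tetrad M) (y : YukawaData N)
    {B : M → Matrix (FinIdx N) (FinIdx N) ℂ} (hB : SmoothMat B) :
    SmoothMat (fun x => (∑ a, (Complex.I • gam a) ⊗ₖ t.matDeriv a B x) +
      chiS ⊗ₖ (y.DF * B x + -(B x * y.DF))) :=
  (SmoothMat.sum _ fun a => (SmoothMat.const _).kron (hB.matDeriv t a)).add
    ((SmoothMat.const _).kron (((SmoothMat.const _).mul hB).add (hB.mul (SmoothMat.const _)).neg))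

/-- `[D, 1 ⊗ B] = ∑ i γᵃ ⊗ e_a(B) + χ_S ⊗ [D_F, B]`. The spin connection drops out, since it acts on
the spinor factor. -/
theorem dirac_commutator (t : Tetrad M) (y : YukawaData N)
    {B : M → Matrix (FinIdx N) (FinIdx N) ℂ} (hB : SmoothMat B) :
    dirac t y * intOp B hB - intOp B hB * dirac t y = mulOp _ (smoothMat_commutator t y hB) := by
  have hnab : ∀ a, nabla t a * intOp B hB - intOp B hB * nabla t a =
      intOp (t.matDeriv a B) (hB.matDeriv t a) := by
    intro a
    have h1 := derivOp_commutator t a ((SmoothMat.const (M := M) 1).kron hB)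
    have h2 : mulOp (fun x => spinConnection t a x ⊗ₖ 1)
          ((smoothMat_spinConnection t a).kron (SmoothMat.const 1)) * intOp B hB =
        intOp B hB * mulOp (fun x => spinConnection t a x ⊗ₖ 1)
          ((smoothMat_spinConnection t a).kron (SmoothMat.const 1)) := by
      rw [intOp, mulOp_mul, mulOp_mul]
      refine mulOp_congr fun x => ?_
      rw [← Matrix.mul_kronecker_mul, ← Matrix.mul_kronecker_mul, one_mul, mul_one, one_mul,
        mul_one]
    have h3 : mulOp (t.matDeriv a fun x => 1 ⊗ₖ B x) (((SmoothMat.const _).kron hB).matDeriv t a) =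
        intOp (t.matDeriv a B) (hB.matDeriv t a) :=
      mulOp_congr fun x => t.matDeriv_map_linear a hB (kronL 1) x
    rw [nabla, add_mul, mul_add, add_sub_add_comm, h2, sub_self, add_zero, ← h3]
    exact h1
  have hM : diracM t * intOp B hB - intOp B hB * diracM t =
      mulOp (fun x => ∑ a, (Complex.I • gam a) ⊗ₖ t.matDeriv a B x)
        (SmoothMat.sum _ fun a => (SmoothMat.const _).kron (hB.matDeriv t a)) := by
    rw [diracM, Finset.sum_mul, Finset.mul_sum, ← Finset.sum_sub_distrib]
    rw [← mulOp_sum Finset.univ fun a => (SmoothMat.const _).kron (hB.matDeriv t a)]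
    refine Finset.sum_congr rfl fun a _ => ?_
    have h2 : mulOp (fun _ => (Complex.I • gam a) ⊗ₖ 1) (SmoothMat.const _) * intOp B hB =
        intOp B hB * mulOp (fun _ => (Complex.I • gam a) ⊗ₖ 1) (SmoothMat.const _) := by
      rw [intOp, mulOp_mul, mulOp_mul]
      refine mulOp_congr fun x => ?_
      rw [← Matrix.mul_kronecker_mul, ← Matrix.mul_kronecker_mul, one_mul, mul_one, one_mul,
        mul_one]
    rw [← mul_assoc, ← h2, mul_assoc, mul_assoc, ← mul_sub, hnab, intOp, mulOp_mul]
    refine mulOp_congr fun x => ?_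
    rw [← Matrix.mul_kronecker_mul, one_mul, mul_one]
  rw [dirac, add_mul, mul_add, add_sub_add_comm, hM, intOp, mulOp_mul, mulOp_mul, mulOp_sub,
    mulOp_add]
  refine mulOp_congr fun x => ?_
  rw [← Matrix.mul_kronecker_mul, ← Matrix.mul_kronecker_mul, one_mul, mul_one, Matrix.kronecker_add]
  congr 2
  exact ((kronL chiS).map_neg _).symm

/-- The commutator with a constant internal matrix. -/
theorem dirac_commutator_const (t : Tetrad M) (y : YukawaData N)
    (B : Matrix (FinIdx N) (FinIdx N) ℂ) :
    dirac t y * intOp (fun _ => B) (SmoothMat.const B) -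
      intOp (fun _ => B) (SmoothMat.const B) * dirac t y =
      mulOp (fun _ => chiS ⊗ₖ (y.DF * B - B * y.DF)) (SmoothMat.const _) := by
  rw [dirac_commutator]
  refine mulOp_congr fun x => ?_
  simp only [t.matDeriv_const, Matrix.kronecker_zero, Finset.sum_const_zero, zero_add,
    sub_eq_add_neg]

end MulOp

/-! ### Charts, coframes and positivity of the volume integral -/

section ChartFrame
variable {M : Type*} [TopologicalSpace M] [ChartedSpace E4 M] [IsManifold (𝓡 4) ∞ M]

/-- The components of the frame vectors in the chart at `i`. -/
def Tetrad.chartFrame (t : Tetrad M) (i x : M) : Matrix (Fin 4) (Fin 4) ℝ :=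
  Matrix.of fun k a =>
    let v : E4 := mfderiv (𝓡 4) 𝓘(ℝ, E4) (chartAt E4 i) x (t.e a x)
    v k

theorem Tetrad.det_chartFrame_ne_zero (t : Tetrad M) {i x : M} (hx : x ∈ (chartAt E4 i).source) :
    (t.chartFrame i x).det ≠ 0 := by
  have : IsManifold (𝓡 4) 1 M := IsManifold.of_le (n := ∞) (by norm_cast)
  have hinj : Function.Injective (mfderiv (𝓡 4) 𝓘(ℝ, E4) (chartAt E4 i) x) :=
    (mdifferentiable_chart (I := 𝓡 4) i).mfderiv_injective hx
  let L : TangentSpace (𝓡 4) x →ₗ[ℝ] E4 :=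
    (mfderiv (𝓡 4) 𝓘(ℝ, E4) (chartAt E4 i) x).toLinearMap
  have hli : LinearIndependent ℝ (fun a => L (t.e a x)) :=
    (t.linIndep x).map' L (LinearMap.ker_eq_bot.2 hinj)
  have hli2 : LinearIndependent ℝ (fun a => (L (t.e a x)).ofLp) :=
    hli.map' (WithLp.linearEquiv 2 ℝ (Fin 4 → ℝ)).toLinearMap
      (LinearMap.ker_eq_bot.2 (WithLp.linearEquiv 2 ℝ (Fin 4 → ℝ)).injective)
  have hcol : LinearIndependent ℝ (t.chartFrame i x).col := hli2
  have hu : IsUnit (t.chartFrame i x) := Matrix.linearIndependent_cols_iff_isUnit.1 hcol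
  exact ((Matrix.isUnit_iff_isUnit_det _).1 hu).ne_zero

theorem Tetrad.continuousOn_chartFrame (t : Tetrad M) (i : M) :
    ContinuousOn (t.chartFrame i) (chartAt E4 i).source := by
  have : IsManifold (𝓡 4) 1 M := IsManifold.of_le (n := ∞) (by norm_cast)
  have hc : ContMDiffOn (𝓡 4) 𝓘(ℝ, E4) 1 (chartAt E4 i) (chartAt E4 i).source :=
    contMDiffOn_chart
  have hopen := (chartAt E4 i).open_source
  have h1 := hc.continuousOn_tangentMapWithin le_rfl hopen.uniqueMDiffOn
  refine continuousOn_pi.2 fun k => continuousOn_pi.2 fun a => ?_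
  have h2 : ContinuousOn (fun x => tangentMapWithin (𝓡 4) 𝓘(ℝ, E4) (chartAt E4 i)
      (chartAt E4 i).source (⟨x, t.e a x⟩ : TangentBundle (𝓡 4) M)) (chartAt E4 i).source :=
    h1.comp (t.smooth a).continuous.continuousOn fun x hx => hx
  have h3 : Continuous fun p : TangentBundle 𝓘(ℝ, E4) E4 => (p.2 : E4) :=
    (contMDiff_snd_tangentBundle_modelSpace E4 𝓘(ℝ, E4) (n := 0)).continuous
  have h4 : Continuous fun v : E4 => v k := by fun_prop
  refine ((h4.comp h3).comp_continuousOn h2).congr fun x hx => ?_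
  let v : E4 := mfderivWithin (𝓡 4) 𝓘(ℝ, E4) (chartAt E4 i) (chartAt E4 i).source x (t.e a x)
  have hv : v = mfderiv (𝓡 4) 𝓘(ℝ, E4) (chartAt E4 i) x (t.e a x) := by
    simp only [v]
    rw [mfderivWithin_of_isOpen hopen hx]
  change _ = v k
  rw [hv]
  rfl

/-- Near every point, cut-off chart coordinates `h_k` and smooth coefficients `f_k` satisfy
`∑ f_k e_b(h_k) = δ_{ab} G` with `G ≥ 0` positive at the point; the coefficients come from the
adjugate of the matrix `e_b(h_k)`. -/
theorem Tetrad.exists_local_coframe [T2Space M] (t : Tetrad M) (a : Fin 4) (p : M) :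
    ∃ f h : Fin 4 → M → ℝ, (∀ k, ContMDiff (𝓡 4) 𝓘(ℝ, ℝ) ∞ (f k)) ∧
      (∀ k, ContMDiff (𝓡 4) 𝓘(ℝ, ℝ) ∞ (h k)) ∧ (∀ k, HasCompactSupport (f k)) ∧
      (∀ k, HasCompactSupport (h k)) ∧ ∃ G : M → ℝ, ContMDiff (𝓡 4) 𝓘(ℝ, ℝ) ∞ G ∧
      (∀ x, 0 ≤ G x) ∧ 0 < G p ∧
      ∀ x b, ∑ k, f k x * t.deriv b (h k) x = if b = a then G x else 0 := by
  let ψ : SmoothBumpFunction (𝓡 4) p := Classical.arbitrary _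
  let h : Fin 4 → M → ℝ := fun k x => ψ x • (chartAt E4 p x) k
  have hcoord : ∀ k, ContMDiffOn (𝓡 4) 𝓘(ℝ, ℝ) ∞ (fun x => (chartAt E4 p x) k)
      (chartAt E4 p).source := fun k => by
    have hL := (EuclideanSpace.proj k : E4 →L[ℝ] ℝ).contMDiff (n := ∞)
    exact hL.comp_contMDiffOn contMDiffOn_chart
  have hh : ∀ k, ContMDiff (𝓡 4) 𝓘(ℝ, ℝ) ∞ (h k) := fun k => ψ.contMDiff_smul (hcoord k)
  have hhc : ∀ k, HasCompactSupport (h k) := fun k => ψ.hasCompactSupport.smul_right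
  let P : M → Matrix (Fin 4) (Fin 4) ℝ := fun x => Matrix.of fun k b => t.deriv b (h k) x
  have hP : ∀ k b, ContMDiff (𝓡 4) 𝓘(ℝ, ℝ) ∞ (fun x => P x k b) := fun k b =>
    t.contMDiff_deriv b (hh k)
  have hPp : P p = t.chartFrame p p := by
    ext k b
    have e1 : h k =ᶠ[nhds p] fun x => (chartAt E4 p x) k := by
      filter_upwards [ψ.eventuallyEq_one] with x hx
      simp [h, hx]
    change t.deriv b (h k) p = _
    rw [t.deriv_congr b e1]
    have hd : MDifferentiableAt (𝓡 4) 𝓘(ℝ, E4) (chartAt E4 p) p :=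
      ((contMDiffOn_chart (I := 𝓡 4) (n := ∞)).contMDiffAt
        (chart_source_mem_nhds E4 p)).mdifferentiableAt (by simp)
    have hc := ((EuclideanSpace.proj k : E4 →L[ℝ] ℝ).hasMFDerivAt
      (x := chartAt E4 p p)).comp p hd.hasMFDerivAt
    have h2 : mfderiv (𝓡 4) 𝓘(ℝ, ℝ) (fun y => (chartAt E4 p y) k) p = _ := hc.mfderiv
    unfold Tetrad.deriv
    rw [h2]
    rfl
  have hdet : ContMDiff (𝓡 4) 𝓘(ℝ, ℝ) ∞ (fun x => (P x).det) := fun x =>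
    contMDiffAt_det fun i j => hP i j x
  have hadj : ∀ k, ContMDiff (𝓡 4) 𝓘(ℝ, ℝ) ∞ (fun x => (P x).adjugate a k) := fun k x => by
    simp only [Matrix.adjugate_apply]
    refine contMDiffAt_det fun i j => ?_
    by_cases hi : i = k
    · subst hi
      simp only [Matrix.updateRow_self]
      exact contMDiffAt_const
    · simp only [Matrix.updateRow_ne hi]
      exact hP i j x
  let g : M → ℝ := fun x => ψ x * (P x).det
  have hg : ContMDiff (𝓡 4) 𝓘(ℝ, ℝ) ∞ g := ψ.contMDiff.mul hdet
  have hgc : HasCompactSupport g := ψ.hasCompactSupport.mul_right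
  refine ⟨fun k x => g x * (ψ x * (P x).adjugate a k), h,
    fun k => hg.mul (ψ.contMDiff.mul (hadj k)), hh, fun k => hgc.mul_right, hhc,
    fun x => g x * g x, hg.mul hg, fun x => mul_self_nonneg _, ?_, fun x b => ?_⟩
  · refine mul_self_pos.2 (mul_ne_zero (by rw [ψ.eq_one]; exact one_ne_zero) ?_)
    rw [hPp]
    exact t.det_chartFrame_ne_zero (mem_chart_source E4 p)
  · have e : ∑ k, (P x).adjugate a k * t.deriv b (h k) x = if b = a then (P x).det else 0 := by
      have h1 := congrFun (congrFun (Matrix.adjugate_mul (P x)) a) b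
      rw [Matrix.mul_apply] at h1
      change ∑ k, (P x).adjugate a k * P x k b = _
      rw [h1]
      simp [Matrix.one_apply, eq_comm]
    have e2 : ∑ k, g x * (ψ x * (P x).adjugate a k) * t.deriv b (h k) x =
        g x * ψ x * ∑ k, (P x).adjugate a k * t.deriv b (h k) x := by
      rw [Finset.mul_sum]
      exact Finset.sum_congr rfl fun k _ => by ring
    rw [e2, e]
    split_ifs
    · simp only [g]; ring
    · simp

end ChartFrame

section Integral
variable {M : Type*} [TopologicalSpace M] [ChartedSpace E4 M] [IsManifold (𝓡 4) ∞ M]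
  [T2Space M] [SigmaCompactSpace M]

/-- The integrand of `Tetrad.integral` in the chart at `i`. -/
def Tetrad.chartIntegrand (t : Tetrad M) (f : M → ℂ) (i : M) (y : E4) : ℂ :=
  (chartPartition M i ((chartAt E4 i).symm y) * t.volDensity i ((chartAt E4 i).symm y)) •
      f ((chartAt E4 i).symm y)

theorem tsupport_chartPartition (i : M) :
    tsupport (chartPartition M i) ⊆ (chartAt E4 i).source :=
  (SmoothPartitionOfUnity.exists_isSubordinate_chartAt_source (𝓡 4) M).choose_spec i

theorem Tetrad.continuousOn_volDensity (t : Tetrad M) (i : M) :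
    ContinuousOn (t.volDensity i) (chartAt E4 i).source := by
  refine ContinuousOn.inv₀ ?_ fun x hx => abs_ne_zero.2 (t.det_chartFrame_ne_zero hx)
  exact ((Continuous.matrix_det continuous_id).comp_continuousOn (t.continuousOn_chartFrame i)).abs

theorem Tetrad.volDensity_pos (t : Tetrad M) {i x : M} (hx : x ∈ (chartAt E4 i).source) :
    0 < t.volDensity i x :=
  inv_pos.2 (abs_pos.2 (t.det_chartFrame_ne_zero hx))

theorem Tetrad.continuousOn_chartIntegrand (t : Tetrad M) {f : M → ℂ} (hf : Continuous f) (i : M) :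
    ContinuousOn (t.chartIntegrand f i) (chartAt E4 i).target := by
  have hs := (chartAt E4 i).continuousOn_symm
  have hm : Set.MapsTo (chartAt E4 i).symm (chartAt E4 i).target (chartAt E4 i).source :=
    (chartAt E4 i).mapsTo_symm
  exact (((chartPartition M i).contMDiff.continuous.comp_continuousOn hs).mul
    ((t.continuousOn_volDensity i).comp hs hm)).smul (hf.comp_continuousOn hs)

open MeasureTheory in
/-- In the chart the integrand is continuous and vanishes off a compact subset of the target. -/
theorem Tetrad.integrableOn_chartIntegrand (t : Tetrad M) {f : M → ℂ} (hf : Continuous f)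
    (hc : HasCompactSupport f) (i : M) :
    IntegrableOn (t.chartIntegrand f i) (chartAt E4 i).target := by
  let K : Set M := tsupport f ∩ tsupport (chartPartition M i)
  have hK : IsCompact K := hc.isCompact.inter_right (isClosed_tsupport _)
  have hKs : K ⊆ (chartAt E4 i).source := fun x hx => tsupport_chartPartition i hx.2
  let K' : Set E4 := chartAt E4 i '' K
  have hK' : IsCompact K' := hK.image_of_continuousOn ((chartAt E4 i).continuousOn.mono hKs)
  have hKt : K' ⊆ (chartAt E4 i).target := by
    rintro _ ⟨x, hx, rfl⟩
    exact (chartAt E4 i).map_source (hKs hx)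
  have h1 : IntegrableOn (t.chartIntegrand f i) K' :=
    ((t.continuousOn_chartIntegrand hf i).mono hKt).integrableOn_compact hK'
  refine h1.of_forall_sdiff_eq_zero (chartAt E4 i).open_target.measurableSet fun y hy => ?_
  by_contra hne
  refine hy.2 ⟨(chartAt E4 i).symm y, ⟨?_, ?_⟩, (chartAt E4 i).right_inv hy.1⟩
  · refine subset_tsupport f fun h0 => hne ?_
    rw [Tetrad.chartIntegrand, h0, smul_zero]
  · refine subset_tsupport (chartPartition M i) fun h0 => hne ?_
    rw [Tetrad.chartIntegrand, h0, zero_mul, zero_smul]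

/-- The sum over the charts is finite, by local finiteness of the partition of unity; `finsum` would
otherwise be zero. -/
theorem Tetrad.finite_support_integral (t : Tetrad M) {f : M → ℂ} (hc : HasCompactSupport f) :
    (Function.support fun i => ∫ y in (chartAt E4 i).target, t.chartIntegrand f i y).Finite := by
  have h1 := (chartPartition M).locallyFinite.finite_nonempty_inter_compact hc.isCompact
  refine h1.subset fun i hi => ?_
  by_contra hne
  refine hi ?_
  change ∫ y in (chartAt E4 i).target, t.chartIntegrand f i y = 0
  refine (MeasureTheory.setIntegral_congr_fun (chartAt E4 i).open_target.measurableSet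
    (g := fun _ => 0) fun y _ => ?_).trans (by simp)
  change (_ * _) • f _ = 0
  by_cases hf0 : f ((chartAt E4 i).symm y) = 0
  · rw [hf0, smul_zero]
  by_cases hp0 : chartPartition M i ((chartAt E4 i).symm y) = 0
  · rw [hp0, zero_mul, zero_smul]
  · exact (hne ⟨_, hp0, subset_tsupport f hf0⟩).elim

theorem Tetrad.integral_sub (t : Tetrad M) {f g : M → ℂ} (hf : Continuous f)
    (hfc : HasCompactSupport f) (hg : Continuous g) (hgc : HasCompactSupport g) :
    t.integral (fun x => f x - g x) = t.integral f - t.integral g := by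
  change _ = (∑ᶠ i : M, ∫ y in (chartAt E4 i).target, t.chartIntegrand f i y) -
    ∑ᶠ i : M, ∫ y in (chartAt E4 i).target, t.chartIntegrand g i y
  rw [← finsum_sub_distrib (t.finite_support_integral hfc) (t.finite_support_integral hgc)]
  refine finsum_congr fun i => ?_
  rw [← MeasureTheory.integral_sub (t.integrableOn_chartIntegrand hf hfc i)
    (t.integrableOn_chartIntegrand hg hgc i)]
  refine MeasureTheory.integral_congr_ae (Filter.Eventually.of_forall fun y => ?_)
  exact smul_sub _ _ _

open MeasureTheory in
/-- A continuous nonnegative function of compact support with vanishing integral vanishes. -/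
theorem Tetrad.eq_zero_of_integral_eq_zero (t : Tetrad M) {f : M → ℝ} (hf : Continuous f)
    (hc : HasCompactSupport f) (h0 : ∀ x, 0 ≤ f x) (hi : t.integral (fun x => (f x : ℂ)) = 0)
    (p : M) : f p = 0 := by
  by_contra hp
  have hfp : 0 < f p := lt_of_le_of_ne (h0 p) (Ne.symm hp)
  let F : M → ℂ := fun x => (f x : ℂ)
  have hF : Continuous F := Complex.continuous_ofReal.comp hf
  have hFc : HasCompactSupport F := hc.comp_left (g := fun r : ℝ => (r : ℂ)) (by simp)
  let Gr : M → E4 → ℝ := fun i y =>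
    (chartPartition M i ((chartAt E4 i).symm y) * t.volDensity i ((chartAt E4 i).symm y)) *
      f ((chartAt E4 i).symm y)
  have hGr : ∀ i y, t.chartIntegrand F i y = (Gr i y : ℂ) := fun i y => by
    simp [Tetrad.chartIntegrand, Gr, F]
  have hG0 : ∀ i y, y ∈ (chartAt E4 i).target → 0 ≤ Gr i y := fun i y hy =>
    mul_nonneg (mul_nonneg ((chartPartition M).nonneg i _)
      (t.volDensity_pos ((chartAt E4 i).map_target hy)).le) (h0 _)
  let J : M → ℝ := fun i => ∫ y in (chartAt E4 i).target, Gr i y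
  have hJ : ∀ i, ∫ y in (chartAt E4 i).target, t.chartIntegrand F i y = (J i : ℂ) := fun i => by
    simp only [hGr]
    exact integral_ofReal
  have hJ0 : ∀ i, 0 ≤ J i := fun i =>
    setIntegral_nonneg (chartAt E4 i).open_target.measurableSet (hG0 i)
  have hfin : (Function.support J).Finite := by
    refine (t.finite_support_integral hFc).subset fun i hi => ?_
    change ∫ y in (chartAt E4 i).target, t.chartIntegrand F i y ≠ 0
    rw [hJ]
    exact Complex.ofReal_ne_zero.2 hi
  have hsum : ∑ᶠ i, J i = 0 := by
    have e : t.integral F = ((∑ᶠ i, J i : ℝ) : ℂ) := by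
      change ∑ᶠ i, ∫ y in (chartAt E4 i).target, t.chartIntegrand F i y = _
      simp only [hJ]
      exact (map_finsum Complex.ofRealHom hfin).symm
    have e2 : t.integral F = 0 := hi
    rw [e] at e2
    exact_mod_cast e2
  obtain ⟨i, hip⟩ : ∃ i, 0 < chartPartition M i p :=
    (chartPartition M).exists_pos_of_mem (Set.mem_univ p)
  have hps : p ∈ (chartAt E4 i).source :=
    tsupport_chartPartition i (subset_tsupport _ hip.ne')
  have hJi : J i = 0 := by
    have h1 : J i ≤ ∑ᶠ i, J i := single_le_finsum i hfin hJ0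
    rw [hsum] at h1
    exact le_antisymm h1 (hJ0 i)
  have hint : IntegrableOn (Gr i) (chartAt E4 i).target := by
    have := (t.integrableOn_chartIntegrand hF hFc i).re
    refine this.congr (Filter.Eventually.of_forall fun y => ?_)
    simp [hGr]
  have hcont : ContinuousOn (Gr i) (chartAt E4 i).target := by
    have := Complex.continuous_re.comp_continuousOn (t.continuousOn_chartIntegrand hF i)
    refine this.congr fun y _ => ?_
    simp [hGr]
  have hae : Gr i =ᵐ[volume.restrict (chartAt E4 i).target] fun _ => 0 := by
    refine (setIntegral_eq_zero_iff_of_nonneg_ae ?_ hint).1 hJi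
    exact (ae_restrict_iff' (chartAt E4 i).open_target.measurableSet).2
      (Filter.Eventually.of_forall (hG0 i))
  have heq := Measure.eqOn_open_of_ae_eq hae (chartAt E4 i).open_target hcont continuousOn_const
  have h1 := heq ((chartAt E4 i).map_source hps)
  simp only [Gr, (chartAt E4 i).left_inv hps] at h1
  exact (mul_pos (mul_pos hip (t.volDensity_pos hps)) hfp).ne' h1

end Integral

/-! ### The opposite on the finite part -/

section FiniteOpp
variable {N : ℕ}

theorem YukawaData.sgn_mul_sgn (y : YukawaData N) : y.sgn * y.sgn = 1 := by
  rcases Int.units_eq_one_or y.s with h | h <;> simp [YukawaData.sgn, h]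

theorem YukawaData.star_sgn (y : YukawaData N) : star y.sgn = y.sgn := by
  simp [YukawaData.sgn]

theorem blocks_add (X Y : Matrix (Fin 4) (Fin 4) (Matrix (GenIdx N) (GenIdx N) ℂ)) :
    blocks X + blocks Y = blocks (X + Y) := rfl

theorem blocks_sub (X Y : Matrix (Fin 4) (Fin 4) (Matrix (GenIdx N) (GenIdx N) ℂ)) :
    blocks X - blocks Y = blocks (X - Y) := rfl

theorem transpose_blocks (X : Matrix (Fin 4) (Fin 4) (Matrix (GenIdx N) (GenIdx N) ℂ)) :
    (blocks X).transpose = blocks (X.transpose.map Matrix.transpose) := rfl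

theorem exists_eq_blocks (B : Matrix (FinIdx N) (FinIdx N) ℂ) : ∃ X, B = blocks X :=
  ⟨(Matrix.comp _ _ _ _ _).symm B, (Equiv.apply_symm_apply _ _).symm⟩

/-- The eigenvalues of `ω_F` on the four summands of `K_F`. -/
def YukawaData.omegaSign (y : YukawaData N) : Fin 4 → ℂ := ![1, 1, -y.sgn, -y.sgn]

theorem YukawaData.omegaF_eq (y : YukawaData N) :
    y.omegaF = blocks (Matrix.diagonal fun i => y.omegaSign i • 1) := by
  rw [YukawaData.omegaF, chiF, YukawaData.etaF, blocks_mul, Matrix.diagonal_mul_diagonal]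
  congr 2
  ext i : 1
  fin_cases i <;> simp [YukawaData.omegaSign]

theorem YukawaData.omegaF_eq_diagonal (y : YukawaData N) :
    y.omegaF = Matrix.diagonal fun i => y.omegaSign i.1 := by
  rw [y.omegaF_eq]
  ext ⟨i, i'⟩ ⟨j, j'⟩
  change (Matrix.diagonal (fun i => y.omegaSign i • (1 : Matrix (GenIdx N) (GenIdx N) ℂ)) i j) i' j' = _
  by_cases h : i = j
  · subst h
    by_cases h' : i' = j' <;> simp [h']
  · simp [h]

theorem YukawaData.omegaSign_mul_self (y : YukawaData N) (i : Fin 4) :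
    y.omegaSign i * y.omegaSign i = 1 := by
  fin_cases i <;> simp [YukawaData.omegaSign, y.sgn_mul_sgn]

theorem YukawaData.star_omegaSign (y : YukawaData N) (i : Fin 4) :
    star (y.omegaSign i) = y.omegaSign i := by
  have h := y.star_sgn
  fin_cases i
  · exact star_one ℂ
  · exact star_one ℂ
  · exact (star_neg _).trans (congrArg _ h)
  · exact (star_neg _).trans (congrArg _ h)

theorem YukawaData.omegaF_mul_omegaF (y : YukawaData N) : y.omegaF * y.omegaF = 1 := by
  rw [y.omegaF_eq_diagonal, Matrix.diagonal_mul_diagonal, ← Matrix.diagonal_one]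
  congr 1
  ext i
  exact y.omegaSign_mul_self _

theorem YukawaData.transpose_omegaF (y : YukawaData N) : y.omegaF.transpose = y.omegaF := by
  rw [y.omegaF_eq_diagonal, Matrix.diagonal_transpose]

theorem YukawaData.map_star_omegaF (y : YukawaData N) : y.omegaF.map star = y.omegaF := by
  rw [y.omegaF_eq_diagonal, Matrix.diagonal_map (star_zero ℂ)]
  congr 1
  ext i
  exact y.star_omegaSign _

theorem JFMat_mul_chiF : JFMat N * chiF N = blocks (swapMat _) := by
  rw [JFMat, chiF, blocks_mul, swapMat_eq]

theorem blocks_swapMat_sq :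
    blocks (swapMat (Matrix (GenIdx N) (GenIdx N) ℂ)) * blocks (swapMat _) = 1 := by
  rw [blocks_mul, swapMat_sq, blocks_one]

/-- The anti-automorphism `B ↦ B^o` of `End K_F`, that is, `B^o = W (ω_F Bᵀ ω_F) W` with the matrix
`W = W⁻¹` of `J_F χ_F`: complex conjugation turns the `B†` of the Krein adjoint into `Bᵀ`. It is the
restriction of `T ↦ T^o` to operators `1 ⊗ B`. -/
def YukawaData.oppF (y : YukawaData N) :
    Matrix (FinIdx N) (FinIdx N) ℂ →ₗ[ℂ] Matrix (FinIdx N) (FinIdx N) ℂ where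
  toFun B := blocks (swapMat _) * (y.omegaF * B.transpose * y.omegaF) * blocks (swapMat _)
  map_add' A B := by
    simp only [Matrix.transpose_add, mul_add, add_mul]
  map_smul' c B := by
    simp only [Matrix.transpose_smul, Matrix.mul_smul, Matrix.smul_mul, RingHom.id_apply]

theorem YukawaData.oppF_apply (y : YukawaData N) (B : Matrix (FinIdx N) (FinIdx N) ℂ) :
    y.oppF B =
      blocks (swapMat _) * (y.omegaF * B.transpose * y.omegaF) * blocks (swapMat _) := rfl

theorem YukawaData.oppF_mul (y : YukawaData N) (A B : Matrix (FinIdx N) (FinIdx N) ℂ) :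
    y.oppF (A * B) = y.oppF B * y.oppF A := by
  rw [oppF_apply, oppF_apply, oppF_apply, Matrix.transpose_mul]
  set W := blocks (swapMat (Matrix (GenIdx N) (GenIdx N) ℂ))
  have e : W * (y.omegaF * B.transpose * y.omegaF) * W *
      (W * (y.omegaF * A.transpose * y.omegaF) * W) =
      W * (y.omegaF * B.transpose * (y.omegaF * (W * W) * y.omegaF) * A.transpose *
        y.omegaF) * W := by
    simp only [mul_assoc]
  rw [e, blocks_swapMat_sq, mul_one, y.omegaF_mul_omegaF, mul_one]
  simp only [mul_assoc]

/-- The signs `c` for which `(B^o)_{ij} = c_i c_j (B_{j+2,i+2})ᵀ` in block form. -/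
def YukawaData.oppSign (y : YukawaData N) : Fin 4 → ℂ := ![-y.sgn, y.sgn, 1, -1]

theorem YukawaData.swapMat_mul_omega (y : YukawaData N) :
    swapMat (Matrix (GenIdx N) (GenIdx N) ℂ) * Matrix.diagonal (fun i => y.omegaSign i • 1) =
      Matrix.of fun i k => if k = i + 2 then y.oppSign i • 1 else 0 := by
  ext i k : 2
  rw [Matrix.mul_diagonal]
  fin_cases i <;> fin_cases k <;>
    simp [swapMat, YukawaData.omegaSign, YukawaData.oppSign]

theorem YukawaData.omega_mul_swapMat (y : YukawaData N) :
    Matrix.diagonal (fun i => y.omegaSign i • 1) * swapMat (Matrix (GenIdx N) (GenIdx N) ℂ) =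
      Matrix.of fun k j => if k = j + 2 then y.oppSign j • 1 else 0 := by
  ext k j : 2
  rw [Matrix.diagonal_mul]
  fin_cases k <;> fin_cases j <;>
    simp [swapMat, YukawaData.omegaSign, YukawaData.oppSign]

theorem YukawaData.oppF_blocks (y : YukawaData N)
    (X : Matrix (Fin 4) (Fin 4) (Matrix (GenIdx N) (GenIdx N) ℂ)) :
    y.oppF (blocks X) = blocks (Matrix.of fun i j =>
      (y.oppSign i * y.oppSign j) • (X (j + 2) (i + 2)).transpose) := by
  have e : y.oppF (blocks X) = (blocks (swapMat _) * y.omegaF) * (blocks X).transpose *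
      (y.omegaF * blocks (swapMat _)) := by
    rw [oppF_apply]
    simp only [mul_assoc]
  rw [e, y.omegaF_eq, transpose_blocks, blocks_mul, blocks_mul, blocks_mul, blocks_mul,
    y.swapMat_mul_omega, y.omega_mul_swapMat]
  congr 1
  ext i j : 2
  simp only [Matrix.mul_apply, Matrix.of_apply, ite_mul, mul_ite, zero_mul, mul_zero,
    Finset.sum_ite_eq', Finset.mem_univ, if_true, Matrix.map_apply,
    Matrix.transpose_apply, Matrix.smul_mul, Matrix.mul_smul, one_mul, mul_one, smul_smul]
  rw [mul_comm]

theorem YukawaData.oppF_oppF (y : YukawaData N) (B : Matrix (FinIdx N) (FinIdx N) ℂ) :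
    y.oppF (y.oppF B) = B := by
  obtain ⟨X, rfl⟩ := exists_eq_blocks B
  have hc : ∀ i, y.oppSign i * y.oppSign (i + 2) = -y.sgn := by
    intro i
    fin_cases i <;> simp [YukawaData.oppSign]
  have h4 : ∀ i : Fin 4, i + 2 + 2 = i := by decide
  rw [oppF_blocks, oppF_blocks]
  congr 1
  ext i j : 2
  simp only [Matrix.of_apply, h4, Matrix.transpose_smul, Matrix.transpose_transpose, smul_smul]
  rw [show y.oppSign i * y.oppSign j * (y.oppSign (j + 2) * y.oppSign (i + 2)) =
    (y.oppSign i * y.oppSign (i + 2)) * (y.oppSign j * y.oppSign (j + 2)) by ring, hc, hc,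
    neg_mul_neg, y.sgn_mul_sgn, one_smul]

theorem YukawaData.transpose_M₀ (y : YukawaData N) : y.M₀.transpose = -(y.sgn • y.M₀) := by
  have h := y.m₀_transpose
  ext ⟨i, i'⟩ ⟨j, j'⟩
  have hm : y.m₀ j' i' = -y.sgn * y.m₀ i' j' := by
    have := congrFun (congrFun h i') j'
    exact this
  rcases i with i | i <;> rcases j with j | j
  · fin_cases i <;> fin_cases j <;>
      simp [YukawaData.M₀, lepQua, Matrix.kroneckerMap_apply, hm]
  all_goals simp [YukawaData.M₀, lepQua, Matrix.kroneckerMap_apply]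

/-- `D_F^o = D_F`; this is where the symmetry `m₀ᵀ = -s m₀` enters. -/
theorem YukawaData.oppF_DF (y : YukawaData N) : y.oppF y.DF = y.DF := by
  have hs := y.sgn_mul_sgn
  have hM : ∀ i j, y.M₀ j i = -(y.sgn * y.M₀ i j) := fun i j =>
    congrFun (congrFun y.transpose_M₀ i) j
  have hss : star y.sgn = y.sgn := y.star_sgn
  have z : ∀ c : ℂ, c • (0 : Matrix (GenIdx N) (GenIdx N) ℂ).transpose = 0 := fun c => by
    rw [Matrix.transpose_zero, smul_zero]
  have h01 : (-y.sgn * y.sgn) • (y.Y₀.map star).transpose = -y.Y₀.conjTranspose := by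
    rw [neg_mul, hs, neg_one_smul]
    rfl
  have h10 : (y.sgn * -y.sgn) • (-y.Y₀.transpose).transpose = y.Y₀ := by
    rw [mul_neg, hs, neg_one_smul, Matrix.transpose_neg, Matrix.transpose_transpose, neg_neg]
  have h02 : (-y.sgn * 1) • (y.sgn • y.M₀.conjTranspose).transpose =
      y.sgn • y.M₀.conjTranspose := by
    ext i j
    change -y.sgn * 1 * (y.sgn * star (y.M₀ i j)) = y.sgn * star (y.M₀ j i)
    rw [hM i j, star_neg, star_mul', hss]
    ring
  have h20 : (1 * -y.sgn) • y.M₀.transpose = y.M₀ := by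
    ext i j
    change 1 * -y.sgn * y.M₀ j i = y.M₀ i j
    rw [hM i j]
    linear_combination y.M₀ i j * hs
  have h23 : ((1 : ℂ) * -1) • y.Y₀.transpose = -y.Y₀.transpose := by
    rw [one_mul, neg_one_smul]
  have h32 : ((-1 : ℂ) * 1) • (-y.Y₀.conjTranspose).transpose = y.Y₀.map star := by
    rw [mul_one, neg_one_smul, Matrix.transpose_neg, neg_neg]
    rfl
  rw [YukawaData.DF, oppF_blocks]
  congr 1
  refine Matrix.ext fun i j => ?_
  fin_cases i <;> fin_cases j
  exacts [z _, h01, h02, z _, h10, z _, z _, z _, h20, z _, z _, h23, z _, z _, h32, z _]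

end FiniteOpp

/-! ### The opposite on spinors -/

section SpinOpp

theorem gam_zero_sq : gam 0 * gam 0 = 1 := by
  ext i j
  fin_cases i <;> fin_cases j <;> simp [gam, Matrix.mul_apply, Fin.sum_univ_four]

theorem conjTranspose_gam_zero : (gam 0).conjTranspose = gam 0 := by
  ext i j
  fin_cases i <;> fin_cases j <;> simp [gam]

theorem map_star_mul {n : Type*} [Fintype n] (A B : Matrix n n ℂ) :
    (A * B).map star = A.map star * B.map star := by
  ext i j
  simp [Matrix.mul_apply]

/-- The effect of `T ↦ T^o` on the spinor factor: `C^o = J_S (γ⁰ C† γ⁰) J_S⁻¹`, where the inverse of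
`J_S ψ = γ² ψ̄` is `J_S` itself. -/
def oppS (C : Matrix (Fin 4) (Fin 4) ℂ) : Matrix (Fin 4) (Fin 4) ℂ :=
  gam 2 * (gam 0 * C.conjTranspose * gam 0).map star * (gam 2).map star

/-- The matrix `γ⁰ γ²`. -/
def spinConj : Matrix (Fin 4) (Fin 4) ℂ :=
  !![0, -Complex.I, 0, 0; Complex.I, 0, 0, 0; 0, 0, 0, Complex.I; 0, 0, -Complex.I, 0]

theorem spinConj_sq : spinConj * spinConj = 1 := by
  ext i j
  fin_cases i <;> fin_cases j <;> simp [spinConj, Matrix.mul_apply, Fin.sum_univ_four]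

theorem oppS_eq (C : Matrix (Fin 4) (Fin 4) ℂ) : oppS C = spinConj * C.transpose * spinConj := by
  have h0 : (gam 0).map star = gam 0 := by
    ext i j
    fin_cases i <;> fin_cases j <;> simp [gam]
  have h1 : gam 2 * gam 0 = -spinConj := by
    ext i j
    fin_cases i <;> fin_cases j <;> simp [gam, spinConj, Matrix.mul_apply, Fin.sum_univ_four]
  have h2 : gam 0 * (gam 2).map star = -spinConj := by
    ext i j
    fin_cases i <;> fin_cases j <;> simp [gam, spinConj, Matrix.mul_apply, Fin.sum_univ_four]
  have hC : C.conjTranspose.map star = C.transpose := by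
    ext i j
    simp
  have e : oppS C = (gam 2 * gam 0) * C.transpose * (gam 0 * (gam 2).map star) := by
    rw [oppS, map_star_mul, map_star_mul, h0, hC]
    simp only [mul_assoc]
  rw [e, h1, h2, neg_mul, neg_mul_neg]

theorem oppS_one : oppS 1 = 1 := by
  rw [oppS_eq, Matrix.transpose_one, mul_one, spinConj_sq]

theorem oppS_chiS : oppS chiS = chiS := by
  have h : spinConj * chiS.transpose = chiS * spinConj := by
    ext i j
    fin_cases i <;> fin_cases j <;>
      simp [spinConj, chiS, Matrix.mul_apply, Matrix.diagonal_apply]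
  rw [oppS_eq, h, mul_assoc, spinConj_sq, mul_one]

theorem oppS_gam (a : Fin 4) : oppS (Complex.I • gam a) = -(Complex.I • gam a) := by
  have h : spinConj * (gam a).transpose = -(gam a * spinConj) := by
    fin_cases a <;> ext i j <;> fin_cases i <;> fin_cases j <;>
      simp [spinConj, gam, Matrix.mul_apply, Fin.sum_univ_four]
  rw [oppS_eq, Matrix.transpose_smul, Matrix.mul_smul, h, Matrix.smul_mul, neg_mul, mul_assoc,
    spinConj_sq, mul_one, smul_neg]

end SpinOpp

/-! ### Krein adjoints of zero-order operators and their opposites -/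

section Opp
variable {N : ℕ}

/-- The matrix of the Krein product on the fibre. -/
def YukawaData.kreinMat (y : YukawaData N) : Matrix (TotIdx N) (TotIdx N) ℂ := gam 0 ⊗ₖ y.omegaF

theorem YukawaData.kreinMat_sq (y : YukawaData N) : y.kreinMat * y.kreinMat = 1 := by
  rw [kreinMat, ← Matrix.mul_kronecker_mul, gam_zero_sq, y.omegaF_mul_omegaF,
    Matrix.one_kronecker_one]

theorem YukawaData.conjTranspose_kreinMat (y : YukawaData N) :
    y.kreinMat.conjTranspose = y.kreinMat := by
  have h : y.omegaF.conjTranspose = y.omegaF := by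
    change y.omegaF.transpose.map star = _
    rw [y.transpose_omegaF, y.map_star_omegaF]
  rw [kreinMat, Matrix.conjTranspose_kronecker, conjTranspose_gam_zero, h]

/-- The fibrewise Krein adjoint. -/
def YukawaData.adjTot (y : YukawaData N) (T : Matrix (TotIdx N) (TotIdx N) ℂ) :
    Matrix (TotIdx N) (TotIdx N) ℂ := y.kreinMat * T.conjTranspose * y.kreinMat

/-- The fibrewise anti-automorphism `T ↦ T^o`, with the antilinear `J` written as a matrix followed by
complex conjugation. -/
def YukawaData.oppTot (y : YukawaData N) (T : Matrix (TotIdx N) (TotIdx N) ℂ) :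
    Matrix (TotIdx N) (TotIdx N) ℂ :=
  JMat N * (y.adjTot T).map star * (JMat N).map star

theorem map_star_kronecker {m n : Type*} (A : Matrix m m ℂ) (B : Matrix n n ℂ) :
    (A ⊗ₖ B).map star = A.map star ⊗ₖ B.map star := by
  ext i j
  exact star_mul' _ _

theorem YukawaData.oppTot_kronecker (y : YukawaData N) (C : Matrix (Fin 4) (Fin 4) ℂ)
    (B : Matrix (FinIdx N) (FinIdx N) ℂ) : y.oppTot (C ⊗ₖ B) = oppS C ⊗ₖ y.oppF B := by
  have h1 : (y.omegaF * B.conjTranspose * y.omegaF).map star =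
      y.omegaF * B.transpose * y.omegaF := by
    rw [map_star_mul, map_star_mul, y.map_star_omegaF]
    congr 2
    ext i j
    simp
  rw [oppTot, adjTot, kreinMat, Matrix.conjTranspose_kronecker, ← Matrix.mul_kronecker_mul,
    ← Matrix.mul_kronecker_mul, JMat, map_star_kronecker, map_star_kronecker, h1,
    ← Matrix.mul_kronecker_mul, ← Matrix.mul_kronecker_mul, JFMat_mul_chiF, blocks_swapMat_star]
  rfl

theorem YukawaData.adjTot_mul (y : YukawaData N) (S T : Matrix (TotIdx N) (TotIdx N) ℂ) :
    y.adjTot (S * T) = y.adjTot T * y.adjTot S := by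
  have e : y.adjTot T * y.adjTot S = y.kreinMat * T.conjTranspose * (y.kreinMat * y.kreinMat) *
      S.conjTranspose * y.kreinMat := by
    simp only [adjTot, mul_assoc]
  rw [e, y.kreinMat_sq, mul_one, adjTot, Matrix.conjTranspose_mul]
  simp only [mul_assoc]

theorem YukawaData.oppTot_mul (y : YukawaData N) (S T : Matrix (TotIdx N) (TotIdx N) ℂ) :
    y.oppTot (S * T) = y.oppTot T * y.oppTot S := by
  have e : y.oppTot T * y.oppTot S = JMat N * (y.adjTot T).map star *
      ((JMat N).map star * JMat N) * (y.adjTot S).map star * (JMat N).map star := by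
    simp only [oppTot, mul_assoc]
  rw [e, mul_eq_one_comm.1 JMat_mul_conj, mul_one, oppTot, y.adjTot_mul, map_star_mul]
  simp only [mul_assoc]

theorem YukawaData.oppTot_add (y : YukawaData N) (S T : Matrix (TotIdx N) (TotIdx N) ℂ) :
    y.oppTot (S + T) = y.oppTot S + y.oppTot T := by
  have h : (y.adjTot (S + T)).map star = (y.adjTot S).map star + (y.adjTot T).map star := by
    rw [adjTot, Matrix.conjTranspose_add, mul_add, add_mul]
    exact Matrix.map_add _ (fun _ _ => star_add _ _) _ _
  rw [oppTot, h, mul_add, add_mul]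
  rfl

theorem YukawaData.oppTot_real (y : YukawaData N) (r : ℝ) :
    y.oppTot ((r : ℂ) • 1) = (r : ℂ) • 1 := by
  have h : (y.adjTot ((r : ℂ) • 1)).map star = (r : ℂ) • 1 := by
    rw [adjTot, Matrix.conjTranspose_smul, Matrix.conjTranspose_one, Matrix.mul_smul, mul_one,
      Matrix.smul_mul, y.kreinMat_sq]
    ext i j
    by_cases hij : i = j <;> simp [hij]
  rw [oppTot, h, Matrix.mul_smul, mul_one, Matrix.smul_mul, JMat_mul_conj]

variable {M : Type*} [TopologicalSpace M] [ChartedSpace E4 M] [IsManifold (𝓡 4) ∞ M]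

theorem SmoothMat.map_star {m n : Type*} {T : M → Matrix m n ℂ} (hT : SmoothMat T) :
    SmoothMat (fun x => (T x).map star) :=
  fun i j => contMDiff_linear (hT i j) Complex.conjAe.toLinearMap

theorem SmoothMat.adjTot (y : YukawaData N) {T : M → Matrix (TotIdx N) (TotIdx N) ℂ}
    (hT : SmoothMat T) : SmoothMat (fun x => y.adjTot (T x)) :=
  ((SmoothMat.const _).mul hT.conjTranspose).mul (SmoothMat.const _)

theorem SmoothMat.oppTot (y : YukawaData N) {T : M → Matrix (TotIdx N) (TotIdx N) ℂ}
    (hT : SmoothMat T) : SmoothMat (fun x => y.oppTot (T x)) :=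
  ((SmoothMat.const _).mul (hT.adjTot y).map_star).mul (SmoothMat.const _)

theorem SmoothMat.oppF (y : YukawaData N) {B : M → Matrix (FinIdx N) (FinIdx N) ℂ}
    (hB : SmoothMat B) : SmoothMat (fun x => y.oppF (B x)) :=
  hB.map_linear (y.oppF.restrictScalars ℝ)

variable [T2Space M] [SigmaCompactSpace M]

theorem isKreinAdj_mulOp (t : Tetrad M) (y : YukawaData N)
    {T : M → Matrix (TotIdx N) (TotIdx N) ℂ} (hT : SmoothMat T) :
    IsKreinAdj t y (mulOp T hT) (mulOp (fun x => y.adjTot (T x)) (hT.adjTot y)) := by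
  intro ψ φ
  unfold krein
  congr 1
  ext x
  rw [mulOp_apply, mulOp_apply, Matrix.star_mulVec, ← Matrix.dotProduct_mulVec,
    Matrix.mulVec_mulVec, Matrix.mulVec_mulVec]
  congr 2
  change _ = y.kreinMat * (y.kreinMat * (T x).conjTranspose * y.kreinMat)
  rw [← mul_assoc, ← mul_assoc, y.kreinMat_sq, one_mul]
  rfl

theorem continuous_krein_integrand (y : YukawaData N) (ψ φ : Spinor M N) :
    Continuous (fun x => dotProduct (star (ψ.1 x)) ((gam 0 ⊗ₖ y.omegaF).mulVec (φ.1 x))) := by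
  have h1 : Continuous ψ.1 := ψ.2.1.continuous
  have h2 : Continuous φ.1 := φ.2.1.continuous
  exact (h1.star).dotProduct (continuous_const.matrix_mulVec h2)

theorem hasCompactSupport_krein_integrand (y : YukawaData N) (ψ φ : Spinor M N) :
    HasCompactSupport
      (fun x => dotProduct (star (ψ.1 x)) ((gam 0 ⊗ₖ y.omegaF).mulVec (φ.1 x))) :=
  φ.2.2.mono fun x hx h => hx (by simp [h])

/-- The Krein product is nondegenerate, so that Krein adjoints are unique. -/
theorem IsKreinAdj.unique {t : Tetrad M} {y : YukawaData N} {A B B' : Op M N}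
    (h : IsKreinAdj t y A B) (h' : IsKreinAdj t y A B') : B = B' := by
  refine LinearMap.ext fun φ => ?_
  let χ : Spinor M N := B φ - B' φ
  have hχ : ∀ x, χ.1 x = (B φ).1 x - (B' φ).1 x := fun x => rfl
  have h1 : ∀ ψ, krein t y ψ χ = 0 := by
    intro ψ
    have e : krein t y ψ χ = krein t y ψ (B φ) - krein t y ψ (B' φ) := by
      unfold krein
      rw [← t.integral_sub (continuous_krein_integrand y ψ _)
        (hasCompactSupport_krein_integrand y ψ _) (continuous_krein_integrand y ψ _)
        (hasCompactSupport_krein_integrand y ψ _)]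
      congr 1
      ext x
      rw [hχ, Matrix.mulVec_sub, dotProduct_sub]
    rw [e, ← h, ← h', sub_self]
  -- Pairing `χ` with the image of `χ` under the fibre metric gives the integral of `|χ|²`.
  let G : Op M N := mulOp (fun _ => y.kreinMat) (SmoothMat.const _)
  let f : M → ℝ := fun x => ∑ i, Complex.normSq (χ.1 x i)
  have hint : ∀ x, dotProduct (star ((G χ).1 x)) ((gam 0 ⊗ₖ y.omegaF).mulVec (χ.1 x)) =
      (f x : ℂ) := by
    intro x
    change dotProduct (star (y.kreinMat.mulVec (χ.1 x))) (y.kreinMat.mulVec (χ.1 x)) = _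
    rw [Matrix.star_mulVec, ← Matrix.dotProduct_mulVec, y.conjTranspose_kreinMat,
      Matrix.mulVec_mulVec, y.kreinMat_sq, Matrix.one_mulVec]
    simp only [dotProduct, f, Complex.ofReal_sum]
    exact Finset.sum_congr rfl fun i _ => (Complex.normSq_eq_conj_mul_self).symm
  have h0 : t.integral (fun x => (f x : ℂ)) = 0 := by
    rw [← h1 (G χ), krein]
    congr 1
    ext x
    exact (hint x).symm
  have hχc : Continuous χ.1 := χ.2.1.continuous
  have hf : Continuous f := continuous_finsetSum _ fun i _ =>
    Complex.continuous_normSq.comp ((continuous_apply i).comp hχc)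
  have hfc : HasCompactSupport f := χ.2.2.mono fun x hx hz => hx (by simp [f, hz])
  have hzero := t.eq_zero_of_integral_eq_zero hf hfc
    (fun x => Finset.sum_nonneg fun i _ => Complex.normSq_nonneg _) h0
  refine sub_eq_zero.1 (spinor_ext fun x => ?_)
  ext i
  exact Complex.normSq_eq_zero.1 ((Finset.sum_eq_zero_iff_of_nonneg
    fun i _ => Complex.normSq_nonneg _).1 (hzero x) i (Finset.mem_univ i))

/-- The adjoint that `kreinAdj` chooses is the expected one, by uniqueness. -/
theorem kreinAdj_eq {t : Tetrad M} {y : YukawaData N} {A B : Op M N} (h : IsKreinAdj t y A B) :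
    kreinAdj t y A = B := by
  have hex : ∃ B : Op M N, IsKreinAdj t y A B := ⟨B, h⟩
  rw [kreinAdj, dif_pos hex]
  exact hex.choose_spec.unique h

theorem opp_mulOp (t : Tetrad M) (y : YukawaData N)
    {T : M → Matrix (TotIdx N) (TotIdx N) ℂ} (hT : SmoothMat T) :
    opp t y (mulOp T hT) = mulOp (fun x => y.oppTot (T x)) (hT.oppTot y) := by
  rw [opp, kreinAdj_eq (isKreinAdj_mulOp t y hT)]
  refine LinearMap.ext fun ψ => spinor_ext fun x => ?_
  change (JMat N).mulVec (star ((y.adjTot (T x)).mulVec ((JMat N).mulVec (star (ψ.1 x))))) =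
    (y.oppTot (T x)).mulVec (ψ.1 x)
  have hstar : ∀ (A : Matrix (TotIdx N) (TotIdx N) ℂ) v,
      star (A.mulVec v) = (A.map star).mulVec (star v) := by
    intro A v
    ext i
    simp [Matrix.mulVec, dotProduct]
  rw [hstar, hstar, star_star, Matrix.mulVec_mulVec, Matrix.mulVec_mulVec]
  rfl

theorem opp_intOp (t : Tetrad M) (y : YukawaData N)
    {B : M → Matrix (FinIdx N) (FinIdx N) ℂ} (hB : SmoothMat B) :
    opp t y (intOp B hB) = intOp (fun x => y.oppF (B x)) (hB.oppF y) := by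
  rw [intOp, opp_mulOp]
  refine mulOp_congr fun x => ?_
  rw [y.oppTot_kronecker, oppS_one]

/-- `T ↦ T^o` is an anti-automorphism of the zero-order operators with
`[D, b]^o = -[D, b^o]` for internal `b`. All adjoints involved are fibrewise, and the sign comes from
`(i γᵃ)^o = -i γᵃ`, `χ_S^o = χ_S` and `D_F^o = D_F`. -/
theorem oppData (t : Tetrad M) (y : YukawaData N) :
    OppData (dirac t y) (zeroOrder M N) (internal M N) (opp t y) where
  map_add := by
    rintro _ ⟨S, hS, rfl⟩ _ ⟨T, hT, rfl⟩
    rw [mulOp_add, opp_mulOp, opp_mulOp, opp_mulOp, mulOp_add]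
    exact mulOp_congr fun x => y.oppTot_add _ _
  map_mul := by
    rintro _ ⟨S, hS, rfl⟩ _ ⟨T, hT, rfl⟩
    rw [mulOp_mul, opp_mulOp, opp_mulOp, opp_mulOp, mulOp_mul]
    exact mulOp_congr fun x => y.oppTot_mul _ _
  map_real r := by
    rw [algebraMap_eq_mulOp, opp_mulOp]
    exact mulOp_congr fun x => y.oppTot_real r
  le := internal_le_zeroOrder
  commutator_mem := by
    rintro _ ⟨B, hB, rfl⟩
    exact ⟨_, _, dirac_commutator t y hB⟩
  map_commutator := by
    rintro _ ⟨B, hB, rfl⟩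
    rw [opp_intOp, dirac_commutator, dirac_commutator, opp_mulOp, mulOp_neg]
    refine mulOp_congr fun x => ?_
    have hd : ∀ a, t.matDeriv a (fun y' => y.oppF (B y')) x = y.oppF (t.matDeriv a B x) :=
      fun a => t.matDeriv_map_linear a hB (y.oppF.restrictScalars ℝ) x
    have hsum : ∀ s : Finset (Fin 4),
        y.oppTot (∑ a ∈ s, (Complex.I • gam a) ⊗ₖ t.matDeriv a B x) =
        -∑ a ∈ s, (Complex.I • gam a) ⊗ₖ y.oppF (t.matDeriv a B x) := by
      intro s
      induction s using Finset.induction_on with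
      | empty =>
        have := y.oppTot_real 0
        simpa using this
      | insert a s ha ih =>
        rw [Finset.sum_insert ha, Finset.sum_insert ha, y.oppTot_add, ih, y.oppTot_kronecker,
          oppS_gam, neg_add]
        congr 1
        ext i j
        simp [Matrix.kroneckerMap_apply]
    rw [y.oppTot_add, hsum, y.oppTot_kronecker, oppS_chiS, map_add, map_neg, y.oppF_mul, y.oppF_mul,
      y.oppF_DF, neg_add]
    simp only [hd]
    congr 1
    ext i j
    simp [Matrix.kroneckerMap_apply]
    ring

end Opp

/-! ### The order-one condition on the finite part -/

section FiniteOrderOne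
variable {N : ℕ}

theorem lepQua_mul (a a' : Matrix (Fin 2) (Fin 2) ℂ)
    (b b' : Matrix (Fin 2 × Fin 3) (Fin 2 × Fin 3) ℂ) (g g' : Matrix (Fin N) (Fin N) ℂ) :
    lepQua a b g * lepQua a' b' g' = lepQua (a * a') (b * b') (g * g') := by
  rw [lepQua, lepQua, ← Matrix.mul_kronecker_mul, Matrix.fromBlocks_multiply, lepQua]
  simp

theorem transpose_lepQua (a : Matrix (Fin 2) (Fin 2) ℂ)
    (b : Matrix (Fin 2 × Fin 3) (Fin 2 × Fin 3) ℂ) (g : Matrix (Fin N) (Fin N) ℂ) :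
    (lepQua a b g).transpose = lepQua a.transpose b.transpose g.transpose := by
  rw [lepQua, lepQua, ← Matrix.kroneckerMap_transpose, Matrix.fromBlocks_transpose,
    Matrix.transpose_zero, Matrix.transpose_zero]

theorem conjTranspose_lepQua (a : Matrix (Fin 2) (Fin 2) ℂ)
    (b : Matrix (Fin 2 × Fin 3) (Fin 2 × Fin 3) ℂ) (g : Matrix (Fin N) (Fin N) ℂ) :
    (lepQua a b g).conjTranspose = lepQua a.conjTranspose b.conjTranspose g.conjTranspose := by
  rw [lepQua, lepQua, Matrix.conjTranspose_kronecker, Matrix.fromBlocks_conjTranspose,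
    Matrix.conjTranspose_zero, Matrix.conjTranspose_zero]

theorem smul_lepQua (r : ℂ) (a : Matrix (Fin 2) (Fin 2) ℂ)
    (b : Matrix (Fin 2 × Fin 3) (Fin 2 × Fin 3) ℂ) (g : Matrix (Fin N) (Fin N) ℂ) :
    r • lepQua a b g = lepQua (r • a) (r • b) g := by
  rw [lepQua, lepQua, ← Matrix.smul_kronecker, Matrix.fromBlocks_smul, smul_zero, smul_zero]

theorem lepQua_zero (g : Matrix (Fin N) (Fin N) ℂ) : lepQua 0 0 g = 0 := by
  rw [lepQua, Matrix.fromBlocks_zero, Matrix.zero_kronecker]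

theorem lepQua_one : lepQua (N := N) 1 1 1 = 1 := by
  rw [lepQua, Matrix.fromBlocks_one, Matrix.one_kronecker_one]

/-- The operator `(α 1₂ ⊕ 1₂ ⊗ m) ⊗ 1` on `K₀`. -/
def lepCol (N : ℕ) (α : ℂ) (m : Matrix (Fin 3) (Fin 3) ℂ) : Matrix (GenIdx N) (GenIdx N) ℂ :=
  lepQua (α • 1) (1 ⊗ₖ m) 1

theorem piFExt_eq (l : ℂ) (q : ℍ[ℝ]) (m : Matrix (Fin 3) (Fin 3) ℂ) (μ : ℂ) :
    piFExt N l q m μ = blocks (Matrix.diagonal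
      ![tilde N !![l, 0; 0, star l], tilde N (quatMat q), lepCol N μ m, lepCol N μ m]) := rfl

theorem transpose_lepCol (α : ℂ) (m : Matrix (Fin 3) (Fin 3) ℂ) :
    (lepCol N α m).transpose = lepCol N α m.transpose := by
  rw [lepCol, transpose_lepQua, Matrix.transpose_smul, Matrix.transpose_one, Matrix.transpose_one,
    ← Matrix.kroneckerMap_transpose, Matrix.transpose_one]
  rfl

theorem conjTranspose_lepCol (α : ℂ) (m : Matrix (Fin 3) (Fin 3) ℂ) :
    (lepCol N α m).conjTranspose = lepCol N (star α) m.conjTranspose := by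
  rw [lepCol, conjTranspose_lepQua, Matrix.conjTranspose_smul, Matrix.conjTranspose_one,
    Matrix.conjTranspose_one, Matrix.conjTranspose_kronecker, Matrix.conjTranspose_one]
  rfl

theorem transpose_tilde (a : Matrix (Fin 2) (Fin 2) ℂ) :
    (tilde N a).transpose = tilde N a.transpose := by
  rw [tilde, transpose_lepQua, Matrix.transpose_one, ← Matrix.kroneckerMap_transpose,
    Matrix.transpose_one]
  rfl

theorem conjTranspose_tilde (a : Matrix (Fin 2) (Fin 2) ℂ) :
    (tilde N a).conjTranspose = tilde N a.conjTranspose := by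
  rw [tilde, conjTranspose_lepQua, Matrix.conjTranspose_one, Matrix.conjTranspose_kronecker,
    Matrix.conjTranspose_one]
  rfl

theorem tilde_zero : tilde N 0 = 0 := by
  rw [tilde, Matrix.zero_kronecker, lepQua_zero]

theorem tilde_one : tilde N 1 = 1 := by
  rw [tilde, Matrix.one_kronecker_one, lepQua_one]

theorem lepCol_zero : lepCol N 0 0 = 0 := by
  rw [lepCol, zero_smul, Matrix.kronecker_zero, lepQua_zero]

theorem lepCol_one : lepCol N 1 1 = 1 := by
  rw [lepCol, one_smul, Matrix.one_kronecker_one, lepQua_one]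

theorem smul_tilde (r : ℂ) (a : Matrix (Fin 2) (Fin 2) ℂ) : r • tilde N a = tilde N (r • a) := by
  rw [tilde, smul_lepQua, ← Matrix.smul_kronecker]
  rfl

theorem smul_lepCol (r α : ℂ) (m : Matrix (Fin 3) (Fin 3) ℂ) :
    r • lepCol N α m = lepCol N (r * α) (r • m) := by
  rw [lepCol, smul_lepQua, smul_smul, ← Matrix.kronecker_smul]
  rfl

theorem commute_tilde_lepCol (a : Matrix (Fin 2) (Fin 2) ℂ) (α : ℂ)
    (m : Matrix (Fin 3) (Fin 3) ℂ) : Commute (tilde N a) (lepCol N α m) := by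
  change _ * _ = _ * _
  rw [tilde, lepCol, lepQua_mul, lepQua_mul, ← Matrix.mul_kronecker_mul,
    ← Matrix.mul_kronecker_mul]
  simp

theorem commute_lepCol_scalar (α γ δ : ℂ) (m : Matrix (Fin 3) (Fin 3) ℂ) :
    Commute (lepCol N α m) (lepCol N γ (δ • 1)) := by
  change _ * _ = _ * _
  rw [lepCol, lepCol, lepQua_mul, lepQua_mul, ← Matrix.mul_kronecker_mul,
    ← Matrix.mul_kronecker_mul]
  simp [mul_comm, smul_smul]

/-- The Yukawa matrices mix neither leptons with quarks nor colours. -/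
theorem YukawaData.commute_Y₀_lepCol (y : YukawaData N) (α : ℂ) (m : Matrix (Fin 3) (Fin 3) ℂ) :
    Commute y.Y₀ (lepCol N α m) := by
  have h1 : ∀ (p : Matrix (Fin 2) (Fin 2) ℂ) g, Commute (lepQua p 0 g) (lepCol N α m) := by
    intro p g
    change _ * _ = _ * _
    rw [lepCol, lepQua_mul, lepQua_mul]
    simp
  have h2 : ∀ (p : Matrix (Fin 2) (Fin 2) ℂ) g,
      Commute (lepQua 0 (p ⊗ₖ 1) g) (lepCol N α m) := by
    intro p g
    change _ * _ = _ * _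
    rw [lepCol, lepQua_mul, lepQua_mul, ← Matrix.mul_kronecker_mul, ← Matrix.mul_kronecker_mul]
    simp
  exact (((h1 _ _).add_left (h1 _ _)).add_left (h2 _ _)).add_left (h2 _ _)

theorem YukawaData.commute_conjTranspose_Y₀_lepCol (y : YukawaData N) (α : ℂ)
    (m : Matrix (Fin 3) (Fin 3) ℂ) : Commute y.Y₀.conjTranspose (lepCol N α m) := by
  have h := congrArg Matrix.conjTranspose (y.commute_Y₀_lepCol (star α) m.conjTranspose).eq
  rw [Matrix.conjTranspose_mul, Matrix.conjTranspose_mul, conjTranspose_lepCol, star_star,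
    Matrix.conjTranspose_conjTranspose] at h
  exact h.symm

theorem YukawaData.commute_transpose_Y₀_lepCol (y : YukawaData N) (α : ℂ)
    (m : Matrix (Fin 3) (Fin 3) ℂ) : Commute y.Y₀.transpose (lepCol N α m) := by
  have h := congrArg Matrix.transpose (y.commute_Y₀_lepCol α m.transpose).eq
  rw [Matrix.transpose_mul, Matrix.transpose_mul, transpose_lepCol,
    Matrix.transpose_transpose] at h
  exact h.symm

theorem YukawaData.commute_map_star_Y₀_lepCol (y : YukawaData N) (α : ℂ)
    (m : Matrix (Fin 3) (Fin 3) ℂ) : Commute (y.Y₀.map star) (lepCol N α m) := by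
  have h := congrArg Matrix.transpose (y.commute_conjTranspose_Y₀_lepCol α m.transpose).eq
  rw [Matrix.transpose_mul, Matrix.transpose_mul, transpose_lepCol,
    Matrix.transpose_transpose] at h
  exact h.symm

/-! The Majorana mass `M₀` acts on the right-handed neutrino alone, where `lepCol` and `tilde` of a
diagonal matrix are scalars. -/

section Majorana
variable (g : Matrix (Fin N) (Fin N) ℂ)

theorem lepCol_mul_neutrino (α : ℂ) (m : Matrix (Fin 3) (Fin 3) ℂ) :
    lepCol N α m * lepQua !![1, 0; 0, 0] 0 g = α • lepQua !![1, 0; 0, 0] 0 g := by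
  rw [lepCol, lepQua_mul, smul_lepQua]
  simp

theorem neutrino_mul_lepCol (α : ℂ) (m : Matrix (Fin 3) (Fin 3) ℂ) :
    lepQua !![1, 0; 0, 0] 0 g * lepCol N α m = α • lepQua !![1, 0; 0, 0] 0 g := by
  rw [lepCol, lepQua_mul, smul_lepQua]
  simp

theorem tilde_mul_neutrino (l l' : ℂ) :
    tilde N !![l, 0; 0, l'] * lepQua !![1, 0; 0, 0] 0 g = l • lepQua !![1, 0; 0, 0] 0 g := by
  rw [tilde, lepQua_mul, smul_lepQua]
  simp

theorem neutrino_mul_tilde (l l' : ℂ) :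
    lepQua !![1, 0; 0, 0] 0 g * tilde N !![l, 0; 0, l'] = l • lepQua !![1, 0; 0, 0] 0 g := by
  rw [tilde, lepQua_mul, smul_lepQua]
  simp
  congr 1
  ext i j
  fin_cases i <;> fin_cases j <;> rfl

end Majorana

theorem YukawaData.conjTranspose_M₀ (y : YukawaData N) :
    y.M₀.conjTranspose = lepQua !![1, 0; 0, 0] 0 y.m₀.conjTranspose := by
  have h : (!![1, 0; 0, 0] : Matrix (Fin 2) (Fin 2) ℂ).conjTranspose = !![1, 0; 0, 0] := by
    ext i j
    fin_cases i <;> fin_cases j <;> simp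
  rw [YukawaData.M₀, conjTranspose_lepQua, Matrix.conjTranspose_zero, h]

theorem YukawaData.oppF_diagonal (y : YukawaData N)
    (d : Fin 4 → Matrix (GenIdx N) (GenIdx N) ℂ) :
    y.oppF (blocks (Matrix.diagonal d)) =
      blocks (Matrix.diagonal fun i => (d (i + 2)).transpose) := by
  have hc : ∀ i, y.oppSign i * y.oppSign i = 1 := by
    intro i
    fin_cases i <;> simp [YukawaData.oppSign, y.sgn_mul_sgn]
  rw [oppF_blocks]
  congr 1
  refine Matrix.ext fun i j => ?_
  rw [Matrix.of_apply]
  by_cases h : i = j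
  · subst h
    rw [Matrix.diagonal_apply_eq, Matrix.diagonal_apply_eq, hc, one_smul]
  · have h' : j + 2 ≠ i + 2 := fun e => h (add_right_cancel e).symm
    rw [Matrix.diagonal_apply_ne _ h, Matrix.diagonal_apply_ne _ h', Matrix.transpose_zero,
      smul_zero]

/-- The order-zero and order-one conditions in `End K_F`. -/
def YukawaData.FinOrderOne (y : YukawaData N) (v w : Matrix (FinIdx N) (FinIdx N) ℂ) : Prop :=
  Commute v w ∧ Commute v (y.DF * w - w * y.DF)

/-- A block-diagonal `d` commutes with `[Z, c]`, if each entry of `Z` intertwines either the entries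
of `c` or those of `d`. -/
theorem commute_commutator_blocks {d c : Fin 4 → Matrix (GenIdx N) (GenIdx N) ℂ}
    {Z : Matrix (Fin 4) (Fin 4) (Matrix (GenIdx N) (GenIdx N) ℂ)}
    (hdc : ∀ i, Commute (d i) (c i))
    (h : ∀ i j, Z i j * c j = c i * Z i j ∨ d i * Z i j = Z i j * d j) :
    Commute (blocks (Matrix.diagonal d))
      (blocks Z * blocks (Matrix.diagonal c) - blocks (Matrix.diagonal c) * blocks Z) := by
  change _ * _ = _ * _
  rw [blocks_mul, blocks_mul, blocks_sub, blocks_mul, blocks_mul]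
  congr 1
  refine Matrix.ext fun i j => ?_
  rw [Matrix.diagonal_mul, Matrix.mul_diagonal, Matrix.sub_apply, Matrix.mul_diagonal,
    Matrix.diagonal_mul]
  rcases h i j with h | h
  · rw [h, sub_self, mul_zero, zero_mul]
  · rw [mul_sub, sub_mul, ← mul_assoc, h, mul_assoc, (hdc j).eq, ← mul_assoc, ← mul_assoc,
      (hdc i).eq, mul_assoc (c i), h, ← mul_assoc]

theorem YukawaData.finOrderOne_diagonal (y : YukawaData N)
    {d c : Fin 4 → Matrix (GenIdx N) (GenIdx N) ℂ} (hdc : ∀ i, Commute (d i) (c i))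
    (h10 : y.Y₀ * c 0 = c 1 * y.Y₀) (h01 : y.Y₀.conjTranspose * c 1 = c 0 * y.Y₀.conjTranspose)
    (h20 : d 2 * y.M₀ = y.M₀ * d 0) (h02 : d 0 * y.M₀.conjTranspose = y.M₀.conjTranspose * d 2)
    (h23 : y.Y₀.transpose * c 3 = c 2 * y.Y₀.transpose ∨
      d 2 * y.Y₀.transpose = y.Y₀.transpose * d 3)
    (h32 : y.Y₀.map star * c 2 = c 3 * y.Y₀.map star ∨
      d 3 * y.Y₀.map star = y.Y₀.map star * d 2) :
    y.FinOrderOne (blocks (Matrix.diagonal d)) (blocks (Matrix.diagonal c)) := by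
  refine ⟨?_, commute_commutator_blocks hdc ?_⟩
  · change _ * _ = _ * _
    rw [blocks_mul, blocks_mul, Matrix.diagonal_mul_diagonal, Matrix.diagonal_mul_diagonal]
    simp only [fun i => (hdc i).eq]
  · have z : ∀ a b : Matrix (GenIdx N) (GenIdx N) ℂ, 0 * a = b * 0 := fun a b => by
      rw [zero_mul, mul_zero]
    have g01 : -y.Y₀.conjTranspose * c 1 = c 0 * -y.Y₀.conjTranspose := by
      rw [neg_mul, mul_neg, h01]
    have g02 : d 0 * (y.sgn • y.M₀.conjTranspose) = y.sgn • y.M₀.conjTranspose * d 2 := by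
      rw [Matrix.mul_smul, Matrix.smul_mul, h02]
    have g23 : -y.Y₀.transpose * c 3 = c 2 * -y.Y₀.transpose ∨
        d 2 * -y.Y₀.transpose = -y.Y₀.transpose * d 3 := by
      simpa only [neg_mul, mul_neg, neg_inj] using h23
    intro i j
    fin_cases i <;> fin_cases j
    exacts [.inl (z _ _), .inl g01, .inr g02, .inl (z _ _), .inl h10, .inl (z _ _), .inl (z _ _),
      .inl (z _ _), .inr h20, .inl (z _ _), .inl (z _ _), g23, .inl (z _ _), .inl (z _ _), h32,
      .inl (z _ _)]

/-- The matrices with scalar action on the leptons and on the quarks of `K_R ⊕ K_L` and of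
`K_R̄ ⊕ K_L̄`; they contain the `B - L` generator. -/
def centralMat (N : ℕ) (α β γ δ : ℂ) : Matrix (FinIdx N) (FinIdx N) ℂ :=
  blocks (Matrix.diagonal
    ![lepCol N α (β • 1), lepCol N α (β • 1), lepCol N γ (δ • 1), lepCol N γ (δ • 1)])

/-- The set of all `centralMat`. -/
def centralSet (N : ℕ) : Set (Matrix (FinIdx N) (FinIdx N) ℂ) :=
  {B | ∃ α β γ δ, B = centralMat N α β γ δ}

theorem YukawaData.oppF_centralMat (y : YukawaData N) (α β γ δ : ℂ) :
    y.oppF (centralMat N α β γ δ) = centralMat N γ δ α β := by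
  have h : ∀ α β : ℂ, (lepCol N α (β • 1)).transpose = lepCol N α (β • 1) := fun α β => by
    rw [transpose_lepCol, Matrix.transpose_smul, Matrix.transpose_one]
  rw [centralMat, oppF_diagonal, centralMat]
  congr 2
  funext i
  fin_cases i
  exacts [h _ _, h _ _, h _ _, h _ _]

theorem YukawaData.oppF_piF (y : YukawaData N) (l : ℂ) (q : ℍ[ℝ])
    (m : Matrix (Fin 3) (Fin 3) ℂ) :
    y.oppF (piF N l q m) = blocks (Matrix.diagonal
      ![lepCol N l m.transpose, lepCol N l m.transpose, tilde N !![l, 0; 0, star l],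
        tilde N (quatMat q).transpose]) := by
  have h : (!![l, 0; 0, star l] : Matrix (Fin 2) (Fin 2) ℂ).transpose = !![l, 0; 0, star l] := by
    ext i j
    fin_cases i <;> fin_cases j <;> rfl
  rw [piF, piFExt_eq, oppF_diagonal]
  congr 2
  funext i
  fin_cases i
  exacts [transpose_lepCol _ _, transpose_lepCol _ _, (transpose_tilde _).trans (congrArg _ h),
    transpose_tilde _]

/-- An element of the Standard Model algebra satisfies the order conditions with every block-diagonal
matrix whose entries on `K_R` and `K_L` are one and the same `lepCol`, and whose other two entries
commute with its own ones; the opposite algebra and `centralSet` consist of such matrices. -/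
theorem YukawaData.finOrderOne_piF (y : YukawaData N) (l : ℂ) (q : ℍ[ℝ])
    (m : Matrix (Fin 3) (Fin 3) ℂ) {α : ℂ} {n : Matrix (Fin 3) (Fin 3) ℂ}
    {c₂ c₃ : Matrix (GenIdx N) (GenIdx N) ℂ} (h₂ : Commute (lepCol N l m) c₂)
    (h₃ : Commute (lepCol N l m) c₃) :
    y.FinOrderOne (piF N l q m)
      (blocks (Matrix.diagonal ![lepCol N α n, lepCol N α n, c₂, c₃])) := by
  rw [piF, piFExt_eq]
  refine y.finOrderOne_diagonal ?_ (y.commute_Y₀_lepCol α n).eq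
    (y.commute_conjTranspose_Y₀_lepCol α n).eq ?_ ?_
    (.inr (y.commute_transpose_Y₀_lepCol l m).symm.eq)
    (.inr (y.commute_map_star_Y₀_lepCol l m).symm.eq)
  · intro i
    fin_cases i
    exacts [commute_tilde_lepCol _ _ _, commute_tilde_lepCol _ _ _, h₂, h₃]
  · exact (lepCol_mul_neutrino _ _ _).trans (neutrino_mul_tilde _ _ _).symm
  · rw [y.conjTranspose_M₀]
    exact (tilde_mul_neutrino _ _ _).trans (neutrino_mul_lepCol _ _ _).symm

theorem YukawaData.finOrderOne_AF_oppF (y : YukawaData N) {v w : Matrix (FinIdx N) (FinIdx N) ℂ}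
    (hv : v ∈ AF N) (hw : w ∈ y.oppF '' AF N) : y.FinOrderOne v w := by
  obtain ⟨l, q, m, rfl⟩ := hv
  obtain ⟨_, ⟨l', q', m', rfl⟩, rfl⟩ := hw
  rw [oppF_piF]
  exact y.finOrderOne_piF l q m (commute_tilde_lepCol _ _ _).symm
    (commute_tilde_lepCol _ _ _).symm

theorem YukawaData.finOrderOne_AF_central (y : YukawaData N)
    {v w : Matrix (FinIdx N) (FinIdx N) ℂ} (hv : v ∈ AF N) (hw : w ∈ centralSet N) :
    y.FinOrderOne v w := by
  obtain ⟨l, q, m, rfl⟩ := hv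
  obtain ⟨α, β, γ, δ, rfl⟩ := hw
  exact y.finOrderOne_piF l q m (commute_lepCol_scalar _ _ _ _) (commute_lepCol_scalar _ _ _ _)

theorem YukawaData.finOrderOne_oppF_central (y : YukawaData N)
    {v w : Matrix (FinIdx N) (FinIdx N) ℂ} (hv : v ∈ y.oppF '' AF N) (hw : w ∈ centralSet N) :
    y.FinOrderOne v w := by
  obtain ⟨_, ⟨l, q, m, rfl⟩, rfl⟩ := hv
  obtain ⟨α, β, γ, δ, rfl⟩ := hw
  rw [oppF_piF]
  refine y.finOrderOne_diagonal ?_ (y.commute_Y₀_lepCol _ _).eq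
    (y.commute_conjTranspose_Y₀_lepCol _ _).eq ?_ ?_
    (.inl (y.commute_transpose_Y₀_lepCol _ _).eq) (.inl (y.commute_map_star_Y₀_lepCol _ _).eq)
  · intro i
    fin_cases i
    exacts [commute_lepCol_scalar _ _ _ _, commute_lepCol_scalar _ _ _ _,
      commute_tilde_lepCol _ _ _, commute_tilde_lepCol _ _ _]
  · exact (tilde_mul_neutrino _ _ _).trans (neutrino_mul_lepCol _ _ _).symm
  · rw [y.conjTranspose_M₀]
    exact (lepCol_mul_neutrino _ _ _).trans (neutrino_mul_tilde _ _ _).symm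

theorem quatMat_zero : quatMat 0 = 0 := by
  ext i j
  fin_cases i <;> fin_cases j <;> simp [quatMat, Complex.ext_iff]

theorem conjTranspose_quatMat (q : ℍ[ℝ]) : (quatMat q).conjTranspose = quatMat (star q) := by
  ext i j
  fin_cases i <;> fin_cases j <;> simp [quatMat, Complex.ext_iff]

theorem quatMat_smul (r : ℝ) (q : ℍ[ℝ]) : quatMat (r • q) = (r : ℂ) • quatMat q := by
  ext i j
  fin_cases i <;> fin_cases j <;> simp [quatMat, Complex.ext_iff]

theorem quatMat_one : quatMat 1 = 1 := by
  ext i j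
  fin_cases i <;> fin_cases j <;> simp [quatMat, Complex.ext_iff]

theorem diag_star_zero : (!![0, 0; 0, star 0] : Matrix (Fin 2) (Fin 2) ℂ) = 0 := by
  ext i j
  fin_cases i <;> fin_cases j <;> simp

theorem diag_star_one : (!![1, 0; 0, star 1] : Matrix (Fin 2) (Fin 2) ℂ) = 1 := by
  ext i j
  fin_cases i <;> fin_cases j <;> simp

theorem piF_one : piF N 1 1 1 = 1 := by
  rw [piF, piFExt_eq, diag_star_one, quatMat_one, tilde_one, lepCol_one, ← blocks_one,
    ← Matrix.diagonal_one]
  congr 2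
  funext i
  fin_cases i <;> rfl

theorem smul_mem_AF (r : ℝ) {v : Matrix (FinIdx N) (FinIdx N) ℂ} (hv : v ∈ AF N) :
    (r : ℂ) • v ∈ AF N := by
  obtain ⟨l, q, m, rfl⟩ := hv
  refine ⟨r * l, r • q, (r : ℂ) • m, ?_⟩
  have h : (!![(r : ℂ) * l, 0; 0, star ((r : ℂ) * l)] : Matrix (Fin 2) (Fin 2) ℂ) =
      (r : ℂ) • !![l, 0; 0, star l] := by
    ext i j
    fin_cases i <;> fin_cases j <;> simp
  rw [piF, piFExt_eq, piF, piFExt_eq, h, quatMat_smul, ← smul_tilde, ← smul_tilde, ← smul_lepCol]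
  change blocks ((r : ℂ) • Matrix.diagonal _) = _
  rw [← Matrix.diagonal_smul]
  congr 2
  funext i
  fin_cases i <;> rfl

theorem one_mem_AF : (1 : Matrix (FinIdx N) (FinIdx N) ℂ) ∈ AF N := ⟨1, 1, 1, piF_one.symm⟩

theorem smul_centralMat (r α β γ δ : ℂ) :
    r • centralMat N α β γ δ = centralMat N (r * α) (r * β) (r * γ) (r * δ) := by
  rw [centralMat, centralMat]
  simp only [← smul_smul r, ← smul_lepCol]
  change blocks (r • Matrix.diagonal _) = _
  rw [← Matrix.diagonal_smul]
  congr 2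
  funext i
  fin_cases i <;> rfl

theorem centralMat_one : centralMat N 1 1 1 1 = 1 := by
  rw [centralMat, one_smul, lepCol_one, ← blocks_one, ← Matrix.diagonal_one]
  congr 2
  funext i
  fin_cases i <;> rfl

theorem smul_mem_centralSet (r : ℂ) {v : Matrix (FinIdx N) (FinIdx N) ℂ}
    (hv : v ∈ centralSet N) : r • v ∈ centralSet N := by
  obtain ⟨α, β, γ, δ, rfl⟩ := hv
  exact ⟨_, _, _, _, smul_centralMat _ _ _ _ _⟩

theorem one_mem_centralSet : (1 : Matrix (FinIdx N) (FinIdx N) ℂ) ∈ centralSet N :=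
  ⟨1, 1, 1, 1, centralMat_one.symm⟩

theorem tBL_mem_centralSet : tBL N ∈ centralSet N := by
  refine ⟨Complex.I * -1, Complex.I * (1 / 3), Complex.I * 1, Complex.I * -(1 / 3), ?_⟩
  rw [← smul_centralMat]
  have h : ∀ α β : ℂ, lepQua (α • 1) (β • 1) 1 = lepCol N α (β • 1) := fun α β => by
    rw [lepCol, Matrix.kronecker_smul, Matrix.one_kronecker_one]
  have h1 : lepQua (N := N) (-1) ((1 / 3 : ℂ) • 1) 1 = lepCol N (-1) ((1 / 3 : ℂ) • 1) := by
    rw [← h, neg_one_smul]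
  have h2 : lepQua (N := N) 1 (-(1 / 3 : ℂ) • 1) 1 = lepCol N 1 (-(1 / 3 : ℂ) • 1) := by
    rw [← h, one_smul]
  rw [tBL, h1, h2]
  rfl

/-- `piFExt` at `(0, 0, δ, γ)` is the part on `K_R̄ ⊕ K_L̄` of a central matrix. -/
theorem piFExt_zero_zero (γ δ : ℂ) : piFExt N 0 0 (δ • 1) γ = centralMat N 0 0 γ δ := by
  rw [piFExt_eq, diag_star_zero, quatMat_zero, tilde_zero, centralMat, zero_smul, lepCol_zero]

theorem centralMat_add (α β γ δ α' β' γ' δ' : ℂ) :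
    centralMat N α β γ δ + centralMat N α' β' γ' δ' =
      centralMat N (α + α') (β + β') (γ + γ') (δ + δ') := by
  have h : ∀ α β α' β' : ℂ, lepCol N α (β • 1) + lepCol N α' (β' • 1) =
      lepCol N (α + α') ((β + β') • 1) := by
    intro α β α' β'
    rw [lepCol, lepCol, lepCol, lepQua, lepQua, lepQua, ← Matrix.add_kronecker,
      Matrix.fromBlocks_add, add_smul, add_smul, Matrix.kronecker_add, add_zero, add_zero]
  rw [centralMat, centralMat, centralMat, blocks_add, Matrix.diagonal_add]
  congr 2
  funext i
  fin_cases i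
  exacts [h _ _ _ _, h _ _ _ _, h _ _ _ _, h _ _ _ _]

theorem centralMat_mul (α β γ δ α' β' γ' δ' : ℂ) :
    centralMat N α β γ δ * centralMat N α' β' γ' δ' =
      centralMat N (α * α') (β * β') (γ * γ') (δ * δ') := by
  have h : ∀ α β α' β' : ℂ, lepCol N α (β • 1) * lepCol N α' (β' • 1) =
      lepCol N (α * α') ((β * β') • 1) := by
    intro α β α' β'
    rw [lepCol, lepCol, lepCol, lepQua_mul, ← Matrix.mul_kronecker_mul]
    simp [smul_smul, mul_comm]
  rw [centralMat, centralMat, centralMat, blocks_mul, Matrix.diagonal_mul_diagonal]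
  congr 2
  funext i
  fin_cases i
  exacts [h _ _ _ _, h _ _ _ _, h _ _ _ _, h _ _ _ _]

/-- `Φ(w) = π(0, w, 0) [D_F, e] - [D_F, e] π(0, w̄, 0)` with `e = π(1, 0, 0)`. -/
theorem YukawaData.Phi_eq (y : YukawaData N) (w : ℍ[ℝ]) :
    y.Phi w = piF N 0 w 0 * (y.DF * piF N 1 0 0 - piF N 1 0 0 * y.DF) -
      (y.DF * piF N 1 0 0 - piF N 1 0 0 * y.DF) * piF N 0 (star w) 0 := by
  have hX : y.DF * piF N 1 0 0 - piF N 1 0 0 * y.DF = blocks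
      !![0, y.Y₀.conjTranspose, 0, 0; y.Y₀, 0, 0, 0; 0, 0, 0, 0; 0, 0, 0, 0] := by
    rw [piF, piFExt_eq, diag_star_one, quatMat_zero, tilde_zero, tilde_one, YukawaData.DF,
      blocks_mul, blocks_mul, blocks_sub]
    congr 1
    have g20 : y.M₀ * 1 - lepCol N 1 0 * y.M₀ = 0 := by
      rw [YukawaData.M₀, lepCol_mul_neutrino, one_smul, mul_one, sub_self]
    have g02 : y.sgn • y.M₀.conjTranspose * lepCol N 1 0 - 1 * (y.sgn • y.M₀.conjTranspose) = 0 := by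
      rw [y.conjTranspose_M₀, Matrix.smul_mul, neutrino_mul_lepCol, one_smul, one_mul, sub_self]
    have g01 : -y.Y₀.conjTranspose * 0 - 1 * -y.Y₀.conjTranspose = y.Y₀.conjTranspose := by
      rw [mul_zero, one_mul, zero_sub, neg_neg]
    have g10 : y.Y₀ * 1 - 0 * y.Y₀ = y.Y₀ := by
      rw [mul_one, zero_mul, sub_zero]
    have g23 : -y.Y₀.transpose * lepCol N 1 0 - lepCol N 1 0 * -y.Y₀.transpose = 0 := by
      rw [neg_mul, mul_neg, (y.commute_transpose_Y₀_lepCol 1 0).eq, sub_self]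
    have g32 : y.Y₀.map star * lepCol N 1 0 - lepCol N 1 0 * y.Y₀.map star = 0 := by
      rw [(y.commute_map_star_Y₀_lepCol 1 0).eq, sub_self]
    have z : ∀ a b : Matrix (GenIdx N) (GenIdx N) ℂ, 0 * a - b * 0 = 0 := fun a b => by
      rw [zero_mul, mul_zero, sub_zero]
    refine Matrix.ext fun i j => ?_
    rw [Matrix.sub_apply, Matrix.mul_diagonal, Matrix.diagonal_mul]
    fin_cases i <;> fin_cases j
    exacts [z _ _, g01, g02, z _ _, g10, z _ _, z _ _, z _ _, g20, z _ _, z _ _, g23, z _ _,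
      z _ _, g32, z _ _]
  rw [hX, piF, piF, piFExt_eq, piFExt_eq, diag_star_zero, tilde_zero, lepCol_zero, blocks_mul,
    blocks_mul, blocks_sub, YukawaData.Phi]
  congr 1
  have z : ∀ a b : Matrix (GenIdx N) (GenIdx N) ℂ, 0 = a * 0 - 0 * b := fun a b => by
    rw [zero_mul, mul_zero, sub_zero]
  have g01 : -(y.Y₀.conjTranspose * (tilde N (quatMat w)).conjTranspose) =
      0 * y.Y₀.conjTranspose - y.Y₀.conjTranspose * tilde N (quatMat (star w)) := by
    rw [conjTranspose_tilde, conjTranspose_quatMat, zero_mul, zero_sub]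
  have g10 : tilde N (quatMat w) * y.Y₀ = tilde N (quatMat w) * y.Y₀ - y.Y₀ * 0 := by
    rw [mul_zero, sub_zero]
  refine Matrix.ext fun i j => ?_
  rw [Matrix.sub_apply, Matrix.mul_diagonal, Matrix.diagonal_mul]
  fin_cases i <;> fin_cases j
  exacts [z _ _, g01, z _ _, z _ _, g10, z _ _, z _ _, z _ _, z _ _, z _ _, z _ _, z _ _,
    z _ _, z _ _, z _ _, z _ _]

/-- `σ(w) = p(-w) [D_F, p(1)] + [D_F, p(1)] p(w̄)`, where `p(μ)` acts as `μ` on the leptons of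
`K_R̄ ⊕ K_L̄` and as zero on the complement. -/
theorem YukawaData.sigma_eq (y : YukawaData N) (w : ℂ) :
    y.sigma w = centralMat N 0 0 (-w) 0 *
        (y.DF * centralMat N 0 0 1 0 - centralMat N 0 0 1 0 * y.DF) +
      (y.DF * centralMat N 0 0 1 0 - centralMat N 0 0 1 0 * y.DF) *
        centralMat N 0 0 (star w) 0 := by
  have z : ∀ a b : Matrix (GenIdx N) (GenIdx N) ℂ, 0 * a - b * 0 = 0 := fun a b => by
    rw [zero_mul, mul_zero, sub_zero]
  have hX : y.DF * centralMat N 0 0 1 0 - centralMat N 0 0 1 0 * y.DF = blocks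
      !![0, 0, y.sgn • y.M₀.conjTranspose, 0; 0, 0, 0, 0; -y.M₀, 0, 0, 0; 0, 0, 0, 0] := by
    rw [centralMat, YukawaData.DF, blocks_mul, blocks_mul, blocks_sub, zero_smul, lepCol_zero]
    congr 1
    have g20 : y.M₀ * 0 - lepCol N 1 0 * y.M₀ = -y.M₀ := by
      rw [YukawaData.M₀, lepCol_mul_neutrino, one_smul, mul_zero, zero_sub]
    have g02 : y.sgn • y.M₀.conjTranspose * lepCol N 1 0 - 0 * (y.sgn • y.M₀.conjTranspose) =
        y.sgn • y.M₀.conjTranspose := by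
      rw [y.conjTranspose_M₀, Matrix.smul_mul, neutrino_mul_lepCol, one_smul, zero_mul, sub_zero]
    have z' : ∀ a : Matrix (GenIdx N) (GenIdx N) ℂ, a * 0 - 0 * a = 0 := fun a => by
      rw [zero_mul, mul_zero, sub_zero]
    have g23 : -y.Y₀.transpose * lepCol N 1 0 - lepCol N 1 0 * -y.Y₀.transpose = 0 := by
      rw [neg_mul, mul_neg, (y.commute_transpose_Y₀_lepCol 1 0).eq, sub_self]
    have g32 : y.Y₀.map star * lepCol N 1 0 - lepCol N 1 0 * y.Y₀.map star = 0 := by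
      rw [(y.commute_map_star_Y₀_lepCol 1 0).eq, sub_self]
    refine Matrix.ext fun i j => ?_
    rw [Matrix.sub_apply, Matrix.mul_diagonal, Matrix.diagonal_mul]
    fin_cases i <;> fin_cases j
    exacts [z _ _, z' _, g02, z _ _, z' _, z _ _, z _ _, z _ _, g20, z _ _, z _ _, g23, z _ _,
      z _ _, g32, z _ _]
  rw [hX, centralMat, centralMat, zero_smul, lepCol_zero, blocks_mul,
    blocks_mul, blocks_add, YukawaData.sigma]
  congr 1
  have z : ∀ a b : Matrix (GenIdx N) (GenIdx N) ℂ, 0 = a * 0 + 0 * b := fun a b => by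
    rw [zero_mul, mul_zero, add_zero]
  have g02 : y.sgn • (w • y.M₀).conjTranspose = 0 * (y.sgn • y.M₀.conjTranspose) +
      y.sgn • y.M₀.conjTranspose * lepCol N (star w) 0 := by
    rw [Matrix.conjTranspose_smul, y.conjTranspose_M₀, Matrix.smul_mul, neutrino_mul_lepCol,
      zero_mul, zero_add]
  have g20 : w • y.M₀ = lepCol N (-w) 0 * -y.M₀ + -y.M₀ * 0 := by
    rw [mul_zero, add_zero, mul_neg, YukawaData.M₀, lepCol_mul_neutrino, neg_smul, neg_neg]
  refine Matrix.ext fun i j => ?_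
  rw [Matrix.add_apply, Matrix.mul_diagonal, Matrix.diagonal_mul]
  fin_cases i <;> fin_cases j
  exacts [z _ _, z _ _, g02, z _ _, z _ _, z _ _, z _ _, z _ _, g20, z _ _, z _ _, z _ _,
    z _ _, z _ _, z _ _, z _ _]

end FiniteOrderOne

/-! ### Field algebras and their one-forms -/

section FieldAlgebras
variable {M : Type*} [TopologicalSpace M] [ChartedSpace E4 M] [IsManifold (𝓡 4) ∞ M] {N : ℕ}
variable {V V₁ V₂ : Set (Matrix (FinIdx N) (FinIdx N) ℂ)}

theorem intOp_mem_fieldOps {B : M → Matrix (FinIdx N) (FinIdx N) ℂ} (hB : SmoothMat B)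
    (hc : ∃ c, HasCompactSupport fun x => B x - c) (hV : ∀ x, B x ∈ V) :
    intOp B hB ∈ fieldOps M V := ⟨B, hB, hc, hV, rfl⟩

theorem fieldOps_mono (h : V₁ ⊆ V₂) : fieldOps M V₁ ⊆ fieldOps M V₂ := by
  rintro _ ⟨B, hB, hc, hV, rfl⟩
  exact ⟨B, hB, hc, fun x => h (hV x), rfl⟩

theorem fieldOps_subset_internal : fieldOps M V ⊆ internal M N := by
  rintro _ ⟨B, hB, -, -, rfl⟩
  exact ⟨B, hB, rfl⟩

theorem hasCompactSupport_map_sub {α β : Type*} [AddGroup α] [AddGroup β] {f : M → α} {c : α}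
    (h : HasCompactSupport fun x => f x - c) (F : α → β) :
    HasCompactSupport fun x => F (f x) - F c := by
  refine h.mono fun x hx h0 => hx ?_
  have h1 : f x = c := sub_eq_zero.1 h0
  simp [h1]

/-- A constant linear map takes fields to fields. -/
theorem intOp_map_mem_fieldOps {B : M → Matrix (FinIdx N) (FinIdx N) ℂ} (hB : SmoothMat B)
    (hc : ∃ c, HasCompactSupport fun x => B x - c)
    (L : Matrix (FinIdx N) (FinIdx N) ℂ →ₗ[ℝ] Matrix (FinIdx N) (FinIdx N) ℂ)
    (hV : ∀ x, L (B x) ∈ V) :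
    intOp (fun x => L (B x)) (hB.map_linear L) ∈ fieldOps M V := by
  obtain ⟨c, hc⟩ := hc
  exact intOp_mem_fieldOps _ ⟨L c, hasCompactSupport_map_sub hc L⟩ hV

/-- The order conditions hold for fields if they hold for their values: the derivatives of a field
with values in `V₂` still commute with `V₁`. -/
theorem orderOne_fieldOps (t : Tetrad M) (y : YukawaData N)
    (h : ∀ v ∈ V₁, ∀ w ∈ V₂, y.FinOrderOne v w) :
    OrderOne (dirac t y) (fieldOps M V₁) (fieldOps M V₂) := by
  rintro _ ⟨B, hB, -, hBV, rfl⟩ _ ⟨C, hC, -, hCV, rfl⟩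
  have h0 : ∀ x x', B x * C x' = C x' * B x := fun x x' => (h _ (hBV x) _ (hCV x')).1.eq
  refine ⟨?_, ?_⟩
  · change _ * _ = _ * _
    rw [mulOp_mul, mulOp_mul]
    refine mulOp_congr fun x => ?_
    rw [← Matrix.mul_kronecker_mul, ← Matrix.mul_kronecker_mul, h0]
  · change _ * (dirac t y * intOp C hC - intOp C hC * dirac t y) =
      (dirac t y * intOp C hC - intOp C hC * dirac t y) * _
    rw [dirac_commutator, mulOp_mul, mulOp_mul]
    refine mulOp_congr fun x => ?_
    have hd : ∀ a, B x * t.matDeriv a C x = t.matDeriv a C x * B x := by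
      intro a
      let L : Matrix (FinIdx N) (FinIdx N) ℂ →ₗ[ℝ] Matrix (FinIdx N) (FinIdx N) ℂ :=
        LinearMap.mulLeft ℝ (B x) - LinearMap.mulRight ℝ (B x)
      have h1 := t.matDeriv_map_linear a hC L x
      have h2 : (fun x' => L (C x')) = fun _ => 0 := funext fun x' => sub_eq_zero.2 (h0 x x')
      rw [h2, t.matDeriv_const] at h1
      exact sub_eq_zero.1 h1.symm
    have hF := (h _ (hBV x) _ (hCV x)).2.eq
    rw [sub_eq_add_neg] at hF
    rw [mul_add, add_mul, Finset.mul_sum, Finset.sum_mul, ← Matrix.mul_kronecker_mul,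
      ← Matrix.mul_kronecker_mul, one_mul, mul_one, hF]
    congr 1
    refine Finset.sum_congr rfl fun a _ => ?_
    rw [← Matrix.mul_kronecker_mul, ← Matrix.mul_kronecker_mul, one_mul, mul_one, hd]

section GaugePart
variable [T2Space M]

/-- The real multiples of the identity. -/
def realScalars (N : ℕ) : Set (Matrix (FinIdx N) (FinIdx N) ℂ) := {B | ∃ r : ℝ, B = (r : ℂ) • 1}

theorem smoothMat_ofReal_smul {f : M → ℝ} (hf : ContMDiff (𝓡 4) 𝓘(ℝ, ℝ) ∞ f) {m n : Type*}
    {B : M → Matrix m n ℂ} (hB : SmoothMat B) : SmoothMat (fun x => (f x : ℂ) • B x) :=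
  SmoothMat.smul (contMDiff_ofReal hf) hB

theorem real_intOp_mem_fieldOps {f : M → ℝ} (hf : ContMDiff (𝓡 4) 𝓘(ℝ, ℝ) ∞ f)
    (hc : HasCompactSupport f) :
    intOp (fun x => (f x : ℂ) • (1 : Matrix (FinIdx N) (FinIdx N) ℂ))
      (smoothMat_ofReal_smul hf (SmoothMat.const 1)) ∈ fieldOps M (realScalars N) := by
  refine intOp_mem_fieldOps _ ⟨0, ?_⟩ fun x => ⟨f x, rfl⟩
  refine hc.mono fun x hx h0 => hx ?_
  simp [h0]

theorem Tetrad.matDeriv_ofReal_smul_one (t : Tetrad M) (b : Fin 4) {f : M → ℝ}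
    (hf : ContMDiff (𝓡 4) 𝓘(ℝ, ℝ) ∞ f) (x : M) :
    t.matDeriv b (fun x => (f x : ℂ) • (1 : Matrix (FinIdx N) (FinIdx N) ℂ)) x =
      ((t.deriv b f x : ℝ) : ℂ) • 1 := by
  ext i j
  exact t.deriv_comp_clm b hf
    (LinearMap.toContinuousLinearMap (Complex.ofRealCLM.toLinearMap.smulRight
      ((1 : Matrix (FinIdx N) (FinIdx N) ℂ) i j) : ℝ →ₗ[ℝ] ℂ)) x

theorem real_commutator (t : Tetrad M) (y : YukawaData N) {f : M → ℝ}
    (hf : ContMDiff (𝓡 4) 𝓘(ℝ, ℝ) ∞ f) :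
    dirac t y * intOp (fun x => (f x : ℂ) • 1) (smoothMat_ofReal_smul hf (SmoothMat.const 1)) -
      intOp (fun x => (f x : ℂ) • 1) (smoothMat_ofReal_smul hf (SmoothMat.const 1)) * dirac t y =
    mulOp (fun x => ∑ b, (Complex.I • gam b) ⊗ₖ (((t.deriv b f x : ℝ) : ℂ) • 1))
      (SmoothMat.sum _ fun b => (SmoothMat.const _).kron
        (smoothMat_ofReal_smul (t.contMDiff_deriv b hf) (SmoothMat.const 1))) := by
  rw [dirac_commutator]
  refine mulOp_congr fun x => ?_
  simp only [t.matDeriv_ofReal_smul_one _ hf]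
  rw [Matrix.mul_smul, Matrix.smul_mul, mul_one, one_mul, add_neg_cancel, Matrix.kronecker_zero,
    add_zero]

/-- `i γᵃ G` is a one-form of the algebra of real functions for some smooth `G ≥ 0` which is positive
on a given compact set: near each point one has `i γᵃ G = ∑ f_k [D, h_k]` with the local coframe,
and finitely many such points suffice. -/
theorem exists_pos_gamma_mem_oneForms (t : Tetrad M) (y : YukawaData N) (a : Fin 4) {K : Set M}
    (hK : IsCompact K) : ∃ (G : M → ℝ) (hG : ContMDiff (𝓡 4) 𝓘(ℝ, ℝ) ∞ G), (∀ x, 0 ≤ G x) ∧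
      (∀ x ∈ K, 0 < G x) ∧
      mulOp (fun x => (Complex.I • gam a) ⊗ₖ ((G x : ℂ) • (1 : Matrix (FinIdx N) (FinIdx N) ℂ)))
        ((SmoothMat.const _).kron (smoothMat_ofReal_smul hG (SmoothMat.const 1))) ∈
      oneForms (dirac t y) (Algebra.adjoin ℝ (fieldOps M (realScalars N))) := by
  refine hK.induction_on (p := fun K => ∃ (G : M → ℝ) (hG : ContMDiff (𝓡 4) 𝓘(ℝ, ℝ) ∞ G),
    (∀ x, 0 ≤ G x) ∧ (∀ x ∈ K, 0 < G x) ∧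
      mulOp (fun x => (Complex.I • gam a) ⊗ₖ ((G x : ℂ) • (1 : Matrix (FinIdx N) (FinIdx N) ℂ)))
        ((SmoothMat.const _).kron (smoothMat_ofReal_smul hG (SmoothMat.const 1))) ∈
      oneForms (dirac t y) (Algebra.adjoin ℝ (fieldOps M (realScalars N)))) ?_ ?_ ?_ ?_
  · refine ⟨fun _ => 0, contMDiff_const, fun _ => le_rfl, fun x hx => hx.elim, ?_⟩
    convert! Submodule.zero_mem _
    rw [← mulOp_zero]
    refine mulOp_congr fun x => ?_
    simp
  · rintro s s' hst ⟨G, hG, h0, h1, h2⟩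
    exact ⟨G, hG, h0, fun x hx => h1 x (hst hx), h2⟩
  · rintro s s' ⟨G, hG, h0, h1, h2⟩ ⟨G', hG', h0', h1', h2'⟩
    refine ⟨fun x => G x + G' x, hG.add hG', fun x => add_nonneg (h0 x) (h0' x), ?_, ?_⟩
    · rintro x (hx | hx)
      · exact add_pos_of_pos_of_nonneg (h1 x hx) (h0' x)
      · exact add_pos_of_nonneg_of_pos (h0 x) (h1' x hx)
    · convert! add_mem h2 h2' using 1
      rw [mulOp_add]
      refine mulOp_congr fun x => ?_
      rw [← Matrix.kronecker_add, ← add_smul, Complex.ofReal_add]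
  · intro p _
    obtain ⟨f, h, hf, hh, hfc, hhc, G, hG, h0, hpos, hsum⟩ := t.exists_local_coframe a p
    refine ⟨{x | 0 < G x}, mem_nhdsWithin_of_mem_nhds
      ((isOpen_lt continuous_const hG.continuous).mem_nhds hpos), G, hG, h0, fun x hx => hx, ?_⟩
    have e : mulOp (fun x => (Complex.I • gam a) ⊗ₖ
          ((G x : ℂ) • (1 : Matrix (FinIdx N) (FinIdx N) ℂ)))
        ((SmoothMat.const _).kron (smoothMat_ofReal_smul hG (SmoothMat.const 1))) =
        ∑ k, intOp (fun x => (f k x : ℂ) • 1)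
            (smoothMat_ofReal_smul (hf k) (SmoothMat.const 1)) *
          (dirac t y * intOp (fun x => (h k x : ℂ) • 1)
              (smoothMat_ofReal_smul (hh k) (SmoothMat.const 1)) -
            intOp (fun x => (h k x : ℂ) • 1)
              (smoothMat_ofReal_smul (hh k) (SmoothMat.const 1)) * dirac t y) := by
      simp only [fun k => real_commutator (N := N) t y (hh k)]
      simp only [intOp, mulOp_mul]
      rw [mulOp_sum Finset.univ fun k => ((SmoothMat.const (M := M) 1).kron
        (smoothMat_ofReal_smul (hf k) (SmoothMat.const 1))).mul
        (SmoothMat.sum _ fun b => (SmoothMat.const _).kron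
        (smoothMat_ofReal_smul (t.contMDiff_deriv b (hh k)) (SmoothMat.const 1)))]
      refine mulOp_congr fun x => ?_
      simp only [Finset.mul_sum, ← Matrix.mul_kronecker_mul, one_mul,
        Matrix.mul_smul, mul_one, smul_smul]
      rw [Finset.sum_comm]
      simp only [Matrix.kronecker_smul, ← Finset.sum_smul]
      have hs : ∀ b, ∑ k, (f k x : ℂ) * ((t.deriv b (h k) x : ℝ) : ℂ) =
          if b = a then (G x : ℂ) else 0 := by
        intro b
        have := congrArg (fun r : ℝ => (r : ℂ)) (hsum x b)
        simp only [Complex.ofReal_sum, Complex.ofReal_mul] at this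
        rw [this]
        split_ifs <;> simp
      simp only [mul_comm ((t.deriv _ _ _ : ℝ) : ℂ), hs, ite_smul, zero_smul, Finset.sum_ite_eq',
        Finset.mem_univ, if_true]
    rw [e]
    exact Submodule.sum_mem _ fun k _ => mul_commutator_mem_oneForms
      (Algebra.subset_adjoin (real_intOp_mem_fieldOps (hf k) (hfc k)))
      (Algebra.subset_adjoin (real_intOp_mem_fieldOps (hh k) (hhc k)))

/-- `∑ i γᵃ ⊗ B_a` is a one-form for fields `B_a` of compact support with values in `V`. By
`exists_pos_gamma_mem_oneForms`, `i γᵃ ⊗ G` is one for some `G` that is positive on the support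
of `B_a`, and `i γᵃ ⊗ B_a` is its multiple by the field `B_a / G`. -/
theorem gaugeOp_mem_oneForms (t : Tetrad M) (y : YukawaData N) (h1 : 1 ∈ V)
    (hV : ∀ r : ℝ, ∀ v ∈ V, (r : ℂ) • v ∈ V) {B : Fin 4 → M → Matrix (FinIdx N) (FinIdx N) ℂ}
    (hB : ∀ a, SmoothMat (B a)) (hc : ∀ a, HasCompactSupport (B a)) (hBV : ∀ a x, B a x ∈ V) :
    gaugeOp B hB ∈ oneForms (dirac t y) (Algebra.adjoin ℝ (fieldOps M V)) := by
  have hsum : gaugeOp B hB = ∑ a, mulOp (fun x => (Complex.I • gam a) ⊗ₖ B a x)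
      ((SmoothMat.const _).kron (hB a)) :=
    (mulOp_sum Finset.univ fun a => (SmoothMat.const _).kron (hB a)).symm
  rw [hsum]
  refine Submodule.sum_mem _ fun a _ => ?_
  obtain ⟨G, hG, -, hpos, hmem⟩ := exists_pos_gamma_mem_oneForms (N := N) t y a (hc a).isCompact
  have hreal : Algebra.adjoin ℝ (fieldOps M (realScalars N)) ≤
      Algebra.adjoin ℝ (fieldOps M V) := by
    refine Algebra.adjoin_mono (fieldOps_mono ?_)
    rintro _ ⟨r, rfl⟩
    exact hV r 1 h1
  -- The quotient `B_a / G` is smooth, because `G` is positive on the support of `B_a`.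
  let C : M → Matrix (FinIdx N) (FinIdx N) ℂ := fun x => (((G x)⁻¹ : ℝ) : ℂ) • B a x
  have hC : SmoothMat C := by
    intro i j x
    by_cases hx : x ∈ tsupport (B a)
    · have h2 : ContMDiffAt (𝓡 4) 𝓘(ℝ, ℝ) ∞ (fun x => (G x)⁻¹) x := (hG x).inv₀ (hpos x hx).ne'
      have h3 : ContMDiffAt (𝓡 4) 𝓘(ℝ, ℂ) ∞ (fun x => (((G x)⁻¹ : ℝ) : ℂ)) x :=
        Complex.ofRealCLM.contMDiff.contMDiffAt.comp x h2
      exact (ContDiff.contMDiff (contDiff_mul (𝕜 := ℝ) (𝔸 := ℂ))).contMDiffAt.comp x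
        (h3.prodMk_space (hB a i j x))
    · have h2 : (fun x => C x i j) =ᶠ[nhds x] fun _ => 0 := by
        filter_upwards [notMem_tsupport_iff_eventuallyEq.1 hx] with z hz
        simp [C, hz]
      exact contMDiffAt_const.congr_of_eventuallyEq h2
  have hCmem : intOp C hC ∈ fieldOps M V := by
    refine intOp_mem_fieldOps _ ⟨0, (hc a).mono fun x hx h0 => hx ?_⟩ fun x =>
      hV _ _ (hBV a x)
    simp [C, h0]
  have e : mulOp (fun x => (Complex.I • gam a) ⊗ₖ B a x) ((SmoothMat.const _).kron (hB a)) =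
      intOp C hC * mulOp (fun x => (Complex.I • gam a) ⊗ₖ ((G x : ℂ) • 1))
        ((SmoothMat.const _).kron (smoothMat_ofReal_smul hG (SmoothMat.const 1))) := by
    rw [intOp, mulOp_mul]
    refine mulOp_congr fun x => ?_
    rw [← Matrix.mul_kronecker_mul, one_mul, Matrix.mul_smul, mul_one, smul_smul]
    by_cases hx : x ∈ tsupport (B a)
    · rw [← Complex.ofReal_mul, mul_inv_cancel₀ (hpos x hx).ne', Complex.ofReal_one, one_smul]
    · rw [image_eq_zero_of_notMem_tsupport hx, smul_zero]
  rw [e]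
  exact mul_mem_oneForms (Algebra.subset_adjoin hCmem) (oneForms_mono hreal hmem)

end GaugePart

theorem SmoothMat.blocks_diagonal {d : M → Fin 4 → Matrix (GenIdx N) (GenIdx N) ℂ}
    (hd : ∀ i, SmoothMat (fun x => d x i)) :
    SmoothMat (fun x => NCSM.blocks (Matrix.diagonal (d x))) := by
  refine SmoothMat.blocks fun i j => ?_
  by_cases h : i = j
  · subst h
    simpa only [Matrix.diagonal_apply_eq] using hd i
  · simpa only [Matrix.diagonal_apply_ne _ h] using SmoothMat.const 0

theorem smoothMat_piF {q : M → ℍ[ℝ]} (hq : ContMDiff (𝓡 4) 𝓘(ℝ, ℍ[ℝ]) ∞ q) :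
    SmoothMat (fun x => piF N 0 (q x) 0) := by
  refine SmoothMat.blocks_diagonal fun i => ?_
  fin_cases i
  exacts [SmoothMat.const _, SmoothMat.tilde N (SmoothMat.quatMat hq), SmoothMat.const _,
    SmoothMat.const _]

theorem smoothMat_centralMat {z : M → ℂ} (hz : ContMDiff (𝓡 4) 𝓘(ℝ, ℂ) ∞ z) :
    SmoothMat (fun x => centralMat N 0 0 (z x) 0) := by
  have h : SmoothMat (fun x => lepCol N (z x) ((0 : ℂ) • 1)) := by
    refine SmoothMat.kron ?_ (SmoothMat.const 1)
    rintro (i | i) (j | j)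
    · exact contMDiff_cmul hz contMDiff_const
    · exact contMDiff_const
    · exact contMDiff_const
    · exact contMDiff_const
  refine SmoothMat.blocks_diagonal fun i => ?_
  fin_cases i
  exacts [SmoothMat.const _, SmoothMat.const _, h, h]

theorem contMDiff_star_quaternion {q : M → ℍ[ℝ]} (hq : ContMDiff (𝓡 4) 𝓘(ℝ, ℍ[ℝ]) ∞ q) :
    ContMDiff (𝓡 4) 𝓘(ℝ, ℍ[ℝ]) ∞ (fun x => star (q x)) :=
  (LinearMap.toContinuousLinearMap ({
    toFun := star
    map_add' := star_add
    map_smul' := fun r p => by ext <;> simp } : ℍ[ℝ] →ₗ[ℝ] ℍ[ℝ])).contMDiff.comp hq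

/-- The Higgs part is a one-form: `YukawaData.Phi_eq` writes it through a commutator with a constant
element of the algebra. -/
theorem oddOp_Phi_mem_oneForms (t : Tetrad M) (y : YukawaData N) {q : M → ℍ[ℝ]}
    (hq : ContMDiff (𝓡 4) 𝓘(ℝ, ℍ[ℝ]) ∞ q) (hc : ∃ c, HasCompactSupport fun x => q x - c) :
    oddOp (fun x => y.Phi (q x)) (SmoothMat.Phi y hq) ∈
      oneForms (dirac t y) (smAlgebra M N) := by
  obtain ⟨c, hc⟩ := hc
  have hq' := contMDiff_star_quaternion hq
  have e : oddOp (fun x => y.Phi (q x)) (SmoothMat.Phi y hq) =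
      intOp (fun x => piF N 0 (q x) 0) (smoothMat_piF hq) *
        (dirac t y * intOp (fun _ => piF N 1 0 0) (SmoothMat.const _) -
          intOp (fun _ => piF N 1 0 0) (SmoothMat.const _) * dirac t y) -
      (dirac t y * intOp (fun _ => piF N 1 0 0) (SmoothMat.const _) -
          intOp (fun _ => piF N 1 0 0) (SmoothMat.const _) * dirac t y) *
        intOp (fun x => piF N 0 (star (q x)) 0) (smoothMat_piF hq') := by
    rw [dirac_commutator_const, intOp, intOp, mulOp_mul, mulOp_mul, mulOp_sub]
    refine mulOp_congr fun x => ?_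
    rw [← Matrix.mul_kronecker_mul, ← Matrix.mul_kronecker_mul, one_mul, mul_one]
    beta_reduce
    rw [y.Phi_eq]
    exact ((kronL chiS).map_sub _ _).trans (sub_eq_add_neg _ _)
  have h1 : intOp (fun x => piF N 0 (q x) 0) (smoothMat_piF hq) ∈ smAlgebra M N :=
    Algebra.subset_adjoin (intOp_mem_fieldOps _
      ⟨_, hasCompactSupport_map_sub hc fun p => piF N 0 p 0⟩ fun x => ⟨_, _, _, rfl⟩)
  have h2 : intOp (fun x => piF N 0 (star (q x)) 0) (smoothMat_piF hq') ∈ smAlgebra M N :=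
    Algebra.subset_adjoin (intOp_mem_fieldOps _
      ⟨_, hasCompactSupport_map_sub hc fun p => piF N 0 (star p) 0⟩ fun x => ⟨_, _, _, rfl⟩)
  have h3 : intOp (fun _ : M => piF N 1 0 0) (SmoothMat.const _) ∈ smAlgebra M N :=
    Algebra.subset_adjoin (intOp_mem_fieldOps _
      ⟨piF N 1 0 0, by simp only [sub_self]; exact HasCompactSupport.zero⟩ fun x => ⟨_, _, _, rfl⟩)
  rw [e]
  exact sub_mem (mul_commutator_mem_oneForms h1 h3) (commutator_mul_mem_oneForms h2 h3)

/-- The part `σ` is a one-form of the algebra of central fields, by `YukawaData.sigma_eq`. -/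
theorem oddOp_sigma_mem_oneForms (t : Tetrad M) (y : YukawaData N) {z : M → ℂ}
    (hz : ContMDiff (𝓡 4) 𝓘(ℝ, ℂ) ∞ z) (hc : ∃ c, HasCompactSupport fun x => z x - c) :
    oddOp (fun x => y.sigma (z x)) (SmoothMat.sigma y hz) ∈
      oneForms (dirac t y) (Algebra.adjoin ℝ (fieldOps M (centralSet N))) := by
  obtain ⟨c, hc⟩ := hc
  have hz' : ContMDiff (𝓡 4) 𝓘(ℝ, ℂ) ∞ (fun x => star (z x)) :=
    contMDiff_linear hz Complex.conjAe.toLinearMap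
  have e : oddOp (fun x => y.sigma (z x)) (SmoothMat.sigma y hz) =
      intOp (fun x => centralMat N 0 0 (-z x) 0) (smoothMat_centralMat hz.neg) *
        (dirac t y * intOp (fun _ => centralMat N 0 0 1 0) (SmoothMat.const _) -
          intOp (fun _ => centralMat N 0 0 1 0) (SmoothMat.const _) * dirac t y) +
      (dirac t y * intOp (fun _ => centralMat N 0 0 1 0) (SmoothMat.const _) -
          intOp (fun _ => centralMat N 0 0 1 0) (SmoothMat.const _) * dirac t y) *
        intOp (fun x => centralMat N 0 0 (star (z x)) 0) (smoothMat_centralMat hz') := by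
    rw [dirac_commutator_const, intOp, intOp, mulOp_mul, mulOp_mul, mulOp_add]
    refine mulOp_congr fun x => ?_
    rw [← Matrix.mul_kronecker_mul, ← Matrix.mul_kronecker_mul, one_mul, mul_one]
    beta_reduce
    rw [y.sigma_eq]
    exact (kronL chiS).map_add _ _
  have h1 : intOp (fun x => centralMat N 0 0 (-z x) 0) (smoothMat_centralMat hz.neg) ∈
      Algebra.adjoin ℝ (fieldOps M (centralSet N)) :=
    Algebra.subset_adjoin (intOp_mem_fieldOps _
      ⟨_, hasCompactSupport_map_sub hc fun p => centralMat N 0 0 (-p) 0⟩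
      fun x => ⟨_, _, _, _, rfl⟩)
  have h2 : intOp (fun x => centralMat N 0 0 (star (z x)) 0) (smoothMat_centralMat hz') ∈
      Algebra.adjoin ℝ (fieldOps M (centralSet N)) :=
    Algebra.subset_adjoin (intOp_mem_fieldOps _
      ⟨_, hasCompactSupport_map_sub hc fun p => centralMat N 0 0 (star p) 0⟩
      fun x => ⟨_, _, _, _, rfl⟩)
  have h3 : intOp (fun _ : M => centralMat N 0 0 1 0) (SmoothMat.const _) ∈
      Algebra.adjoin ℝ (fieldOps M (centralSet N)) :=
    Algebra.subset_adjoin (intOp_mem_fieldOps _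
      ⟨centralMat N 0 0 1 0, by simp only [sub_self]; exact HasCompactSupport.zero⟩ fun x => ⟨_, _, _, _, rfl⟩)
  rw [e]
  exact add_mem (mul_commutator_mem_oneForms h1 h3) (commutator_mul_mem_oneForms h2 h3)

theorem SMFields.form_mem_oneForms [T2Space M] {y : YukawaData N} (t : Tetrad M)
    (f : SMFields M y) : f.form ∈ oneForms (dirac t y) (smAlgebra M N) := by
  obtain ⟨c, hc⟩ := f.q_const
  refine add_mem (gaugeOp_mem_oneForms t y one_mem_AF (fun r v hv => smul_mem_AF r hv)
    f.A_smooth f.A_compact f.A_mem) (oddOp_Phi_mem_oneForms t y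
      (f.q_smooth.sub contMDiff_const)
      ⟨c - 1, hasCompactSupport_map_sub hc fun p => p - 1⟩)

theorem BLFields.form_mem_oneForms [T2Space M] (t : Tetrad M) (y : YukawaData N)
    (b : BLFields M) :
    b.form y ∈ oneForms (dirac t y) (Algebra.adjoin ℝ (fieldOps M (centralSet N))) := by
  obtain ⟨c, hc⟩ := b.z_const
  refine add_mem (gaugeOp_mem_oneForms t y one_mem_centralSet
    (fun r v hv => smul_mem_centralSet r hv) _
    (fun a => (b.Z_compact a).mono fun x hx h0 => hx (by simp [h0]))
    (fun a x => smul_mem_centralSet _ tBL_mem_centralSet)) (oddOp_sigma_mem_oneForms t y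
      (b.z_smooth.sub contMDiff_const)
      ⟨c - 1, hasCompactSupport_map_sub hc fun p => p - 1⟩)

theorem smAlgebra_le_internal : smAlgebra M N ≤ internal M N :=
  Algebra.adjoin_le fieldOps_subset_internal

section HatAlgebra
variable [T2Space M] [SigmaCompactSpace M]

theorem opp_opp_intOp (t : Tetrad M) (y : YukawaData N)
    {B : M → Matrix (FinIdx N) (FinIdx N) ℂ} (hB : SmoothMat B) :
    opp t y (opp t y (intOp B hB)) = intOp B hB := by
  rw [opp_intOp, opp_intOp]
  exact mulOp_congr fun x => congrArg _ (y.oppF_oppF (B x))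

theorem opp_image_fieldOps_subset (t : Tetrad M) (y : YukawaData N) :
    opp t y '' fieldOps M V ⊆ fieldOps M (y.oppF '' V) := by
  rintro _ ⟨_, ⟨B, hB, hc, hV, rfl⟩, rfl⟩
  rw [show mulOp (fun x => 1 ⊗ₖ B x) ((SmoothMat.const _).kron hB) = intOp B hB from rfl,
    opp_intOp]
  exact intOp_map_mem_fieldOps hB hc (y.oppF.restrictScalars ℝ) fun x => ⟨_, hV x, rfl⟩

theorem opp_image_fieldOps_subset_internal (t : Tetrad M) (y : YukawaData N) :
    opp t y '' fieldOps M V ⊆ internal M N :=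
  (opp_image_fieldOps_subset t y).trans fieldOps_subset_internal

theorem hatAlgebraExt_le_internal (t : Tetrad M) (y : YukawaData N) :
    hatAlgebraExt t y ≤ internal M N :=
  Algebra.adjoin_le (Set.union_subset fieldOps_subset_internal
    (opp_image_fieldOps_subset_internal t y))

/-- The hat algebra is stable under `T ↦ T^o`, which exchanges its two sets of generators. -/
theorem opp_mem_hatAlgebraExt (t : Tetrad M) (y : YukawaData N) :
    ∀ a ∈ hatAlgebraExt t y, opp t y a ∈ hatAlgebraExt t y := by
  intro a ha
  have h := (oppData t y).adjoin (Set.union_subset fieldOps_subset_internal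
    (opp_image_fieldOps_subset_internal t y)) a ha
  refine Algebra.adjoin_mono ?_ h
  rw [Set.image_union, Set.union_comm]
  refine Set.union_subset_union_left _ ?_
  rintro _ ⟨_, ⟨T, hT, rfl⟩, rfl⟩
  obtain ⟨B, hB, rfl⟩ := fieldOps_subset_internal hT
  rwa [opp_opp_intOp]

theorem smAlgebra_le_hatAlgebraExt (t : Tetrad M) (y : YukawaData N) :
    smAlgebra M N ≤ hatAlgebraExt t y := by
  refine Algebra.adjoin_mono (Set.Subset.trans (fieldOps_mono ?_) Set.subset_union_left)
  rintro _ ⟨l, q, m, rfl⟩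
  exact ⟨l, q, m, l, rfl⟩

/-- A central field `B` is `P B + (P B^o)^o`, where `P` is the projection to `K_R̄ ⊕ K_L̄`, and both
`P B` and `P B^o` belong to the extended background. -/
theorem central_le_hatAlgebraExt (t : Tetrad M) (y : YukawaData N) :
    Algebra.adjoin ℝ (fieldOps M (centralSet N)) ≤ hatAlgebraExt t y := by
  refine Algebra.adjoin_le ?_
  rintro _ ⟨B, hB, hc, hV, rfl⟩
  let P : Matrix (FinIdx N) (FinIdx N) ℂ →ₗ[ℝ] Matrix (FinIdx N) (FinIdx N) ℂ :=
    LinearMap.mulLeft ℝ (centralMat N 0 0 1 1)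
  have hP : ∀ v ∈ centralSet N, P v ∈ AFExt N := by
    rintro _ ⟨α, β, γ, δ, rfl⟩
    refine ⟨0, 0, δ • 1, γ, ?_⟩
    rw [piFExt_zero_zero]
    change centralMat N 0 0 1 1 * _ = _
    rw [centralMat_mul, zero_mul, zero_mul, one_mul, one_mul]
  have ho : ∀ v ∈ centralSet N, y.oppF v ∈ centralSet N := by
    rintro _ ⟨α, β, γ, δ, rfl⟩
    exact ⟨_, _, _, _, y.oppF_centralMat _ _ _ _⟩
  have hdec : ∀ v ∈ centralSet N, v = P v + y.oppF (P (y.oppF v)) := by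
    rintro _ ⟨α, β, γ, δ, rfl⟩
    change _ = centralMat N 0 0 1 1 * _ + y.oppF (centralMat N 0 0 1 1 * _)
    rw [y.oppF_centralMat, centralMat_mul, centralMat_mul, y.oppF_centralMat, centralMat_add]
    simp
  let P' : Matrix (FinIdx N) (FinIdx N) ℂ →ₗ[ℝ] Matrix (FinIdx N) (FinIdx N) ℂ :=
    P ∘ₗ y.oppF.restrictScalars ℝ
  have h1 : intOp (fun x => P (B x)) (hB.map_linear P) ∈ hatAlgebraExt t y :=
    Algebra.subset_adjoin (.inl (intOp_map_mem_fieldOps hB hc P fun x => hP _ (hV x)))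
  have h2 : opp t y (intOp (fun x => P' (B x)) (hB.map_linear P')) ∈ hatAlgebraExt t y :=
    Algebra.subset_adjoin (.inr ⟨_, intOp_map_mem_fieldOps hB hc P' fun x =>
      hP _ (ho _ (hV x)), rfl⟩)
  have e : mulOp (fun x => 1 ⊗ₖ B x) ((SmoothMat.const _).kron hB) =
      intOp (fun x => P (B x)) (hB.map_linear P) +
        opp t y (intOp (fun x => P' (B x)) (hB.map_linear P')) := by
    rw [opp_intOp, intOp, intOp, mulOp_add]
    refine mulOp_congr fun x => ?_
    rw [← Matrix.kronecker_add]
    exact congrArg _ (hdec _ (hV x))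
  change mulOp (fun x => 1 ⊗ₖ B x) ((SmoothMat.const _).kron hB) ∈ hatAlgebraExt t y
  rw [e]
  exact add_mem h1 h2

theorem exists_isKreinAdj (t : Tetrad M) (y : YukawaData N) {T : Op M N}
    (hT : T ∈ zeroOrder M N) : ∃ B, IsKreinAdj t y T B := by
  obtain ⟨S, hS, rfl⟩ := hT
  exact ⟨_, isKreinAdj_mulOp t y hS⟩

end HatAlgebra
end FieldAlgebras

end
end NCSM

open NCSM in
theorem mainTheorem4 {M : Type*} [TopologicalSpace M] [ChartedSpace NCSM.E4 M]
    [IsManifold (𝓡 4) ∞ M] [T2Space M] [SigmaCompactSpace M] (t : NCSM.Tetrad M) {N : ℕ}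
    (y : NCSM.YukawaData N) (f : NCSM.SMFields M y) (b : NCSM.BLFields M) :
    f.form ∈ NCSM.oneForms (NCSM.dirac t y) (NCSM.smAlgebra M N) ∧
    (∃ B, NCSM.IsKreinAdj t y f.form B) ∧
    ∃ (h₁ : f.form ∈ NCSM.oneForms (NCSM.dirac t y) (NCSM.hatAlgebraExt t y))
      (h₂ : b.form y ∈ NCSM.oneForms (NCSM.dirac t y) (NCSM.hatAlgebraExt t y))
      (h₃ : f.form + NCSM.opp t y f.form + b.form y ∈
        NCSM.oneForms (NCSM.dirac t y) (NCSM.hatAlgebraExt t y)),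
      ∀ R : NCSM.Op M N,
        NCSM.modJunk (NCSM.dirac t y) (NCSM.hatAlgebraExt t y) R =
          NCSM.curvature (NCSM.dirac t y) (NCSM.hatAlgebraExt t y) ⟨f.form, h₁⟩ →
        (∃ B, NCSM.IsKreinAdj t y R B) ∧
        NCSM.curvature (NCSM.dirac t y) (NCSM.hatAlgebraExt t y)
            ⟨f.form + NCSM.opp t y f.form + b.form y, h₃⟩ =
          NCSM.modJunk (NCSM.dirac t y) (NCSM.hatAlgebraExt t y) R +
          NCSM.modJunk (NCSM.dirac t y) (NCSM.hatAlgebraExt t y) (NCSM.opp t y R) +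
          NCSM.curvature (NCSM.dirac t y) (NCSM.hatAlgebraExt t y) ⟨b.form y, h₂⟩ := by
  have H := oppData (N := N) t y
  have hf := f.form_mem_oneForms t
  have hb := b.form_mem_oneForms t y
  have hsm := smAlgebra_le_hatAlgebraExt t y
  have hcen := central_le_hatAlgebraExt t y
  have hint := hatAlgebraExt_le_internal t y
  have hopp := opp_mem_hatAlgebraExt t y
  -- The opposite of the Standard Model algebra.
  let A' := Algebra.adjoin ℝ (opp t y '' fieldOps M (AF N))
  have hA' : A' ≤ hatAlgebraExt t y := by
    refine Algebra.adjoin_le ?_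
    rintro _ ⟨T, hT, rfl⟩
    exact hopp T (hsm (Algebra.subset_adjoin hT))
  have hof : opp t y f.form ∈ oneForms (dirac t y) A' :=
    H.map_mem_oneForms smAlgebra_le_internal (H.adjoin fieldOps_subset_internal) hf
  have hj₁ : OrderOne (dirac t y) (smAlgebra M N : Set (Op M N)) (A' : Set (Op M N)) :=
    OrderOne.adjoin fun T hT S hS =>
      orderOne_fieldOps t y (fun v hv w hw => y.finOrderOne_AF_oppF hv hw) T hT S
        (opp_image_fieldOps_subset t y hS)
  have hj₂ : OrderOne (dirac t y) (smAlgebra M N : Set (Op M N))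
      (Algebra.adjoin ℝ (fieldOps M (centralSet N)) : Subalgebra ℝ (Op M N)) :=
    OrderOne.adjoin (orderOne_fieldOps t y fun v hv w hw => y.finOrderOne_AF_central hv hw)
  have hj₃ : OrderOne (dirac t y) (A' : Set (Op M N))
      (Algebra.adjoin ℝ (fieldOps M (centralSet N)) : Subalgebra ℝ (Op M N)) :=
    OrderOne.adjoin fun T hT =>
      orderOne_fieldOps t y (fun v hv w hw => y.finOrderOne_oppF_central hv hw) T
        (opp_image_fieldOps_subset t y hT)
  have h₁ := oneForms_mono hsm hf
  have h₂ := oneForms_mono hcen hb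
  have h₃ := add_mem (add_mem h₁ (oneForms_mono hA' hof)) h₂
  refine ⟨hf, exists_isKreinAdj t y ?_, h₁, h₂, h₃, fun R hR => ?_⟩
  · obtain ⟨T, hT⟩ := h₁
    rw [← hT]
    exact (H.exists_lift hint hopp T).1
  · have key := H.curvature_add hint hopp h₁ h₂ h₃ (hj₁.anticommutator_mem_junk hsm hA' hf hof)
      (hj₂.anticommutator_mem_junk hsm hcen hf hb) (hj₃.anticommutator_mem_junk hA' hcen hof hb)
      R hR
    exact ⟨exists_isKreinAdj t y key.1, key.2⟩
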